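/- **Setting.** Let $U=\mathbb A^m\times\mathbb P^{a_1}\times\cdots\times\mathbb P^{a_k}$ over $\mathbb C$ (in particular $U$ may be an affine space or a product of projective spaces), with affine and homogeneous coordinates $x=(x_s)$. Let $\psi=(\psi_1,\dots,\psi_n)$ be polynomials in $x$, multihomogeneous of one common multidegree in the coordinates of the projective factors, representing a birational map $\psi:U\dashrightarrow V$ onto a projective variety $V\subseteq\mathbb P^{n-1}$; thus $V$ is the Zariski closure of the image and there is a rational inverse $V\dashrightarrow U$. Let $V_{\rm reg}$ be the regular locus of $V$ and $Q=\{\psi^T\psi=0\}$ the isotropic quadric. For $H\in\mathrm{Sym}^2(\mathbb C^n)$ put $R_H(x)=\dfrac{\psi(x)^TH\psi(x)}{\psi(x)^T\psi(x)}$. * A *critical point of $R_H$* is a point $x\in\psi^{-1}(V_{\rm reg}\setminus Q)$ with $\nabla_xR_H(x)=0$. * The *critical ideal* is $J_{\rm crit}(V,H)=\big\langle(\psi(x)^T\psi(x))^2\,\nabla_xR_H(x)\big\rangle:(\psi(x)^T\psi(x))^\infty$; its zero set is taken in $U$. * The *Rayleigh–Ritz (RR) degree* of $V$ is the number, for general $H\in\mathrm{Sym}^2(\mathbb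 C^n)$, of points $p\in V_{\rm reg}\setminus Q$ at which the gradient of $\frac{p^THp}{p^Tp}$ annihilates the tangent space $T_pV$. "For general $H$" means: for all $H$ outside the zero set of some polynomial that is not identically zero on $\mathrm{Sym}^2(\mathbb C^n)$. * $\psi$ is *immersive at $x$* if the differential at $x$ of the map to $\mathbb P^{n-1}$ is injective, i.e. $\psi(x)$ and the columns of $\mathrm{Jac}(\psi)(x)$ span a space of dimension $\dim U+1$. **Proposition.** 1. For every $H\in\mathrm{Sym}^2(\mathbb C^n)$, the set of critical points of $R_H$ is the part of the zero set of $J_{\rm crit}(V,H)$ that lies in $\psi^{-1}(V_{\rm reg}\setminus Q)$. Moreover, the zero set of $J_{\rm crit}(V,H)$ is the Zariski closure in $U$ of $\{x:\psi(x)^T\psi(x)\ne0,\ \nabla_xR_H(x)=0\}$. 2. If $\psi$ is immersive at every point with $\psi(x)^T\psi(x)\neq0$, then for general $H$ the set of critical points of $R_H$ is equal to the zero set of $J_{\rm crit}(V,H)$. 3. The RR degree of $V$ is well defined (the number of critical points on $V$ is finite and the same for all general $H$), and for general $H$ the number of critical points of $R_H$ at which $\psi$ is immersive is finite and equal to the RR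 degree of $V$. In particular, if $\psi$ is immersive at every point of $\psi^{-1}(V_{\rm reg}\setminus Q)$, then for general $H$ the number of critical points of $R_H$ is equal to the RR degree of $V$. -/

import Mathlib

open MvPolynomial

noncomputable section

namespace RayleighRitz

/-! ### Projective varieties and the Rayleigh quotient -/

/-- The complex projective space `ℙ^{n-1}`. -/
abbrev PSpace (n : ℕ) : Type := Projectivization ℂ (Fin n → ℂ)

/-- The affine cone (without the origin) over a set of points of `ℙ^{n-1}`. -/
def cone {n : ℕ} (V : Set (PSpace n)) : Set (Fin n → ℂ) :=
  {v | ∃ hv : v ≠ 0, Projectivization.mk ℂ v hv ∈ V}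

/-- The defining ideal `I_V`: all polynomials that vanish on the affine cone over `V`.
It is homogeneous and radical, and for nonempty `V` it is the usual homogeneous vanishing ideal. -/
def definingIdeal {n : ℕ} (V : Set (PSpace n)) : Ideal (MvPolynomial (Fin n) ℂ) :=
  vanishingIdeal ℂ (cone V)

/-- The Zariski closure of a set of points of `ℙ^{n-1}`. -/
def projClosure {n : ℕ} (S : Set (PSpace n)) : Set (PSpace n) :=
  {p | ∀ f ∈ definingIdeal S, eval p.rep f = 0}

/-- The Zariski tangent space at `v` of the affine cone over `V`, i.e. the kernel of the Jacobian
matrix of `I_V` at `v`. -/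
def coneTangent {n : ℕ} (V : Set (PSpace n)) (v : Fin n → ℂ) : Submodule ℂ (Fin n → ℂ) where
  carrier := {w | ∀ f ∈ definingIdeal V, ∑ j, eval v (pderiv j f) * w j = 0}
  zero_mem' := by intro f _; simp
  add_mem' := by
    intro w w' hw hw' f hf
    simp [mul_add, Finset.sum_add_distrib, hw f hf, hw' f hf]
  smul_mem' := by
    intro c w hw f hf
    have h := hw f hf
    simp only [Pi.smul_apply, smul_eq_mul]
    rw [← mul_zero c, ← h, Finset.mul_sum]
    exact Finset.sum_congr rfl fun j _ => by ring

/-- The nonzero vectors that represent a regular point of the irreducible projective variety `V`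
(Jacobian criterion).  The transcendence degree of the homogeneous coordinate ring is the dimension
of the affine cone, that is `dim V + 1`. -/
def regCone {n : ℕ} (V : Set (PSpace n)) : Set (Fin n → ℂ) :=
  {v | v ∈ cone V ∧ (Module.finrank ℂ (coneTangent V v) : Cardinal) =
    Algebra.trdeg ℂ (MvPolynomial (Fin n) ℂ ⧸ definingIdeal V)}

/-- The Rayleigh quotient `ψᵀ H ψ / ψᵀ ψ`. -/
def rayleigh {n : ℕ} (H : Matrix (Fin n) (Fin n) ℂ) (v : Fin n → ℂ) : ℂ :=
  (v ⬝ᵥ H.mulVec v) / (v ⬝ᵥ v)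

/-- The complex critical points of the Rayleigh quotient on `V`: the regular, non-isotropic points
of `V` at which the gradient of the Rayleigh quotient is orthogonal to the tangent space of `V`
(with respect to the bilinear form `vᵀ w`). The conditions do not depend on the representative. -/
def critPoints {n : ℕ} (V : Set (PSpace n)) (H : Matrix (Fin n) (Fin n) ℂ) : Set (PSpace n) :=
  {p | p.rep ∈ regCone V ∧ p.rep ⬝ᵥ p.rep ≠ 0 ∧
    ∀ w ∈ coneTangent V p.rep, fderiv ℂ (rayleigh H) p.rep w = 0}

/-- A property holds for a general symmetric matrix `H ∈ Sym²(ℂⁿ)`: it holds off the zero set of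
some polynomial in the entries of `H` that does not vanish identically on `Sym²(ℂⁿ)`. -/
def ForGeneralSymm (n : ℕ) (P : Matrix (Fin n) (Fin n) ℂ → Prop) : Prop :=
  ∃ F : MvPolynomial (Fin n × Fin n) ℂ,
    (∃ H : Matrix (Fin n) (Fin n) ℂ, H.IsSymm ∧ eval (fun ij => H ij.1 ij.2) F ≠ 0) ∧
    ∀ H : Matrix (Fin n) (Fin n) ℂ, H.IsSymm → eval (fun ij => H ij.1 ij.2) F ≠ 0 → P H

/-- `d` is the Rayleigh-Ritz degree of `V`: for a general complex symmetric matrix `H` there are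
exactly `d` complex critical points. -/
def IsRRDegree {n : ℕ} (V : Set (PSpace n)) (d : ℕ) : Prop :=
  ForGeneralSymm n fun H => (critPoints V H).Finite ∧ (critPoints V H).ncard = d

/-! ### The parameter space `U = 𝔸^m × ∏ᵢ ℙ^{aᵢ}`

No projective factors (`k = 0`): affine space. No affine factor (`m = 0`): a product of projective
spaces. -/

/-- Indices of the (affine and homogeneous) coordinates on `𝔸^m × ∏ᵢ ℙ^{aᵢ}`. -/
abbrev CoordIdx (m : ℕ) {k : ℕ} (a : Fin k → ℕ) : Type := Fin m ⊕ (Σ i : Fin k, Fin (a i + 1))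

/-- The points of `𝔸^m × ∏ᵢ ℙ^{aᵢ}`. -/
abbrev ParamSpace (m : ℕ) {k : ℕ} (a : Fin k → ℕ) : Type :=
  (Fin m → ℂ) × (∀ i : Fin k, Projectivization ℂ (Fin (a i + 1) → ℂ))

section Param

variable {n m k : ℕ} {a : Fin k → ℕ}

/-- `x` is a vector of (affine and homogeneous) coordinates of the point `u`. -/
def IsCoord (u : ParamSpace m a) (x : CoordIdx m a → ℂ) : Prop :=
  (∀ j, x (Sum.inl j) = u.1 j) ∧
    ∀ i, ∃ h : (fun s => x (Sum.inr ⟨i, s⟩)) ≠ 0, Projectivization.mk ℂ _ h = u.2 i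

/-- A choice of coordinates of `u`. -/
def coords (u : ParamSpace m a) : CoordIdx m a → ℂ :=
  Sum.elim u.1 fun s => (u.2 s.1).rep s.2

theorem isCoord_coords (u : ParamSpace m a) : IsCoord u (coords u) :=
  ⟨fun _ => rfl, fun i => ⟨(u.2 i).rep_nonzero, (u.2 i).mk_rep⟩⟩

/-- The zero set in `U` of an ideal of the (multihomogeneous) coordinate ring. -/
def zeroSet (J : Ideal (MvPolynomial (CoordIdx m a) ℂ)) : Set (ParamSpace m a) :=
  {u | ∀ x, IsCoord u x → ∀ f ∈ J, eval x f = 0}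

/-- The Zariski closure of a subset of `U`. -/
def paramClosure (S : Set (ParamSpace m a)) : Set (ParamSpace m a) :=
  zeroSet (vanishingIdeal ℂ {x : CoordIdx m a → ℂ | ∃ u ∈ S, IsCoord u x})

/-- The weight that gives degree one to the coordinates of the `i`-th projective factor, and degree
zero to all others. -/
def blockWeight (i : Fin k) : CoordIdx m a → ℕ :=
  Sum.elim (fun _ => 0) fun s => if s.1 = i then 1 else 0

/-- The vector `ψ(x)`. -/
def evalMap (ψ : Fin n → MvPolynomial (CoordIdx m a) ℂ) (x : CoordIdx m a → ℂ) : Fin n → ℂ :=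
  fun j => eval x (ψ j)

/-- The image in `ℙ^{n-1}` of the domain `{ψ ≠ 0}` of the rational map given by `ψ`. -/
def imageSet (ψ : Fin n → MvPolynomial (CoordIdx m a) ℂ) : Set (PSpace n) :=
  {p | ∃ u : ParamSpace m a, ∃ h : evalMap ψ (coords u) ≠ 0, p = Projectivization.mk ℂ _ h}

/-- `ψ` represents a birational map `U ⇢ V`; here `V` is automatically an irreducible projective
variety, being the closure of the image. -/
structure IsBirationalParam (ψ : Fin n → MvPolynomial (CoordIdx m a) ℂ)
    (V : Set (PSpace n)) : Prop where
  /-- The entries of `ψ` are multihomogeneous, of one common multidegree, in the coordinates of the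
  projective factors. -/
  multihomogeneous : ∃ d : Fin k → ℕ, ∀ i j, IsWeightedHomogeneous (blockWeight i) (ψ j) (d i)
  /-- `V` is the Zariski closure of the image: the map is dominant. -/
  eq_closure : V = projClosure (imageSet ψ)
  /-- There is a rational map `φ : V ⇢ U` with `φ ∘ ψ = id`: its affine coordinates are quotients
  `g j / g₀` of forms of the same degree, its coordinates in each projective factor are forms of the
  same degree that do not all vanish on `V`. -/
  exists_inverse : ∃ (g₀ : MvPolynomial (Fin n) ℂ) (g : CoordIdx m a → MvPolynomial (Fin n) ℂ)
    (e₀ : ℕ) (e : Fin k → ℕ),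
    g₀.IsHomogeneous e₀ ∧ (∀ j, (g (Sum.inl j)).IsHomogeneous e₀) ∧
    (∀ i s, (g (Sum.inr ⟨i, s⟩)).IsHomogeneous (e i)) ∧
    g₀ ∉ definingIdeal V ∧ (∀ i, ∃ s, g (Sum.inr ⟨i, s⟩) ∉ definingIdeal V) ∧
    (∀ j, aeval ψ (g (Sum.inl j)) = X (Sum.inl j) * aeval ψ g₀) ∧
    (∀ i s t, aeval ψ (g (Sum.inr ⟨i, s⟩)) * X (Sum.inr ⟨i, t⟩) =
      aeval ψ (g (Sum.inr ⟨i, t⟩)) * X (Sum.inr ⟨i, s⟩))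

/-- The open set `ψ⁻¹(V_reg \ Q)` of `U`, where `Q` is the isotropic quadric `ψᵀψ = 0`. -/
def regNonIsotropic (ψ : Fin n → MvPolynomial (CoordIdx m a) ℂ) (V : Set (PSpace n)) :
    Set (ParamSpace m a) :=
  {u | evalMap ψ (coords u) ∈ regCone V ∧
    evalMap ψ (coords u) ⬝ᵥ evalMap ψ (coords u) ≠ 0}

/-- The points of `U` with `ψ(x)ᵀψ(x) ≠ 0`. -/
def nonIsotropic (ψ : Fin n → MvPolynomial (CoordIdx m a) ℂ) : Set (ParamSpace m a) :=
  {u | evalMap ψ (coords u) ⬝ᵥ evalMap ψ (coords u) ≠ 0}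

/-- The gradient at `u` of the parametric Rayleigh quotient `R_H(x) = ψ(x)ᵀHψ(x) / ψ(x)ᵀψ(x)`
vanishes. -/
def GradVanishes (ψ : Fin n → MvPolynomial (CoordIdx m a) ℂ) (H : Matrix (Fin n) (Fin n) ℂ)
    (u : ParamSpace m a) : Prop :=
  fderiv ℂ (fun x : CoordIdx m a → ℂ => rayleigh H (evalMap ψ x)) (coords u) = 0

/-- The critical points of the parametric Rayleigh quotient: the points of `ψ⁻¹(V_reg \ Q)` where
its gradient vanishes. -/
def paramCritPoints (ψ : Fin n → MvPolynomial (CoordIdx m a) ℂ) (V : Set (PSpace n))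
    (H : Matrix (Fin n) (Fin n) ℂ) : Set (ParamSpace m a) :=
  {u | u ∈ regNonIsotropic ψ V ∧ GradVanishes ψ H u}

/-- `ψ` is immersive at `u`: the differential at `u` of the map to `ℙ^{n-1}` is injective, i.e.
`ψ(x)` and the columns of the Jacobian matrix of `ψ` span a space of dimension `dim U + 1`. -/
def IsImmersiveAt (ψ : Fin n → MvPolynomial (CoordIdx m a) ℂ) (u : ParamSpace m a) : Prop :=
  Module.finrank ℂ (Submodule.span ℂ
    (insert (evalMap ψ (coords u))
      (Set.range fun (s : CoordIdx m a) (j : Fin n) => eval (coords u) (pderiv s (ψ j))))) =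
    m + ∑ i, a i + 1

/-- The polynomial `ψ(x)ᵀψ(x)`. -/
def denomPoly (ψ : Fin n → MvPolynomial (CoordIdx m a) ℂ) : MvPolynomial (CoordIdx m a) ℂ :=
  ∑ j, ψ j * ψ j

/-- The polynomial `ψ(x)ᵀHψ(x)`. -/
def numerPoly (ψ : Fin n → MvPolynomial (CoordIdx m a) ℂ) (H : Matrix (Fin n) (Fin n) ℂ) :
    MvPolynomial (CoordIdx m a) ℂ :=
  ∑ i, ∑ j, ψ i * C (H i j) * ψ j

/-- The saturation `I : f^∞`. -/
def saturation {R : Type*} [CommRing R] (I : Ideal R) (f : R) : Ideal R where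
  carrier := {g | ∃ N : ℕ, g * f ^ N ∈ I}
  zero_mem' := ⟨0, by simp⟩
  add_mem' := by
    rintro g g' ⟨N, hN⟩ ⟨N', hN'⟩
    refine ⟨N + N', ?_⟩
    have : (g + g') * f ^ (N + N') = f ^ N' * (g * f ^ N) + f ^ N * (g' * f ^ N') := by ring
    rw [this]
    exact I.add_mem (I.mul_mem_left _ hN) (I.mul_mem_left _ hN')
  smul_mem' := by
    rintro c g ⟨N, hN⟩
    exact ⟨N, by rw [smul_eq_mul, mul_assoc]; exact I.mul_mem_left _ hN⟩

/-- The critical ideal `⟨(ψᵀψ)² ∇ₓ R_H⟩ : (ψᵀψ)^∞`.  By the quotient rule the entry of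
`(ψᵀψ)² ∇ₓ R_H` for the coordinate `x_s` is `(ψᵀψ) ∂ₛ(ψᵀHψ) - (ψᵀHψ) ∂ₛ(ψᵀψ)`. -/
def critIdeal (ψ : Fin n → MvPolynomial (CoordIdx m a) ℂ) (H : Matrix (Fin n) (Fin n) ℂ) :
    Ideal (MvPolynomial (CoordIdx m a) ℂ) :=
  saturation
    (Ideal.span (Set.range fun s : CoordIdx m a =>
      denomPoly ψ * pderiv s (numerPoly ψ H) - numerPoly ψ H * pderiv s (denomPoly ψ)))
    (denomPoly ψ)

end Param

end RayleighRitz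

end

open RayleighRitz

/-! Part 1 is the quotient rule together with the Nullstellensatz. Off `ψᵀψ = 0` the generators of
the critical ideal vanish exactly where the gradient does. If `f` vanishes at all these points, then
a power of `f · ψᵀψ` lies in the unsaturated ideal, so a power of `f` lies in the saturation.

Parts 2 and 3 rest on a dimension count for the incidence of points and symmetric matrices. Put `N =
dim U`. Let `v` be nonisotropic and let `T ∋ v` be a tangent space of the cone, of dimension `N +
1`. Then `v` is critical for `H` iff `H v ∈ ⟨v⟩ + T^⊥`, which is `N` independent linear conditions
on `H`. So the incidence over an `N`-dimensional base has the dimension of `Sym²(ℂⁿ)`; `paramMat`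
writes it as an explicit polynomial family. There are two consequences for general `H`. Over a
proper closed subset of the base the incidence does not dominate `Sym²`, so no critical point lies
there: this is `generically_eval_ne_zero` in the charts of `U`, for immersive points, and
`generically_eval_rep_ne_zero` on `V`. And the number of critical points in a suitable open part of
a chart is finite and constant, as the size of a general fibre of a polynomial map between affine
spaces of equal dimension (`exists_ncard_fiber_eq`).

Birationality connects `U` with `V`. In a chart the inverse is defined wherever the form `goodForm`
does not vanish. Evaluating the inverse over the dual numbers shows that there `ψ` is immersive, its
values are regular points of `V`, and the tangent space of the cone is spanned by `ψ` and its
partial derivatives (`coneTangent_eq_jetSpan`). For general `H` the immersive critical points in `U`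
and all critical points on `V` lie in this common open set, so both have the same number `d`
(`exists_generically_ncard`). If `ψ` is immersive off the isotropic quadric, the zeros of the
gradient form a finite, hence closed, set that lies over the regular locus; this gives part 2. -/

noncomputable section

namespace RayleighRitz

/-! ### Transcendence degree and elimination -/

/-- If there are more elements than the transcendence degree, they satisfy a polynomial relation. -/
theorem exists_aeval_eq_zero_of_trdeg_lt {B κ : Type} [CommRing B] [Algebra ℂ B] (Φ : κ → B)
    (h : Algebra.trdeg ℂ B < Cardinal.mk κ) :
    ∃ F : MvPolynomial κ ℂ, F ≠ 0 ∧ aeval Φ F = 0 := by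
  by_contra hc
  push Not at hc
  have hi : AlgebraicIndependent ℂ Φ := by
    rw [algebraicIndependent_iff]
    intro p hp
    by_contra hne
    exact hc p hne hp
  exact absurd hi.cardinalMk_le_trdeg (not_le.mpr h)

/-- The transcendence degree drops under a non-injective surjection onto a domain. -/
theorem trdeg_lt_of_surjective_of_not_injective {S S' : Type} [CommRing S] [IsDomain S]
    [Algebra ℂ S] [Algebra.FiniteType ℂ S] [CommRing S'] [IsDomain S'] [Algebra ℂ S']
    (f : S →ₐ[ℂ] S') (hf : Function.Surjective f) {g : S} (hg : g ≠ 0) (hfg : f g = 0) :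
    Algebra.trdeg ℂ S' < Algebra.trdeg ℂ S := by
  refine lt_of_le_of_ne (trdeg_le_of_surjective f hf) fun heq => ?_
  obtain ⟨t, ht⟩ := exists_isTranscendenceBasis ℂ S'
  set y : t → S := fun a => Function.surjInv hf a with hy
  have hfy : ∀ a, f (y a) = a := fun a => Function.surjInv_eq hf _
  have hyi : AlgebraicIndependent ℂ y := by
    refine AlgebraicIndependent.of_comp f ?_
    convert ht.1 using 1
    funext a
    exact hfy a
  have hfin : Algebra.trdeg ℂ S < Cardinal.aleph0 := trdeg_lt_aleph0_of_finiteType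
  have hyb : IsTranscendenceBasis ℂ y := by
    refine hyi.isTranscendenceBasis_of_trdeg_le hfin ?_
    rw [← heq, ht.cardinalMk_eq_trdeg]
  have halg := hyb.isAlgebraic
  -- Equal transcendence degrees would make the lift `y` of a transcendence basis of `S'` a
  -- transcendence basis of `S`. Then `g` divides a nonzero polynomial in `y`, and applying `f`
  -- gives a relation between the elements of `t`.
  obtain ⟨r, hr0, hgr⟩ := (halg.isAlgebraic g).exists_nonzero_dvd (mem_nonZeroDivisors_of_ne_zero hg)
  obtain ⟨p, hp⟩ : ∃ p : MvPolynomial t ℂ, aeval y p = (r : S) := by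
    have h1 := r.2
    have h2 := Algebra.adjoin_range_eq_range_aeval ℂ y
    exact (SetLike.ext_iff.mp h2 (r : S)).mp h1
  have hp0 : p ≠ 0 := by
    rintro rfl
    apply hr0
    ext
    simpa using hp.symm
  have hz : f (r : S) = 0 := by
    obtain ⟨c, hc⟩ := hgr
    have : (r : S) = g * c := hc
    rw [this, map_mul, hfg, zero_mul]
  apply hp0
  refine (algebraicIndependent_iff.mp ht.1) p ?_
  have h2 : (Subtype.val : t → S') = fun a => f (y a) := funext fun a => (hfy a).symm
  rw [h2, ← hz, ← hp]
  exact (MvPolynomial.comp_aeval_apply y f p).symm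

theorem trdeg_quotient_lt_of_lt {ι : Type} [Finite ι] {P P' : Ideal (MvPolynomial ι ℂ)}
    [P.IsPrime] [P'.IsPrime] (h : P < P') :
    Algebra.trdeg ℂ (MvPolynomial ι ℂ ⧸ P') < Algebra.trdeg ℂ (MvPolynomial ι ℂ ⧸ P) := by
  obtain ⟨g, hg', hg⟩ := SetLike.exists_of_lt h
  refine trdeg_lt_of_surjective_of_not_injective (Ideal.Quotient.factorₐ ℂ h.le)
    (Ideal.Quotient.factor_surjective h.le) (g := Ideal.Quotient.mk P g) ?_ ?_
  · rwa [Ne, Ideal.Quotient.eq_zero_iff_mem]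
  · simpa [Ideal.Quotient.eq_zero_iff_mem] using hg'

/-- Elimination for a prime: a polynomial map with `τ`-parameters over the zero locus of a prime
of small dimension has its image in a proper closed subset. -/
theorem exists_eval_eq_zero_of_prime {ι τ κ : Type} [Finite ι] [Finite τ] [Finite κ]
    (P : Ideal (MvPolynomial ι ℂ)) [P.IsPrime] {r : ℕ}
    (hr : Algebra.trdeg ℂ (MvPolynomial ι ℂ ⧸ P) ≤ r) (hc : r + Nat.card τ < Nat.card κ)
    (Φ : κ → MvPolynomial τ (MvPolynomial ι ℂ)) :
    ∃ F : MvPolynomial κ ℂ, F ≠ 0 ∧ ∀ z : ι → ℂ, (∀ f ∈ P, eval z f = 0) → ∀ s : τ → ℂ,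
      eval (fun j => eval₂ (eval z) s (Φ j)) F = 0 := by
  classical
  set q : MvPolynomial ι ℂ →ₐ[ℂ] MvPolynomial ι ℂ ⧸ P := Ideal.Quotient.mkₐ ℂ P
  have htr : Algebra.trdeg ℂ (MvPolynomial τ (MvPolynomial ι ℂ ⧸ P)) < Cardinal.mk κ := by
    have h1 := trdeg_add_eq ℂ (MvPolynomial ι ℂ ⧸ P) (A := MvPolynomial τ (MvPolynomial ι ℂ ⧸ P))
    rw [← h1, MvPolynomial.trdeg_of_isDomain]
    have hτ : Cardinal.mk τ = (Nat.card τ : Cardinal) := (Nat.cast_card (α := τ)).symm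
    have hκ : Cardinal.mk κ = (Nat.card κ : Cardinal) := (Nat.cast_card (α := κ)).symm
    rw [hτ, hκ, Cardinal.lift_id]
    refine lt_of_le_of_lt (add_le_add_left hr _) ?_
    exact_mod_cast hc
  -- The entries of `Φ` are dependent in the polynomial ring over the quotient by `P`. The relation
  -- specializes at each zero of `P`, because evaluation there factors through the quotient.
  obtain ⟨F, hF, hF0⟩ := exists_aeval_eq_zero_of_trdeg_lt
    (fun j => MvPolynomial.map q.toRingHom (Φ j)) htr
  refine ⟨F, hF, fun z hz s => ?_⟩
  let ev : (MvPolynomial ι ℂ ⧸ P) →ₐ[ℂ] ℂ := Ideal.Quotient.liftₐ P (aeval z) (by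
    intro f hf; simpa [aeval_eq_eval] using hz f hf)
  let χ : MvPolynomial τ (MvPolynomial ι ℂ ⧸ P) →+* ℂ := eval₂Hom ev.toRingHom s
  have hχ : χ.comp (algebraMap ℂ _) = RingHom.id ℂ := by
    ext x
    simp only [χ, RingHom.comp_apply, IsScalarTower.algebraMap_apply ℂ (MvPolynomial ι ℂ ⧸ P)
      (MvPolynomial τ (MvPolynomial ι ℂ ⧸ P)), MvPolynomial.algebraMap_eq, eval₂Hom_C]
    simp
  have := congrArg χ hF0
  rw [map_zero, aeval_def, hom_eval₂, hχ] at this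
  rw [← this, eval, coe_eval₂Hom]
  congr 1
  funext j
  simp only [χ, coe_eval₂Hom, eval₂_map]
  congr 1

/-! ### Cardinality of a general fibre -/

open Polynomial in
/-- Finitely many polynomials over the fraction field have a common denominator. -/
theorem exists_forall_mem_lifts {A K : Type} [CommRing A] [IsDomain A] [Field K] [Algebra A K]
    [IsFractionRing A K] (S : Finset K[X]) :
    ∃ (F : A) (hF : F ≠ 0), ∀ s ∈ S, s ∈ Polynomial.lifts
      (IsLocalization.Away.lift (S := Localization.Away F) F (g := algebraMap A K)
        (by simpa using hF : IsUnit (algebraMap A K F))) := by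
  classical
  obtain ⟨b, hb⟩ := IsLocalization.exist_integer_multiples_of_finset (nonZeroDivisors A)
    (S.biUnion fun s => s.coeffs)
  have hF : (b : A) ≠ 0 := nonZeroDivisors.ne_zero b.2
  refine ⟨b, hF, fun s hs => ?_⟩
  rw [lifts_iff_coeff_lifts]
  intro n
  by_cases hn : s.coeff n = 0
  · exact ⟨0, by simp [hn]⟩
  · obtain ⟨a, ha⟩ := hb (s.coeff n) (Finset.mem_biUnion.mpr ⟨s, hs, coeff_mem_coeffs hn⟩)
    refine ⟨IsLocalization.mk' (Localization.Away (b : A)) a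
      (⟨b, Submonoid.mem_powers _⟩ : Submonoid.powers (b : A)), ?_⟩
    rw [IsLocalization.Away.lift, IsLocalization.lift_mk'_spec, ha, Algebra.smul_def]

/-- The generic structure of a finite separable extension of domains. -/
structure GenericPrimitive (A R : Type) [CommRing A] [CommRing R] [Algebra A R] (h : R) where
  F : A
  ne_zero : F ≠ 0
  θ : R
  p : Polynomial (Localization.Away F)
  monic : p.Monic
  dvd_iff : ∀ g : Polynomial (Localization.Away F),
    g.eval₂ (Localization.awayMap (algebraMap A R) F) (algebraMap R _ θ) = 0 ↔ p ∣ g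
  exists_eq : ∀ x : R, ∃ r : Polynomial (Localization.Away F),
    r.eval₂ (Localization.awayMap (algebraMap A R) F) (algebraMap R _ θ) = algebraMap R _ x
  inv : Polynomial (Localization.Away F)
  inv_mul : inv.eval₂ (Localization.awayMap (algebraMap A R) F) (algebraMap R _ θ) *
    algebraMap R _ h = 1
  separable : p.Separable

-- After inverting `F`, the ring `R` becomes `A_F[T]/(p)` with `θ` the class of `T`. Points of the
-- fibre over `χ` are thus the roots of the specialized polynomial, and separability together with
-- monicity gives exactly `deg p` of them.
open Polynomial in
theorem GenericPrimitive.ncard_fiber {A R : Type} [CommRing A] [CommRing R] [Algebra A R] {h : R}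
    (G : GenericPrimitive A R h) (χ : A →+* ℂ) (hχ : χ G.F ≠ 0) :
    {ρ : R →+* ℂ | ρ.comp (algebraMap A R) = χ ∧ ρ h ≠ 0}.Finite ∧
    {ρ : R →+* ℂ | ρ.comp (algebraMap A R) = χ ∧ ρ h ≠ 0}.ncard = G.p.natDegree := by
  classical
  obtain ⟨F, hF0, θ, p, hmon, hdvd, hex, inv, hinv, hsep⟩ := G
  simp only at hχ ⊢
  set AF := Localization.Away F
  set RF := Localization.Away (algebraMap A R F)
  set a' : AF →+* RF := Localization.awayMap (algebraMap A R) F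
  let χF : AF →+* ℂ := IsLocalization.Away.lift F (g := χ) (by simpa using hχ)
  have hχF : ∀ a, χF (algebraMap A AF a) = χ a := fun a => IsLocalization.Away.lift_eq F _ a
  have ha' : ∀ a, a' (algebraMap A AF a) = algebraMap R RF (algebraMap A R a) := fun a =>
    IsLocalization.map_eq _ a
  -- extension of points of the fibre
  have hext : ∀ ρ : R →+* ℂ, ρ.comp (algebraMap A R) = χ → ∃ ρ' : RF →+* ℂ,
      (∀ x, ρ' (algebraMap R RF x) = ρ x) ∧ ρ'.comp a' = χF := by
    intro ρ hρ
    have hu : IsUnit (ρ (algebraMap A R F)) := by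
      rw [← RingHom.comp_apply, hρ]; simpa using hχ
    refine ⟨IsLocalization.Away.lift (algebraMap A R F) hu,
      fun x => IsLocalization.Away.lift_eq _ hu x, ?_⟩
    refine IsLocalization.ringHom_ext (Submonoid.powers F) ?_
    ext a
    simp only [RingHom.comp_apply, ha', hχF, IsLocalization.Away.lift_eq]
    rw [← RingHom.comp_apply, hρ]
  have hpt : ∀ ρ : R →+* ℂ, ρ.comp (algebraMap A R) = χ → ∀ (g : AF[X]) (x : R),
      g.eval₂ a' (algebraMap R RF θ) = algebraMap R RF x → g.eval₂ χF (ρ θ) = ρ x := by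
    intro ρ hρ g x hg
    obtain ⟨ρ', h1, h2⟩ := hext ρ hρ
    rw [← h1 x, ← hg, Polynomial.hom_eval₂, h2, h1]
  have hroot : ∀ ρ : R →+* ℂ, ρ.comp (algebraMap A R) = χ → p.eval₂ χF (ρ θ) = 0 := by
    intro ρ hρ
    have := hpt ρ hρ p 0 (by rw [(hdvd p).mpr dvd_rfl, map_zero])
    rwa [map_zero] at this
  have hp0 : p.map χF ≠ 0 := (hmon.map χF).ne_zero
  -- the map to the roots
  have himg : (fun ρ : R →+* ℂ => ρ θ) '' {ρ | ρ.comp (algebraMap A R) = χ ∧ ρ h ≠ 0} =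
      ((p.map χF).rootSet ℂ : Set ℂ) := by
    ext t
    rw [mem_rootSet_of_ne hp0]
    simp only [Set.mem_image, Set.mem_ofPred_eq, Polynomial.coe_aeval_eq_eval, Polynomial.eval_map]
    constructor
    · rintro ⟨ρ, ⟨hρ, -⟩, rfl⟩
      exact hroot ρ hρ
    · intro ht
      -- `dvd_iff` makes `j` injective and `exists_eq` makes it surjective. Its inverse, followed by
      -- evaluation at the root `t`, is the point of the fibre over `t`.
      let j : AdjoinRoot p →+* RF := AdjoinRoot.lift a' (algebraMap R RF θ) ((hdvd p).mpr dvd_rfl)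
      have hjmk : ∀ g : AF[X], j (AdjoinRoot.mk p g) = g.eval₂ a' (algebraMap R RF θ) := fun g =>
        AdjoinRoot.lift_mk _ g
      have hji : Function.Injective j := by
        rw [injective_iff_map_eq_zero]
        intro g hg
        obtain ⟨g, rfl⟩ := AdjoinRoot.mk_surjective g
        rw [hjmk, hdvd] at hg
        exact AdjoinRoot.mk_eq_zero.mpr hg
      have hjs : Function.Surjective j := by
        intro z
        obtain ⟨⟨x, s⟩, hz⟩ := IsLocalization.surj (Submonoid.powers (algebraMap A R F)) z
        obtain ⟨r, hr⟩ := hex x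
        obtain ⟨n, hn⟩ := s.2
        have hun : IsUnit (algebraMap A AF F) := IsLocalization.Away.algebraMap_isUnit F
        refine ⟨AdjoinRoot.mk p (Polynomial.C ((↑(hun.unit⁻¹) : AF) ^ n) * r), ?_⟩
        rw [hjmk, Polynomial.eval₂_mul, Polynomial.eval₂_C, hr]
        have hs : IsUnit (algebraMap R RF (s : R)) := IsLocalization.map_units RF s
        rw [← hs.mul_left_inj, hz, mul_right_comm]
        simp only at hn ⊢
        have h3 : algebraMap R RF (s : R) = a' (algebraMap A AF F ^ n) := by
          rw [← hn, map_pow, map_pow, ha']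
        rw [h3, ← map_mul, ← mul_pow, IsUnit.val_inv_mul, one_pow, map_one, one_mul]
      let e : AdjoinRoot p ≃+* RF := RingEquiv.ofBijective j ⟨hji, hjs⟩
      let σ : AdjoinRoot p →+* ℂ := AdjoinRoot.lift χF t ht
      have hσ : ∀ g : AF[X], σ (e.symm (g.eval₂ a' (algebraMap R RF θ))) = g.eval₂ χF t := by
        intro g
        rw [← hjmk g, show j (AdjoinRoot.mk p g) = e (AdjoinRoot.mk p g) from rfl,
          RingEquiv.symm_apply_apply]
        exact AdjoinRoot.lift_mk _ g
      refine ⟨(σ.comp e.symm.toRingHom).comp (algebraMap R RF), ⟨?_, ?_⟩, ?_⟩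
      · ext a
        have := hσ (Polynomial.C (algebraMap A AF a))
        rw [Polynomial.eval₂_C, Polynomial.eval₂_C, ha', hχF] at this
        exact this
      -- Since `h` is already invertible after inverting `F`, the condition `ρ h ≠ 0` excludes no
      -- point of the fibre.
      · intro h0
        have h1 := congrArg (fun z => σ (e.symm z)) hinv
        simp only [map_mul, map_one] at h1
        have h2 : σ (e.symm (algebraMap R RF h)) = 0 := h0
        rw [h2, mul_zero] at h1
        exact zero_ne_one h1
      · have := hσ Polynomial.X
        rw [Polynomial.eval₂_X, Polynomial.eval₂_X] at this
        exact this
  have hinj : Set.InjOn (fun ρ : R →+* ℂ => ρ θ)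
      {ρ | ρ.comp (algebraMap A R) = χ ∧ ρ h ≠ 0} := by
    rintro ρ ⟨hρ, -⟩ ρ₂ ⟨hρ₂, -⟩ heq
    ext x
    obtain ⟨r, hr⟩ := hex x
    simp only at heq
    rw [← hpt ρ hρ r x hr, ← hpt ρ₂ hρ₂ r x hr, heq]
  constructor
  · refine Set.Finite.of_finite_image ?_ hinj
    rw [himg]
    exact Set.toFinite _
  · rw [← hinj.ncard_image, himg, ← Nat.card_coe_set_eq, Nat.card_eq_fintype_card,
      card_rootSet_eq_natDegree (hsep.map) (IsAlgClosed.splits _), hmon.natDegree_map]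

-- In characteristic zero the extension of fraction fields has a primitive element. All that is
-- required of it involves finitely many polynomials over the fraction field of `A`, so one
-- denominator `F` suffices.
open Polynomial in
theorem nonempty_genericPrimitive {A R : Type} [CommRing A] [IsDomain A] [CharZero A] [CommRing R]
    [IsDomain R] [IsIntegrallyClosed R] [Algebra A R] [FaithfulSMul A R]
    [Algebra.IsAlgebraic A R] [Algebra.FiniteType A R] {h : R} (hh : h ≠ 0) :
    Nonempty (GenericPrimitive A R h) := by
  classical
  let K := FractionRing A
  let L := FractionRing R
  let : Algebra K L := FractionRing.liftAlgebra A L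
  have : Algebra.IsAlgebraic A L := (IsFractionRing.isAlgebraic_iff' A R L).mp inferInstance
  have : Algebra.IsAlgebraic K L := (IsFractionRing.comap_isAlgebraic_iff (A := A)).mp inferInstance
  have : CharZero K := charZero_of_injective_algebraMap (IsFractionRing.injective A K)
  obtain ⟨gens, hgens⟩ := (inferInstance : Algebra.FiniteType A R).out
  have : FiniteDimensional K L := by
    have h1 : IntermediateField.adjoin K (algebraMap R L '' (gens : Set R)) = ⊤ := by
      rw [eq_top_iff]
      have h2 : ∀ x : R, algebraMap R L x ∈
          IntermediateField.adjoin K (algebraMap R L '' (gens : Set R)) := by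
        intro x
        have hx : x ∈ Algebra.adjoin A (gens : Set R) := hgens ▸ Algebra.mem_top
        induction hx using Algebra.adjoin_induction with
        | mem x hx => exact IntermediateField.subset_adjoin _ _ ⟨x, hx, rfl⟩
        | algebraMap a =>
          rw [← IsScalarTower.algebraMap_apply, IsScalarTower.algebraMap_apply A K L]
          exact IntermediateField.algebraMap_mem _ _
        | add x y _ _ hx hy => rw [map_add]; exact add_mem hx hy
        | mul x y _ _ hx hy => rw [map_mul]; exact mul_mem hx hy
      intro z _
      obtain ⟨x, y, hy, rfl⟩ := IsFractionRing.div_surjective (A := R) z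
      exact div_mem (h2 x) (h2 y)
    have : Finite (algebraMap R L '' (gens : Set R)) := (gens.finite_toSet.image _).to_subtype
    have h3 := IntermediateField.finiteDimensional_adjoin (K := K)
      (S := algebraMap R L '' (gens : Set R)) (fun x _ => (Algebra.IsAlgebraic.isAlgebraic x).isIntegral)
    rw [h1] at h3
    exact IntermediateField.topEquiv.toLinearEquiv.finiteDimensional
  obtain ⟨α, hα⟩ := Field.exists_primitive_element K L
  -- Normality of `R` enters here: a nonzero multiple of the primitive element by an element of `A`
  -- is integral, hence lies in `R`.
  obtain ⟨b, hb0, hb⟩ := (Algebra.IsAlgebraic.isAlgebraic (R := A) α).exists_integral_multiple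
  obtain ⟨θ, hθ⟩ := IsIntegrallyClosed.algebraMap_eq_of_integral (R := R) (hb.tower_top (A := R))
  set t : L := algebraMap R L θ with ht
  have hint : IsIntegral K t := (Algebra.IsAlgebraic.isAlgebraic t).isIntegral
  have htop : Algebra.adjoin K {t} = ⊤ := by
    have h1 : IntermediateField.adjoin K {t} = ⊤ := by
      rw [eq_top_iff, ← hα, IntermediateField.adjoin_simple_le_iff]
      have hbK : algebraMap A K b ≠ 0 := by simpa using hb0
      have h2 : α = (algebraMap A K b)⁻¹ • t := by
        rw [hθ, algebra_compatible_smul K b α, smul_smul, inv_mul_cancel₀ hbK, one_smul]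
      rw [h2]
      exact IntermediateField.smul_mem _ (IntermediateField.mem_adjoin_simple_self K t)
    rw [← IntermediateField.adjoin_simple_toSubalgebra_of_isAlgebraic hint.isAlgebraic, h1]
    rfl
  have hrep : ∀ z : L, ∃ r : K[X], Polynomial.aeval t r = z := by
    intro z
    have hz : z ∈ Algebra.adjoin K {t} := htop ▸ Algebra.mem_top
    rw [Algebra.adjoin_singleton_eq_range_aeval] at hz
    exact hz
  choose rep hrep using hrep
  obtain ⟨u, v, huv⟩ : (minpoly K t).Separable :=
    (minpoly.irreducible hint).separable
  -- `F` clears the denominators of the minimal polynomial, of the Bézout coefficients that witness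
  -- its separability, and of the expressions of `1/h` and of the algebra generators of `R` as
  -- polynomials in `θ`.
  obtain ⟨F, hF, hlift⟩ := exists_forall_mem_lifts (A := A) (K := K)
    (insert (minpoly K t) (insert u (insert v (insert (rep (algebraMap R L h)⁻¹)
      (gens.image fun x => rep (algebraMap R L x))))))
  set iK : Localization.Away F →+* K := IsLocalization.Away.lift (S := Localization.Away F) F
    (g := algebraMap A K) (IsUnit.mk0 _ (by simpa using hF)) with hiK
  have hiKa : ∀ a, iK (algebraMap A _ a) = algebraMap A K a := fun a =>
    IsLocalization.Away.lift_eq F _ a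
  have hiKinj : Function.Injective iK := by
    rw [hiK, IsLocalization.Away.lift, IsLocalization.lift_injective_iff]
    intro x y
    rw [(IsLocalization.injective _ (powers_le_nonZeroDivisors_of_noZeroDivisors hF)).eq_iff,
      (IsFractionRing.injective A K).eq_iff]
  have hF' : algebraMap A R F ≠ 0 := by simpa using hF
  let RF := Localization.Away (algebraMap A R F)
  let a' : Localization.Away F →+* RF := Localization.awayMap (algebraMap A R) F
  have ha' : ∀ a, a' (algebraMap A _ a) = algebraMap R RF (algebraMap A R a) := fun a =>
    IsLocalization.map_eq _ a
  let iL : RF →+* L := IsLocalization.Away.lift (algebraMap A R F) (g := algebraMap R L)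
    (IsUnit.mk0 _ (by simpa using hF))
  have hiLa : ∀ a, iL (algebraMap R RF a) = algebraMap R L a := fun a =>
    IsLocalization.Away.lift_eq _ _ a
  have hiLinj : Function.Injective iL := by
    simp only [iL]
    rw [IsLocalization.Away.lift, IsLocalization.lift_injective_iff]
    intro x y
    rw [(IsLocalization.injective _ (powers_le_nonZeroDivisors_of_noZeroDivisors hF')).eq_iff,
      (IsFractionRing.injective R L).eq_iff]
  have hcomm : iL.comp a' = (algebraMap K L).comp iK := by
    refine IsLocalization.ringHom_ext (Submonoid.powers F) ?_
    ext a
    simp only [RingHom.comp_apply, ha', hiLa, hiKa]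
    rw [← IsScalarTower.algebraMap_apply, ← IsScalarTower.algebraMap_apply]
  have heval : ∀ g : (Localization.Away F)[X],
      iL (g.eval₂ a' (algebraMap R RF θ)) = Polynomial.aeval t (g.map iK) := by
    intro g
    rw [Polynomial.hom_eval₂, hcomm, hiLa, Polynomial.aeval_def, Polynomial.eval₂_map]
  have hl : ∀ s ∈ insert (minpoly K t) (insert u (insert v (insert (rep (algebraMap R L h)⁻¹)
      (gens.image fun x => rep (algebraMap R L x))))), ∃ s' : (Localization.Away F)[X], s'.map iK = s :=
    fun s hs => (mem_lifts s).mp (hlift s hs)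
  obtain ⟨p, hp, -, hpm⟩ := lifts_and_natDegree_eq_and_monic (hlift (minpoly K t) (by simp))
    (minpoly.monic hint)
  obtain ⟨u', hu'⟩ := hl u (by simp)
  obtain ⟨v', hv'⟩ := hl v (by simp)
  obtain ⟨w, hw⟩ := hl (rep (algebraMap R L h)⁻¹) (by simp)
  refine ⟨⟨F, hF, θ, p, hpm, fun g => ?_, fun x => ?_, w, ?_, ⟨u', v', ?_⟩⟩⟩
  · change g.eval₂ a' (algebraMap R RF θ) = 0 ↔ _
    rw [← map_eq_zero_iff iL hiLinj, heval, ← map_dvd_map iK hiKinj hpm]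
    erw [hp]
    exact (minpoly.dvd_iff (A := K)).symm
  · change ∃ r : (Localization.Away F)[X], r.eval₂ a' (algebraMap R RF θ) = algebraMap R RF x
    have hx : x ∈ Algebra.adjoin A (gens : Set R) := hgens ▸ Algebra.mem_top
    induction hx using Algebra.adjoin_induction with
    | mem x hx =>
      obtain ⟨r, hr⟩ := hl (rep (algebraMap R L x)) (by
        simp only [Finset.mem_insert, Finset.mem_image]
        exact Or.inr (Or.inr (Or.inr (Or.inr ⟨x, hx, rfl⟩))))
      refine ⟨r, hiLinj ?_⟩
      rw [heval, hr, hrep, hiLa]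
    | algebraMap a => exact ⟨Polynomial.C (algebraMap A _ a), by rw [Polynomial.eval₂_C, ha']⟩
    | add x y _ _ hx hy =>
      obtain ⟨r, hr⟩ := hx
      obtain ⟨r', hr'⟩ := hy
      exact ⟨r + r', by rw [Polynomial.eval₂_add, hr, hr', map_add]⟩
    | mul x y _ _ hx hy =>
      obtain ⟨r, hr⟩ := hx
      obtain ⟨r', hr'⟩ := hy
      exact ⟨r * r', by rw [Polynomial.eval₂_mul, hr, hr', map_mul]⟩
  · change w.eval₂ a' (algebraMap R RF θ) * algebraMap R RF h = 1
    apply hiLinj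
    rw [map_mul, heval, hw, hrep, hiLa, map_one, inv_mul_cancel₀]
    simpa using hh
  · apply Polynomial.map_injective iK hiKinj
    rw [Polynomial.map_add, Polynomial.map_mul, Polynomial.map_mul, hu', hv', ← derivative_map,
      Polynomial.map_one]
    erw [hp]
    exact huv


/-- Over a general point, the fibres of a polynomial map between affine spaces of the same
dimension, restricted to a basic open set, are finite of constant cardinality. -/
theorem exists_ncard_fiber_eq {ι κ : Type} [Finite ι] [Finite κ] (hc : Nat.card ι = Nat.card κ)
    (Φ : κ → MvPolynomial ι ℂ) (h : MvPolynomial ι ℂ) :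
    ∃ (d : ℕ) (F : MvPolynomial κ ℂ), F ≠ 0 ∧ ∀ y : κ → ℂ, eval y F ≠ 0 →
      {z : ι → ℂ | eval z h ≠ 0 ∧ ∀ j, eval z (Φ j) = y j}.Finite ∧
      {z : ι → ℂ | eval z h ≠ 0 ∧ ∀ j, eval z (Φ j) = y j}.ncard = d := by
  classical
  by_cases hh : h = 0
  · exact ⟨0, 1, one_ne_zero, fun y _ => by simp [hh]⟩
  -- If the `Φ j` are dependent, the relation vanishes on the image, so the general fibre is empty
  -- and `d = 0`. If they are independent, equality of dimensions makes them a transcendence basis,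
  -- and `exists_ncard_fiber_eq` reduces to `GenericPrimitive`.
  by_cases hi : AlgebraicIndependent ℂ Φ
  swap
  · rw [algebraicIndependent_iff] at hi
    push Not at hi
    obtain ⟨F, hF, hF0⟩ := hi
    refine ⟨0, F, hF0, fun y hy => ?_⟩
    have : {z : ι → ℂ | eval z h ≠ 0 ∧ ∀ j, eval z (Φ j) = y j} = ∅ := by
      rw [Set.eq_empty_iff_forall_notMem]
      rintro z ⟨-, hz⟩
      apply hy
      have h1 := congrArg (eval z) hF
      rw [map_zero, aeval_def, hom_eval₂] at h1
      rw [← h1, eval, coe_eval₂Hom]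
      congr 1
      · ext; simp
      · funext j; exact (hz j).symm
    simp [this]
  let : Algebra (MvPolynomial κ ℂ) (MvPolynomial ι ℂ) := (aeval Φ).toRingHom.toAlgebra
  have halg : ∀ p, algebraMap (MvPolynomial κ ℂ) (MvPolynomial ι ℂ) p = aeval Φ p := fun p => rfl
  have : IsScalarTower ℂ (MvPolynomial κ ℂ) (MvPolynomial ι ℂ) :=
    IsScalarTower.of_algebraMap_eq fun x => by rw [halg, AlgHom.commutes]
  have : FaithfulSMul (MvPolynomial κ ℂ) (MvPolynomial ι ℂ) :=
    (faithfulSMul_iff_algebraMap_injective _ _).mpr hi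
  have hb : IsTranscendenceBasis ℂ Φ := by
    refine hi.isTranscendenceBasis_of_trdeg_le_of_finite ?_
    rw [MvPolynomial.trdeg_of_isDomain, Cardinal.lift_id, ← Nat.cast_card, ← Nat.cast_card, hc]
  have : Algebra.IsAlgebraic (MvPolynomial κ ℂ) (MvPolynomial ι ℂ) := by
    have h1 := hb.isAlgebraic
    constructor
    intro x
    obtain ⟨q, hq0, hq⟩ := h1.isAlgebraic x
    let e := hi.aevalEquiv
    refine ⟨q.map e.symm.toRingEquiv.toRingHom, ?_, ?_⟩
    · rwa [Ne, Polynomial.map_eq_zero_iff]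
      exact e.symm.injective
    · rw [Polynomial.aeval_def, Polynomial.eval₂_map]
      have heq : (algebraMap (MvPolynomial κ ℂ) (MvPolynomial ι ℂ)).comp
          e.symm.toRingEquiv.toRingHom =
          algebraMap (Algebra.adjoin ℂ (Set.range Φ)) (MvPolynomial ι ℂ) := by
        refine RingHom.ext fun a => ?_
        obtain ⟨b, rfl⟩ := e.surjective a
        change algebraMap (MvPolynomial κ ℂ) (MvPolynomial ι ℂ) (e.symm (e b)) = _
        rw [AlgEquiv.symm_apply_apply, halg]
        rfl
      rw [heq]
      exact hq
  have : Algebra.FiniteType (MvPolynomial κ ℂ) (MvPolynomial ι ℂ) :=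
    Algebra.FiniteType.of_restrictScalars_finiteType ℂ _ _
  obtain ⟨G⟩ := nonempty_genericPrimitive (A := MvPolynomial κ ℂ) (R := MvPolynomial ι ℂ) hh
  refine ⟨G.p.natDegree, G.F, G.ne_zero, fun y hy => ?_⟩
  have := G.ncard_fiber (eval y) hy
  have himg : {ρ : MvPolynomial ι ℂ →+* ℂ | ρ.comp (algebraMap (MvPolynomial κ ℂ) _) = eval y ∧
      ρ h ≠ 0} = (fun z => eval z) '' {z : ι → ℂ | eval z h ≠ 0 ∧ ∀ j, eval z (Φ j) = y j} := by
    ext ρ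
    constructor
    · rintro ⟨h1, h2⟩
      have hρ : ρ = eval fun i => ρ (X i) := by
        refine MvPolynomial.ringHom_ext (fun r => ?_) (fun i => by simp)
        have := congrArg (fun f => f (C r)) h1
        simpa [halg] using this
      refine ⟨fun i => ρ (X i), ⟨by rwa [← hρ], fun j => ?_⟩, hρ.symm⟩
      rw [← hρ]
      have := congrArg (fun f => f (X j)) h1
      simpa [halg] using this
    · rintro ⟨z, ⟨h1, h2⟩, rfl⟩
      refine ⟨MvPolynomial.ringHom_ext (fun r => by simp [halg]) (fun i => ?_), h1⟩
      simp [halg, h2]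
  have hinj : Function.Injective fun z : ι → ℂ => eval z := by
    intro z z' hzz
    funext i
    simpa using congrArg (fun f => f (X i)) hzz
  rw [himg, Set.ncard_image_of_injective _ hinj] at this
  exact ⟨this.1.of_finite_image hinj.injOn, this.2⟩

/-! ### General symmetric matrices -/

/-- A property of points of affine space that holds on a nonempty Zariski open subset. -/
def Generically {κ : Type} (P : (κ → ℂ) → Prop) : Prop :=
  ∃ F : MvPolynomial κ ℂ, F ≠ 0 ∧ ∀ y, eval y F ≠ 0 → P y

theorem Generically.mono {κ : Type} {P Q : (κ → ℂ) → Prop} (h : Generically P)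
    (hPQ : ∀ y, P y → Q y) : Generically Q := by
  obtain ⟨F, hF, h⟩ := h
  exact ⟨F, hF, fun y hy => hPQ y (h y hy)⟩

theorem Generically.and {κ : Type} {P Q : (κ → ℂ) → Prop} (hP : Generically P)
    (hQ : Generically Q) : Generically fun y => P y ∧ Q y := by
  obtain ⟨F, hF, hP⟩ := hP
  obtain ⟨G, hG, hQ⟩ := hQ
  refine ⟨F * G, mul_ne_zero hF hG, fun y hy => ?_⟩
  rw [map_mul] at hy
  exact ⟨hP y (left_ne_zero_of_mul hy), hQ y (right_ne_zero_of_mul hy)⟩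

theorem Generically.forall {κ : Type} {α : Type} [Finite α] {P : α → (κ → ℂ) → Prop}
    (h : ∀ a, Generically (P a)) : Generically fun y => ∀ a, P a y := by
  classical
  have := Fintype.ofFinite α
  choose F hF h using h
  refine ⟨∏ a, F a, Finset.prod_ne_zero_iff.mpr fun a _ => hF a, fun y hy a => h a y ?_⟩
  rw [map_prod] at hy
  exact Finset.prod_ne_zero_iff.mp hy a (Finset.mem_univ a)

/-- The symmetric matrix with given entries. -/
def symMat {n : ℕ} (y : Sym2 (Fin n) → ℂ) : Matrix (Fin n) (Fin n) ℂ :=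
  Matrix.of fun i j => y s(i, j)

theorem symMat_isSymm {n : ℕ} (y : Sym2 (Fin n) → ℂ) : (symMat y).IsSymm := by
  ext i j
  simp [symMat, Sym2.eq_swap]

theorem mk_out_sym2 {α : Type} (e : Sym2 α) : s(e.out.1, e.out.2) = e :=
  Quot.out_eq e

/-- `ForGeneralSymm` uses polynomials in all `n²` entries, whereas genericity is proved in the
coordinates of `Sym²`, indexed by unordered pairs. Choosing an ordering `e.out` of each pair
translates one into the other; by symmetry of `H` the choice is immaterial. -/
theorem Generically.forGeneralSymm {n : ℕ} {P : Matrix (Fin n) (Fin n) ℂ → Prop}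
    (h : Generically fun y => P (symMat y)) : ForGeneralSymm n P := by
  obtain ⟨F, hF, h⟩ := h
  have key : ∀ H : Matrix (Fin n) (Fin n) ℂ, H.IsSymm →
      symMat (fun e => H e.out.1 e.out.2) = H := by
    intro H hH
    ext i j
    have := mk_out_sym2 s(i, j)
    rw [Sym2.eq_iff] at this
    rcases this with ⟨h1, h2⟩ | ⟨h1, h2⟩
    · simp only [symMat, Matrix.of_apply, h1, h2]
    · simp only [symMat, Matrix.of_apply, h1, h2]
      exact hH.apply i j
  refine ⟨rename (fun e => e.out) F, ?_, fun H hH hHF => ?_⟩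
  · obtain ⟨y, hy⟩ : ∃ y, eval y F ≠ 0 := by
      by_contra hc
      push Not at hc
      exact hF (MvPolynomial.funext fun y => by rw [hc y, map_zero])
    refine ⟨symMat y, symMat_isSymm y, ?_⟩
    rw [eval_rename]
    convert hy using 3
    funext e
    simp only [Function.comp, symMat, Matrix.of_apply]
    exact congrArg y (mk_out_sym2 e)
  · rw [eval_rename] at hHF
    have := h _ hHF
    have h2 := key H hH
    simp only [Function.comp_def] at this
    rwa [h2] at this

/-! ### Symmetric matrices with a prescribed value at a vector -/

section SymSolve

variable {n : ℕ} {A B : Type} [CommRing A] [CommRing B]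

/-- A polynomial parametrization of the symmetric matrices that map `v` to `(v i)² b`. -/
def symSolve (i : Fin n) (v b : Fin n → A) (G : Fin n → Fin n → A) (j l : Fin n) : A :=
  let c : Fin n → A := fun k => b k - ∑ k', G k k' * v k'
  let δ : Fin n → A := fun k => if k = i then 1 else 0
  v i ^ 2 * G j l + v i * (c j * δ l + δ j * c l) - (∑ k, c k * v k) * (δ j * δ l)

theorem symSolve_symm (i : Fin n) (v b : Fin n → A) {G : Fin n → Fin n → A}
    (hG : ∀ j l, G j l = G l j) (j l : Fin n) : symSolve i v b G j l = symSolve i v b G l j := by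
  simp only [symSolve, hG j l]
  ring

/-- With `c = b - G v` and `δ` the `i`-th unit vector, the correction `v_i (c δᵀ + δ cᵀ) - (c · v) δ
δᵀ` is supported on row and column `i` and sends `v` to `v_i² c`. The factor `v_i²` avoids division,
so the formula makes sense for polynomial entries. -/
theorem sum_symSolve_mul (i : Fin n) (v b : Fin n → A) (G : Fin n → Fin n → A) (j : Fin n) :
    ∑ l, symSolve i v b G j l * v l = v i ^ 2 * b j := by
  have h1 : ∀ x : A, ∑ l, x * (if l = i then (1 : A) else 0) * v l = x * v i := by
    intro x; simp
  let c : Fin n → A := fun k => b k - ∑ k', G k k' * v k'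
  have hcj : c j = b j - ∑ k', G j k' * v k' := rfl
  let δ : Fin n → A := fun k => if k = i then 1 else 0
  have hdef : ∀ l, symSolve i v b G j l = v i ^ 2 * G j l + v i * (c j * δ l + δ j * c l) -
      (∑ k, c k * v k) * (δ j * δ l) := fun _ => rfl
  have e : ∀ l, (v i ^ 2 * G j l + v i * (c j * δ l + δ j * c l) -
      (∑ k, c k * v k) * (δ j * δ l)) * v l = v i ^ 2 * (G j l * v l) +
      ((v i * c j) * δ l * v l) + v i * δ j * (c l * v l) -
      ((∑ k, c k * v k) * δ j) * δ l * v l := fun l => by ring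
  simp only [hdef, e, Finset.sum_sub_distrib, Finset.sum_add_distrib, ← Finset.mul_sum]
  have h2 := h1 (v i * c j)
  have h3 := h1 ((∑ k, c k * v k) * δ j)
  rw [h2, h3, hcj]
  ring

theorem map_symSolve (f : A →+* B) (i : Fin n) (v b : Fin n → A) (G : Fin n → Fin n → A)
    (j l : Fin n) : f (symSolve i v b G j l) =
      symSolve i (fun k => f (v k)) (fun k => f (b k)) (fun k k' => f (G k k')) j l := by
  simp [symSolve, apply_ite f]

theorem symSolve_of_ne {i : Fin n} (v b : Fin n → A) (G : Fin n → Fin n → A) {j l : Fin n}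
    (hj : j ≠ i) (hl : l ≠ i) : symSolve i v b G j l = v i ^ 2 * G j l := by
  simp [symSolve, hj, hl]

/-- The target vector of the parametrization. -/
def paramVec {ν : Type} [Fintype ν] (i : Fin n) (v : Fin n → A) (η : ν → Fin n → A)
    (s : Option ν ⊕ Sym2 {j : Fin n // j ≠ i} → A) (j : Fin n) : A :=
  s (Sum.inl none) * v j + ∑ l, s (Sum.inl (some l)) * η l j

/-- The free entries of the parametrization. -/
def paramFree {ν : Type} (i : Fin n)
    (s : Option ν ⊕ Sym2 {j : Fin n // j ≠ i} → A) (j l : Fin n) : A :=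
  if h : j ≠ i ∧ l ≠ i then s (Sum.inr s(⟨j, h.1⟩, ⟨l, h.2⟩)) else 0

/-- A polynomial parametrization of the symmetric matrices that map `v` into the span of `v` and
the vectors `η l`. -/
def paramMat {ν : Type} [Fintype ν] (i : Fin n) (v : Fin n → A) (η : ν → Fin n → A)
    (s : Option ν ⊕ Sym2 {j : Fin n // j ≠ i} → A) : Fin n → Fin n → A :=
  symSolve i v (paramVec i v η s) (paramFree i s)

theorem paramFree_symm {ν : Type} (i : Fin n) (s : Option ν ⊕ Sym2 {j : Fin n // j ≠ i} → A) (j l : Fin n) :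
    paramFree i s j l = paramFree i s l j := by
  unfold paramFree
  by_cases hj : j = i
  · simp [hj]
  by_cases hl : l = i
  · simp [hl]
  rw [dif_pos ⟨hj, hl⟩, dif_pos ⟨hl, hj⟩, Sym2.eq_swap]

variable {ν : Type} [Fintype ν]

theorem paramMat_symm (i : Fin n) (v : Fin n → A) (η : ν → Fin n → A)
    (s : Option ν ⊕ Sym2 {j : Fin n // j ≠ i} → A) (j l : Fin n) :
    paramMat i v η s j l = paramMat i v η s l j :=
  symSolve_symm i v _ (paramFree_symm i s) j l

theorem map_paramMat (f : A →+* B) (i : Fin n) (v : Fin n → A) (η : ν → Fin n → A)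
    (s : Option ν ⊕ Sym2 {j : Fin n // j ≠ i} → A) (j l : Fin n) : f (paramMat i v η s j l) =
      paramMat i (fun k => f (v k)) (fun r k => f (η r k)) (fun t => f (s t)) j l := by
  rw [paramMat, map_symSolve]
  unfold paramMat
  congr 1
  · funext k; simp [paramVec]
  · funext k k'
    unfold paramFree
    split_ifs <;> simp

theorem paramMat_out {i : Fin n} (v : Fin n → A) (η : ν → Fin n → A)
    (s : Option ν ⊕ Sym2 {j : Fin n // j ≠ i} → A) (j l : Fin n) :
    paramMat i v η s s(j, l).out.1 s(j, l).out.2 = paramMat i v η s j l := by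
  have := mk_out_sym2 s(j, l)
  rw [Sym2.eq_iff] at this
  rcases this with ⟨h1, h2⟩ | ⟨h1, h2⟩
  · rw [h1, h2]
  · rw [h1, h2, paramMat_symm]

/-- Passing from symmetric matrices of size `n - 1` to size `n` adds `n` entries. When `ν` has `n -
(N + 1)` elements, the codimension of the tangent space of the cone, the family therefore has `dim
Sym² - N` parameters. -/
theorem card_paramIdx (i : Fin n) :
    Nat.card (Option ν ⊕ Sym2 {j : Fin n // j ≠ i}) + n = Fintype.card ν + 1 +
      Nat.card (Sym2 (Fin n)) := by
  classical
  obtain ⟨m, rfl⟩ : ∃ m, n = m + 1 := ⟨n - 1, by have := i.2; omega⟩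
  have h1 : Fintype.card {j : Fin (m + 1) // j ≠ i} = m := by
    rw [Fintype.card_subtype_compl, Fintype.card_fin, Fintype.card_subtype_eq]; rfl
  rw [Nat.card_sum, Nat.card_eq_fintype_card, Nat.card_eq_fintype_card, Nat.card_eq_fintype_card,
    Fintype.card_option, Sym2.card, Sym2.card, h1, Fintype.card_fin]
  have : (m + 1 + 1).choose 2 = (m + 1) + (m + 1).choose 2 := by
    rw [Nat.choose_succ_succ' (m + 1) 1, Nat.choose_one_right]
  omega

/-- Row `j ≠ i` of `D v = 0` reduces to `D j i * v i = 0`, and then by symmetry row `i` reduces to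
`D i i * v i = 0`. So a symmetric matrix is determined by its value at `v` and its entries off row
and column `i`. -/
theorem eq_zero_of_symm_of_mulVec {K : Type} [Field K] {D : Fin n → Fin n → K} {i : Fin n}
    {v : Fin n → K} (hi : v i ≠ 0) (hD : ∀ j l, D j l = D l j) (hv : ∀ j, ∑ l, D j l * v l = 0)
    (h0 : ∀ j l, j ≠ i → l ≠ i → D j l = 0) (j l : Fin n) : D j l = 0 := by
  have h1 : ∀ j, j ≠ i → D j i = 0 := by
    intro j hj
    have := hv j
    rw [Finset.sum_eq_single i (fun l _ hl => by rw [h0 j l hj hl, zero_mul]) (by simp)] at this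
    exact (mul_eq_zero.mp this).resolve_right hi
  have h2 : D i i = 0 := by
    have := hv i
    rw [Finset.sum_eq_single i (fun l _ hl => by rw [hD, h1 l hl, zero_mul]) (by simp)] at this
    exact (mul_eq_zero.mp this).resolve_right hi
  by_cases hj : j = i
  · by_cases hl : l = i
    · rw [hj, hl, h2]
    · rw [hj, hD, h1 l hl]
  · by_cases hl : l = i
    · rw [hl, h1 j hj]
    · exact h0 j l hj hl

end SymSolve

/-! ### Critical points in terms of tangent spaces -/

section Crit

variable {n : ℕ}

/-- The gradient of the Rayleigh quotient of `H` at `v` annihilates `T`. -/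
def CritAt (H : Matrix (Fin n) (Fin n) ℂ) (v : Fin n → ℂ) (T : Submodule ℂ (Fin n → ℂ)) : Prop :=
  ∀ w ∈ T, (w ⬝ᵥ H.mulVec v) * (v ⬝ᵥ v) = (v ⬝ᵥ H.mulVec v) * (w ⬝ᵥ v)

theorem critAt_smul {H : Matrix (Fin n) (Fin n) ℂ} {v : Fin n → ℂ} {T : Submodule ℂ (Fin n → ℂ)}
    {c : ℂ} (hc : c ≠ 0) : CritAt H (c • v) T ↔ CritAt H v T := by
  refine forall_congr' fun w => forall_congr' fun _ => ?_
  simp only [Matrix.mulVec_smul, dotProduct_smul, smul_dotProduct, smul_eq_mul]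
  constructor
  · intro h
    have h3 : c ^ 3 ≠ 0 := pow_ne_zero _ hc
    refine mul_left_cancel₀ h3 ?_
    linear_combination h
  · intro h
    linear_combination c ^ 3 * h

variable {ν : Type} [Fintype ν]

/-- `η` spans the orthogonal complement of `T`. -/
def SpansPerp (η : ν → Fin n → ℂ) (T : Submodule ℂ (Fin n → ℂ)) : Prop :=
  ∀ u : Fin n → ℂ, (∀ w ∈ T, w ⬝ᵥ u = 0) ↔ ∃ c : ν → ℂ, u = ∑ l, c l • η l

/-- Taking for `c₀` the Rayleigh quotient, the condition says that the residual `H v - c₀ v` is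
orthogonal to `T`. Conversely the component along `T^⊥` drops out on pairing with any vector of `T`,
in particular with `v`. -/
theorem critAt_iff_exists {H : Matrix (Fin n) (Fin n) ℂ} {v : Fin n → ℂ}
    {T : Submodule ℂ (Fin n → ℂ)} (hvT : v ∈ T) (hv : v ⬝ᵥ v ≠ 0) {η : ν → Fin n → ℂ}
    (hη : SpansPerp η T) :
    CritAt H v T ↔ ∃ (c₀ : ℂ) (c : ν → ℂ), H.mulVec v = c₀ • v + ∑ l, c l • η l := by
  constructor
  · intro h
    set c₀ := (v ⬝ᵥ H.mulVec v) / (v ⬝ᵥ v)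
    obtain ⟨c, hc⟩ := (hη (H.mulVec v - c₀ • v)).mp (fun w hw => by
      rw [dotProduct_sub, dotProduct_smul, smul_eq_mul, sub_eq_zero]
      refine mul_right_cancel₀ hv ?_
      rw [h w hw, div_mul_eq_mul_div, div_mul_cancel₀ _ hv])
    exact ⟨c₀, c, by rw [← hc]; abel⟩
  · rintro ⟨c₀, c, h⟩ w hw
    have h1 : ∀ w ∈ T, w ⬝ᵥ ∑ l, c l • η l = 0 := (hη _).mpr ⟨c, rfl⟩
    rw [h, dotProduct_add, dotProduct_add, h1 w hw, h1 v hvT, dotProduct_smul, dotProduct_smul,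
      smul_eq_mul, smul_eq_mul]
    ring

/-- The parameters are the coefficients of `H v` and the entries of `H` off row and column `i`, all
divided by `v_i²` to compensate the factor in `symSolve`. The resulting matrix agrees with `H` by
`eq_zero_of_symm_of_mulVec`. -/
theorem exists_paramMat_of_critAt {y : Sym2 (Fin n) → ℂ} {v : Fin n → ℂ}
    {T : Submodule ℂ (Fin n → ℂ)} (hvT : v ∈ T) (hv : v ⬝ᵥ v ≠ 0) {η : ν → Fin n → ℂ}
    (hη : SpansPerp η T) {i : Fin n} (hi : v i ≠ 0) (h : CritAt (symMat y) v T) :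
    ∃ s, ∀ j l, paramMat i v η s j l = y s(j, l) := by
  obtain ⟨c₀, c, hc⟩ := (critAt_iff_exists hvT hv hη).mp h
  set r := (v i ^ 2)⁻¹ with hr
  have hri : v i ^ 2 * r = 1 := mul_inv_cancel₀ (pow_ne_zero 2 hi)
  let y' : Sym2 {j : Fin n // j ≠ i} → ℂ := fun e => r * y (e.map Subtype.val)
  let s : Option ν ⊕ Sym2 {j : Fin n // j ≠ i} → ℂ :=
    Sum.elim (fun o => o.elim (r * c₀) fun l => r * c l) y'
  refine ⟨s, fun j l => ?_⟩
  rw [← sub_eq_zero]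
  refine eq_zero_of_symm_of_mulVec (D := fun j l => paramMat i v η s j l - y s(j, l)) hi
    (fun j l => by rw [paramMat_symm, Sym2.eq_swap]) (fun j => ?_) (fun j l hj hl => ?_) j l
  · simp only [sub_mul, Finset.sum_sub_distrib]
    have h1 : ∑ l, y s(j, l) * v l = c₀ * v j + ∑ l, c l * η l j := by
      have := congrFun hc j
      simpa [Matrix.mulVec, dotProduct, symMat] using this
    rw [h1, paramMat, sum_symSolve_mul]
    simp only [paramVec, s, Sum.elim_inl, Option.elim, mul_assoc, ← Finset.mul_sum]
    linear_combination (c₀ * v j + ∑ l, c l * η l j) * hri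
  · rw [paramMat, symSolve_of_ne _ _ _ hj hl, paramFree, dif_pos ⟨hj, hl⟩]
    simp only [s, Sum.elim_inr, y', Sym2.map_mk]
    linear_combination y s(j, l) * hri

theorem critAt_of_paramMat {y : Sym2 (Fin n) → ℂ} {v : Fin n → ℂ}
    {T : Submodule ℂ (Fin n → ℂ)} (hvT : v ∈ T) (hv : v ⬝ᵥ v ≠ 0) {η : ν → Fin n → ℂ}
    (hη : SpansPerp η T) {i : Fin n} {s : Option ν ⊕ Sym2 {j : Fin n // j ≠ i} → ℂ}
    (hs : ∀ j l, paramMat i v η s j l = y s(j, l)) : CritAt (symMat y) v T := by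
  rw [critAt_iff_exists hvT hv hη]
  refine ⟨v i ^ 2 * s (Sum.inl none), fun l => v i ^ 2 * s (Sum.inl (some l)), ?_⟩
  funext j
  have := sum_symSolve_mul i v (paramVec i v η s) (paramFree i s) j
  change ∑ l, paramMat i v η s j l * v l = _ at this
  simp only [hs] at this
  simp only [Matrix.mulVec, dotProduct, symMat, Matrix.of_apply, this, paramVec, Pi.add_apply,
    Pi.smul_apply, Finset.sum_apply, smul_eq_mul, mul_add, Finset.mul_sum, mul_assoc]

/-- The value of the matrix at `v` determines the target vector. Pairing this with the nonisotropic
`v` isolates the coefficient of `v`, independence of `η` gives the other coefficients, and the free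
entries can be read off the matrix. -/
theorem paramMat_injective {v : Fin n → ℂ} {T : Submodule ℂ (Fin n → ℂ)} (hvT : v ∈ T)
    (hv : v ⬝ᵥ v ≠ 0) {η : ν → Fin n → ℂ} (hη : SpansPerp η T) (hi : LinearIndependent ℂ η)
    {i : Fin n} (hvi : v i ≠ 0) {s s' : Option ν ⊕ Sym2 {j : Fin n // j ≠ i} → ℂ}
    (hs : ∀ j l, paramMat i v η s j l = paramMat i v η s' j l) : s = s' := by
  have hvi2 : v i ^ 2 ≠ 0 := pow_ne_zero 2 hvi
  have hb : ∀ j, paramVec i v η s j = paramVec i v η s' j := by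
    intro j
    have h1 := sum_symSolve_mul i v (paramVec i v η s) (paramFree i s) j
    have h2 := sum_symSolve_mul i v (paramVec i v η s') (paramFree i s') j
    change ∑ l, paramMat i v η s j l * v l = _ at h1
    change ∑ l, paramMat i v η s' j l * v l = _ at h2
    simp only [hs] at h1
    exact mul_left_cancel₀ hvi2 (h1.symm.trans h2)
  set u : ν → ℂ := fun l => s (Sum.inl (some l)) - s' (Sum.inl (some l)) with hu
  set u₀ : ℂ := s (Sum.inl none) - s' (Sum.inl none) with hu₀
  have hsum : u₀ • v + ∑ l, u l • η l = 0 := by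
    funext j
    have := hb j
    simp only [paramVec] at this
    simp only [Pi.add_apply, Pi.smul_apply, Finset.sum_apply, smul_eq_mul, Pi.zero_apply, hu, hu₀,
      sub_mul, Finset.sum_sub_distrib]
    linear_combination this
  have hu₀0 : u₀ = 0 := by
    have h1 : v ⬝ᵥ ∑ l, u l • η l = 0 := (hη _).mpr ⟨u, rfl⟩ v hvT
    have h2 := congrArg (fun z => v ⬝ᵥ z) hsum
    simp only [dotProduct_add, h1, dotProduct_smul, smul_eq_mul, add_zero, dotProduct_zero] at h2
    exact (mul_eq_zero.mp h2).resolve_right hv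
  rw [hu₀0, zero_smul, zero_add] at hsum
  have hu0 := Fintype.linearIndependent_iff.mp hi u hsum
  funext t
  rcases t with (_ | l) | e
  · exact sub_eq_zero.mp hu₀0
  · exact sub_eq_zero.mp (hu0 l)
  · induction e with
    | _ j l =>
      have := hs j l
      rw [paramMat, paramMat, symSolve_of_ne _ _ _ j.2 l.2, symSolve_of_ne _ _ _ j.2 l.2] at this
      have h3 := mul_left_cancel₀ hvi2 this
      rwa [paramFree, paramFree, dif_pos ⟨j.2, l.2⟩, dif_pos ⟨j.2, l.2⟩] at h3

end Crit

/-! ### Jets: dual numbers and the linear span of a map and its partial derivatives -/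

section Jets

variable {n : ℕ} {ι : Type}

theorem IsWeightedHomogeneous.aeval_pow_mul {R A : Type} [CommRing R] [CommRing A] [Algebra R A]
    {w : ι → ℕ} {f : MvPolynomial ι R} {d : ℕ} (hf : IsWeightedHomogeneous w f d) (t : A)
    (x : ι → A) : aeval (fun s => t ^ w s * x s) f = t ^ d * aeval x f := by
  rw [aeval_def, aeval_def, eval₂_eq, eval₂_eq, Finset.mul_sum]
  refine Finset.sum_congr rfl fun m hm => ?_
  have h1 := hf (mem_support_iff.mp hm)
  rw [Finsupp.weight_apply, Finsupp.sum] at h1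
  simp only [mul_pow, Finset.prod_mul_distrib, ← pow_mul, Finset.prod_pow_eq_pow_sum]
  rw [← h1]
  simp only [smul_eq_mul, mul_comm (m _)]
  ring

theorem IsHomogeneous.aeval_mul {R A : Type} [CommRing R] [CommRing A] [Algebra R A]
    {f : MvPolynomial ι R} {d : ℕ} (hf : f.IsHomogeneous d) (t : A) (x : ι → A) :
    aeval (fun s => t * x s) f = t ^ d * aeval x f := by
  simpa using IsWeightedHomogeneous.aeval_pow_mul (A := A) hf t x

theorem IsHomogeneous.eval_smul {f : MvPolynomial ι ℂ} {d : ℕ} (hf : f.IsHomogeneous d) (t : ℂ)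
    (x : ι → ℂ) : eval (t • x) f = t ^ d * eval x f := by
  exact IsHomogeneous.aeval_mul (A := ℂ) hf t x

/-- The dual number `a + b ε`. -/
def dual (a b : ℂ) : DualNumber ℂ := TrivSqZeroExt.inl a + TrivSqZeroExt.inr b

@[simp] theorem fst_dual (a b : ℂ) : (dual a b).fst = a := by simp [dual]

@[simp] theorem snd_dual (a b : ℂ) : (dual a b).snd = b := by simp [dual]

theorem fst_aeval_dualNumber (X : ι → DualNumber ℂ) (f : MvPolynomial ι ℂ) :
    (aeval X f).fst = eval (fun s => (X s).fst) f := by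
  have := (MvPolynomial.comp_aeval_apply X (TrivSqZeroExt.fstHom ℂ ℂ ℂ) f)
  rw [← aeval_eq_eval]
  exact this

variable [Fintype ι]

theorem snd_aeval_dualNumber (X : ι → DualNumber ℂ) (f : MvPolynomial ι ℂ) :
    (aeval X f).snd = ∑ s, (X s).snd * eval (fun s => (X s).fst) (pderiv s f) := by
  classical
  induction f using MvPolynomial.induction_on with
  | C a =>
    simp [TrivSqZeroExt.algebraMap_eq_inl]
  | add p q hp hq =>
    simp [hp, hq, mul_add, Finset.sum_add_distrib]
  | mul_X p i hp =>
    rw [map_mul, aeval_X, DualNumber.snd_mul, hp, fst_aeval_dualNumber]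
    simp only [pderiv_mul, map_add, map_mul, eval_X, mul_add, Finset.sum_add_distrib,
      Finset.sum_mul]
    rw [add_comm]
    congr 1
    · exact Finset.sum_congr rfl fun s _ => by ring
    · rw [Finset.sum_eq_single i]
      · rw [pderiv_X_self, map_one]; ring
      · intro b _ hb
        rw [pderiv_X_of_ne hb.symm]; simp
      · simp

/-- The span of a polynomial map and its partial derivatives at a point. -/
def jetSpan (θ : Fin n → MvPolynomial ι ℂ) (x : ι → ℂ) : Submodule ℂ (Fin n → ℂ) :=
  Submodule.span ℂ (insert (fun j => eval x (θ j))
    (Set.range fun (s : ι) (j : Fin n) => eval x (pderiv s (θ j))))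

/-- The values and the partial derivatives of a polynomial map at a point. -/
def jetVec (θ : Fin n → MvPolynomial ι ℂ) (x : ι → ℂ) : Option ι → Fin n → ℂ
  | none => fun j => eval x (θ j)
  | some s => fun j => eval x (pderiv s (θ j))

omit [Fintype ι] in
theorem jetSpan_eq_span_range (θ : Fin n → MvPolynomial ι ℂ) (x : ι → ℂ) :
    jetSpan θ x = Submodule.span ℂ (Set.range (jetVec θ x)) := by
  rw [jetSpan]
  congr 1
  ext w
  constructor
  · rintro (rfl | ⟨s, rfl⟩)
    · exact ⟨none, rfl⟩
    · exact ⟨some s, rfl⟩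
  · rintro ⟨_ | s, rfl⟩
    · exact Or.inl rfl
    · exact Or.inr ⟨s, rfl⟩

theorem mem_jetSpan_iff {θ : Fin n → MvPolynomial ι ℂ} {x : ι → ℂ} {w : Fin n → ℂ} :
    w ∈ jetSpan θ x ↔ ∃ (c₀ : ℂ) (c : ι → ℂ), ∀ j,
      w j = c₀ * eval x (θ j) + ∑ s, c s * eval x (pderiv s (θ j)) := by
  rw [jetSpan_eq_span_range, Submodule.mem_span_range_iff_exists_fun]
  constructor
  · rintro ⟨c, rfl⟩
    refine ⟨c none, fun s => c (some s), fun j => ?_⟩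
    simp [Fintype.sum_option, jetVec]
  · rintro ⟨c₀, c, h⟩
    refine ⟨fun o => o.elim c₀ c, ?_⟩
    funext j
    simp [Fintype.sum_option, jetVec, h j]

/-- Tangent vectors are read as `ε`-parts of dual-number points `t · θ(X)`, with `t` accounting for
the direction of `θ(x)` itself. In this form, statements about rescaling, charts and inverses need
only be known over an arbitrary algebra. -/
theorem mem_jetSpan_iff_dualNumber {θ : Fin n → MvPolynomial ι ℂ} {x : ι → ℂ} {w : Fin n → ℂ} :
    w ∈ jetSpan θ x ↔ ∃ (t : DualNumber ℂ) (X : ι → DualNumber ℂ), t.fst = 1 ∧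
      (∀ s, (X s).fst = x s) ∧ ∀ j, w j = (t * aeval X (θ j)).snd := by
  rw [mem_jetSpan_iff]
  constructor
  · rintro ⟨c₀, c, h⟩
    refine ⟨dual 1 c₀, fun s => dual (x s) (c s), fst_dual _ _, fun s => fst_dual _ _, fun j => ?_⟩
    rw [DualNumber.snd_mul, snd_aeval_dualNumber, fst_aeval_dualNumber, h]
    simp only [fst_dual, snd_dual]
    ring
  · rintro ⟨t, X, ht, hX, h⟩
    refine ⟨t.snd, fun s => (X s).snd, fun j => ?_⟩
    have hx : (fun s => (X s).fst) = x := funext hX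
    rw [h, DualNumber.snd_mul, snd_aeval_dualNumber, fst_aeval_dualNumber, ht, hx]
    ring

theorem mem_jetSpan_of_dualNumber {θ : Fin n → MvPolynomial ι ℂ} {x : ι → ℂ} {w : Fin n → ℂ}
    {t : DualNumber ℂ} {X : ι → DualNumber ℂ} (ht : t.fst ≠ 0) (hX : ∀ s, (X s).fst = x s)
    (hw : ∀ j, w j = (t * aeval X (θ j)).snd) : w ∈ jetSpan θ x := by
  have : t.fst⁻¹ • w ∈ jetSpan θ x := by
    refine mem_jetSpan_iff_dualNumber.mpr ⟨t.fst⁻¹ • t, X, ?_, hX, fun j => ?_⟩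
    · simp [ht]
    · rw [smul_mul_assoc, TrivSqZeroExt.snd_smul, ← hw]; rfl
  have h2 := (jetSpan θ x).smul_mem t.fst this
  rwa [smul_smul, mul_inv_cancel₀ ht, one_smul] at h2

theorem mem_coneTangent_iff {V : Set (PSpace n)} {v w : Fin n → ℂ} :
    w ∈ coneTangent V v ↔ ∀ f ∈ definingIdeal V,
      (aeval (fun j => dual (v j) (w j)) f).snd = 0 := by
  refine forall_congr' fun f => forall_congr' fun _ => ?_
  rw [snd_aeval_dualNumber]
  simp only [fst_dual, snd_dual, mul_comm]

end Jets

/-! ### Birational parametrizations by affine space -/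

/-- A polynomial map `θ` from affine space to the affine cone with ideal `I`, dense in the
projectivization, with a rational inverse `[v] ↦ (qs s v / q v)`. -/
structure AffineInverse {n : ℕ} {σ : Type} (θ : Fin n → MvPolynomial σ ℂ)
    (I : Ideal (MvPolynomial (Fin n) ℂ)) where
  mem_iff : ∀ f, f ∈ I ↔ ∀ (t : ℂ) (x : σ → ℂ), eval (fun j => t * eval x (θ j)) f = 0
  q : MvPolynomial (Fin n) ℂ
  qs : σ → MvPolynomial (Fin n) ℂ
  deg : ℕ
  hom_q : q.IsHomogeneous deg
  hom_qs : ∀ s, (qs s).IsHomogeneous deg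
  ne_zero : aeval θ q ≠ 0
  inv : ∀ s, aeval θ (qs s) = X s * aeval θ q
  l : Fin n
  l_ne_zero : θ l ≠ 0

/-- The polynomial `p (qs / q)` multiplied by `q ^ D`. -/
def clearDenom {n : ℕ} {σ : Type} (q : MvPolynomial (Fin n) ℂ) (qs : σ → MvPolynomial (Fin n) ℂ)
    (D : ℕ) (p : MvPolynomial σ ℂ) : MvPolynomial (Fin n) ℂ :=
  ∑ m ∈ p.support, C (coeff m p) * (q ^ (D - m.degree) * m.prod fun s e => qs s ^ e)

/-- A monomial of degree `e` is multiplied by `q ^ (D - e)`, and substituting `qs = x q` supplies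
the missing `q ^ e`. The total power is `D` for every monomial, which also makes the result a form
when `q` and the `qs` are forms of one degree. -/
theorem map_clearDenom {n : ℕ} {σ : Type} {q : MvPolynomial (Fin n) ℂ}
    {qs : σ → MvPolynomial (Fin n) ℂ} {D : ℕ} {p : MvPolynomial σ ℂ} (hD : p.totalDegree ≤ D)
    {A : Type} [CommRing A] [Algebra ℂ A] (φ : MvPolynomial (Fin n) ℂ →ₐ[ℂ] A) (x : σ → A)
    (h : ∀ s, φ (qs s) = x s * φ q) : φ (clearDenom q qs D p) = φ q ^ D * aeval x p := by
  rw [clearDenom, map_sum, aeval_def, eval₂_eq, Finset.mul_sum]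
  refine Finset.sum_congr rfl fun m hm => ?_
  have hmD : m.degree ≤ D := by
    exact le_trans (le_totalDegree hm) hD
  rw [map_mul, map_mul, map_pow, Finsupp.prod, map_prod]
  simp only [map_pow, h, mul_pow, Finset.prod_mul_distrib]
  have h2 : φ (C (coeff m p)) = algebraMap ℂ A (coeff m p) := by
    rw [← MvPolynomial.algebraMap_eq, AlgHom.commutes]
  have h3 : ∏ s ∈ m.support, φ q ^ m s = φ q ^ m.degree := by
    rw [Finset.prod_pow_eq_pow_sum]; rfl
  rw [h2, h3]
  have h4 : φ q ^ D = φ q ^ (D - m.degree) * φ q ^ m.degree := by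
    rw [← pow_add, Nat.sub_add_cancel hmD]
  rw [h4]
  ring

theorem isHomogeneous_clearDenom {n : ℕ} {σ : Type} {q : MvPolynomial (Fin n) ℂ}
    {qs : σ → MvPolynomial (Fin n) ℂ} {D E : ℕ} {p : MvPolynomial σ ℂ} (hD : p.totalDegree ≤ D)
    (hq : q.IsHomogeneous E) (hqs : ∀ s, (qs s).IsHomogeneous E) :
    (clearDenom q qs D p).IsHomogeneous (E * D) := by
  refine IsHomogeneous.sum _ _ _ fun m hm => ?_
  have hmD : m.degree ≤ D := le_trans (le_totalDegree hm) hD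
  have h1 : (m.prod fun s e => qs s ^ e).IsHomogeneous (∑ s ∈ m.support, E * m s) :=
    IsHomogeneous.prod _ _ _ fun s _ => (hqs s).pow _
  have h2 := (isHomogeneous_C (Fin n) (coeff m p)).mul ((hq.pow (D - m.degree)).mul h1)
  convert h2 using 1
  rw [← Finset.mul_sum, zero_add, ← mul_add]
  congr 1
  have : ∑ s ∈ m.support, m s = m.degree := rfl
  omega

/-- A bound for the degrees of the entries of `θ`. -/
def degreeBound {n : ℕ} {σ : Type} (θ : Fin n → MvPolynomial σ ℂ) : ℕ :=
  Finset.univ.sup fun j => (θ j).totalDegree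

theorem totalDegree_le_degreeBound {n : ℕ} {σ : Type} (θ : Fin n → MvPolynomial σ ℂ)
    (j : Fin n) : (θ j).totalDegree ≤ degreeBound θ :=
  Finset.le_sup (f := fun j => (θ j).totalDegree) (Finset.mem_univ j)

namespace AffineInverse

variable {n : ℕ} {σ : Type} {θ : Fin n → MvPolynomial σ ℂ}
  {I : Ideal (MvPolynomial (Fin n) ℂ)} (S : AffineInverse θ I)
include S

theorem mem_iff_of_isHomogeneous {f : MvPolynomial (Fin n) ℂ} {d : ℕ} (hf : f.IsHomogeneous d) :
    f ∈ I ↔ aeval θ f = 0 := by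
  have hev : ∀ x, eval x (aeval θ f) = eval (fun j => eval x (θ j)) f := by
    intro x
    exact MvPolynomial.comp_aeval_apply θ (aeval x) f
  rw [S.mem_iff]
  constructor
  · intro h
    refine MvPolynomial.funext fun x => ?_
    have := h 1 x
    rw [hev, map_zero]
    simpa using this
  · intro h t x
    have := IsHomogeneous.eval_smul hf t (fun j => eval x (θ j))
    rw [← hev, h, map_zero, mul_zero] at this
    exact this

/-- A form whose nonvanishing locus lies in the locus where the inverse map is defined. -/
def goodForm : MvPolynomial (Fin n) ℂ := S.q * clearDenom S.q S.qs (degreeBound θ) (θ S.l)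

theorem isHomogeneous_goodForm : S.goodForm.IsHomogeneous (S.deg + S.deg * degreeBound θ) :=
  S.hom_q.mul (isHomogeneous_clearDenom (totalDegree_le_degreeBound θ _) S.hom_q S.hom_qs)

theorem aeval_goodForm :
    aeval θ S.goodForm = aeval θ S.q * (aeval θ S.q ^ degreeBound θ * θ S.l) := by
  rw [goodForm, map_mul, map_clearDenom (totalDegree_le_degreeBound θ _) (aeval θ) X S.inv, aeval_X_left]
  rfl

theorem aeval_goodForm_ne_zero : aeval θ S.goodForm ≠ 0 := by
  rw [S.aeval_goodForm]
  exact mul_ne_zero S.ne_zero (mul_ne_zero (pow_ne_zero _ S.ne_zero) S.l_ne_zero)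

theorem goodForm_notMem : S.goodForm ∉ I := fun h =>
  S.aeval_goodForm_ne_zero ((S.mem_iff_of_isHomogeneous S.isHomogeneous_goodForm).mp h)

/-- These are the 2×2 minors which say that `θ` composed with the inverse returns the same point of
`V`: along `θ` the cleared form of `θ j` becomes `q ^ D * θ j`, proportional to the coordinate `X
j`. -/
theorem relation_mem (j : Fin n) :
    X S.l * clearDenom S.q S.qs (degreeBound θ) (θ j) - X j * clearDenom S.q S.qs (degreeBound θ) (θ S.l) ∈ I := by
  have h : ∀ j, (clearDenom S.q S.qs (degreeBound θ) (θ j)).IsHomogeneous (S.deg * degreeBound θ) := fun j =>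
    isHomogeneous_clearDenom (totalDegree_le_degreeBound θ _) S.hom_q S.hom_qs
  rw [S.mem_iff_of_isHomogeneous (((isHomogeneous_X ℂ S.l).mul (h j)).sub
    ((isHomogeneous_X ℂ j).mul (h S.l)))]
  have h2 : ∀ j, aeval θ (clearDenom S.q S.qs (degreeBound θ) (θ j)) = aeval θ S.q ^ degreeBound θ * θ j := by
    intro j
    rw [map_clearDenom (totalDegree_le_degreeBound θ _) (aeval θ) X S.inv, aeval_X_left]
    rfl
  rw [map_sub, map_mul, map_mul, h2, h2, aeval_X, aeval_X]
  ring

/-- Points of the cone with values in an algebra come from the parametrization wherever the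
inverse map is defined. -/
theorem exists_eq_mul {A : Type} [CommRing A] [Algebra ℂ A] {v : Fin n → A}
    (hv : ∀ f ∈ I, aeval v f = 0) (hg : IsUnit (aeval v S.goodForm)) :
    ∃ (t : A) (x : σ → A), (∀ s, aeval v (S.qs s) = x s * aeval v S.q) ∧
      ∀ j, v j = t * aeval x (θ j) := by
  rw [goodForm, map_mul, IsUnit.mul_iff] at hg
  obtain ⟨⟨u, hu⟩, hl⟩ := hg
  set x : σ → A := fun s => aeval v (S.qs s) * ↑u⁻¹
  have hx : ∀ s, aeval v (S.qs s) = x s * aeval v S.q := by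
    intro s
    simp only [x, ← hu, mul_assoc, Units.inv_mul, mul_one]
  have hcl : ∀ j, aeval v (clearDenom S.q S.qs (degreeBound θ) (θ j)) =
      aeval v S.q ^ degreeBound θ * aeval x (θ j) := fun j =>
    map_clearDenom (totalDegree_le_degreeBound θ _) (aeval v) x hx
  rw [hcl, IsUnit.mul_iff] at hl
  obtain ⟨hqD, w, hw⟩ := hl
  refine ⟨v S.l * ↑w⁻¹, x, hx, fun j => ?_⟩
  have h1 := hv _ (S.relation_mem j)
  rw [map_sub, map_mul, map_mul, hcl, hcl, aeval_X, aeval_X, ← hw] at h1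
  have h2 : aeval v S.q ^ degreeBound θ * (v S.l * aeval x (θ j) - v j * ↑w) = 0 := by
    linear_combination h1
  rw [hqD.mul_right_eq_zero, sub_eq_zero] at h2
  calc v j = v j * ↑w * ↑w⁻¹ := by rw [mul_assoc, Units.mul_inv, mul_one]
    _ = _ := by rw [← h2]; ring

/-- Over the infinite field `ℂ`, pointwise vanishing is a polynomial identity, with the variable
`none` for the scale `t`. The identity can be specialized in every algebra, and it presents `I` as
the kernel of a map to a domain. -/
theorem mem_iff_aeval_option {f : MvPolynomial (Fin n) ℂ} :
    f ∈ I ↔ aeval (fun j => X none * rename (some : σ → Option σ) (θ j)) f = 0 := by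
  have hev : ∀ z : Option σ → ℂ,
      eval z (aeval (fun j => X none * rename (some : σ → Option σ) (θ j)) f) =
      eval (fun j => z none * eval (fun s => z (some s)) (θ j)) f := by
    intro z
    have := MvPolynomial.comp_aeval_apply
      (fun j => X none * rename (some : σ → Option σ) (θ j)) (aeval z) f
    rw [aeval_eq_eval] at this
    refine this.trans ?_
    rw [aeval_eq_eval]
    congr 2
    funext j
    simp only [map_mul, eval_X, eval_rename]
    rfl
  rw [S.mem_iff]
  constructor
  · intro h
    refine MvPolynomial.funext fun z => ?_
    rw [hev, map_zero, h]
  · intro h t x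
    have := congrArg (eval fun o : Option σ => o.elim t x) h
    rw [hev, map_zero] at this
    exact this

theorem aeval_mul_eq_zero {f : MvPolynomial (Fin n) ℂ} (hf : f ∈ I) {A : Type} [CommRing A]
    [Algebra ℂ A] (t : A) (x : σ → A) : aeval (fun j => t * aeval x (θ j)) f = 0 := by
  have h := congrArg (aeval fun o : Option σ => o.elim t x) (S.mem_iff_aeval_option.mp hf)
  rw [map_zero, MvPolynomial.comp_aeval_apply] at h
  rw [← h]
  congr 2
  funext j
  rw [map_mul, aeval_X, aeval_rename]
  rfl

theorem aeval_qs_mul {A : Type} [CommRing A] [Algebra ℂ A] (t : A) (x : σ → A) (s : σ) :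
    aeval (fun j => t * aeval x (θ j)) (S.qs s) =
      x s * aeval (fun j => t * aeval x (θ j)) S.q := by
  rw [IsHomogeneous.aeval_mul (S.hom_qs s), IsHomogeneous.aeval_mul S.hom_q]
  have h := congrArg (aeval x) (S.inv s)
  rw [map_mul, aeval_X, MvPolynomial.comp_aeval_apply, MvPolynomial.comp_aeval_apply] at h
  rw [h]
  ring

theorem eq_of_eq_mul {A : Type} [CommRing A] [Algebra ℂ A] {t t' : A} {x x' : σ → A}
    (h : ∀ j, t * aeval x (θ j) = t' * aeval x' (θ j))
    (hu : IsUnit (aeval (fun j => t * aeval x (θ j)) S.q)) : x = x' := by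
  funext s
  have h1 := S.aeval_qs_mul t x s
  have h2 := S.aeval_qs_mul t' x' s
  rw [← funext h, h1] at h2
  exact hu.mul_left_inj.mp h2

end AffineInverse

namespace AffineInverse

variable {n : ℕ} {σ : Type} [Fintype σ] {θ : Fin n → MvPolynomial σ ℂ}
  {I : Ideal (MvPolynomial (Fin n) ℂ)}

/-- The elements of `DualNumber ℂ` with invertible real part are units. -/
theorem _root_.RayleighRitz.isUnit_dualNumber {z : DualNumber ℂ} (h : z.fst ≠ 0) : IsUnit z :=
  TrivSqZeroExt.isUnit_iff_isUnit_fst.mpr (isUnit_iff_ne_zero.mpr h)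

omit [Fintype σ] in
theorem q_ne_zero (S : AffineInverse θ I) {v : Fin n → ℂ} (h : eval v S.goodForm ≠ 0) :
    eval v S.q ≠ 0 := by
  rw [goodForm, map_mul] at h
  exact left_ne_zero_of_mul h

omit [Fintype σ] in
theorem θ_ne_zero (S : AffineInverse θ I) {x : σ → ℂ} {t : ℂ}
    (h : eval (fun j => t * eval x (θ j)) S.goodForm ≠ 0) : eval x (θ S.l) ≠ 0 := by
  intro h0
  apply h
  have h1 := IsHomogeneous.eval_smul S.isHomogeneous_goodForm t (fun j => eval x (θ j))
  have h2 := congrArg (eval x) S.aeval_goodForm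
  have h3 : eval x (aeval θ S.goodForm) = eval (fun j => eval x (θ j)) S.goodForm :=
    MvPolynomial.comp_aeval_apply θ (aeval x) S.goodForm
  rw [h3, map_mul, map_mul, h0, mul_zero, mul_zero] at h2
  rw [h2, mul_zero] at h1
  exact h1

/-- A tangent vector `w` is a dual-number point `v + ε w` of the cone. Where the inverse is defined,
`exists_eq_mul` lifts this point through `θ`, and its `ε`-part is then a jet. Conversely `θ` maps
dual-number points into the cone. -/
theorem coneTangent_eq_jetSpan {V : Set (PSpace n)} (S : AffineInverse θ (definingIdeal V))
    {x : σ → ℂ} (hx : eval (fun j => eval x (θ j)) S.goodForm ≠ 0) :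
    coneTangent V (fun j => eval x (θ j)) = jetSpan θ x := by
  ext w
  constructor
  · intro hw
    rw [mem_coneTangent_iff] at hw
    set v : Fin n → DualNumber ℂ := fun j => dual (eval x (θ j)) (w j) with hv
    have hfst : ∀ f, (aeval v f).fst = eval (fun j => eval x (θ j)) f := by
      intro f
      rw [fst_aeval_dualNumber]
      simp [hv]
    obtain ⟨t, X, hX, hvX⟩ := S.exists_eq_mul (A := DualNumber ℂ) (v := v) (fun f hf => by
        ext
        · rw [hfst]
          simpa using (S.mem_iff f).mp hf 1 x
        · exact hw f hf) (isUnit_dualNumber (by rwa [hfst]))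
    have hq := S.q_ne_zero hx
    have hXx : ∀ s, (X s).fst = x s := by
      intro s
      have h1 := congrArg TrivSqZeroExt.fst (hX s)
      rw [TrivSqZeroExt.fst_mul, hfst, hfst] at h1
      have h2 := S.aeval_qs_mul (A := ℂ) 1 x s
      simp only [one_mul, aeval_eq_eval] at h2
      rw [h2] at h1
      exact (mul_right_cancel₀ hq h1).symm
    have ht : t.fst ≠ 0 := by
      intro h0
      have h1 := congrArg TrivSqZeroExt.fst (hvX S.l)
      rw [TrivSqZeroExt.fst_mul, h0, zero_mul, hv, fst_dual] at h1
      exact S.θ_ne_zero (t := 1) (by simpa using hx) h1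
    refine mem_jetSpan_of_dualNumber ht hXx fun j => ?_
    rw [← hvX, hv, snd_dual]
  · intro hw
    obtain ⟨t, X, ht, hX, hw⟩ := mem_jetSpan_iff_dualNumber.mp hw
    rw [mem_coneTangent_iff]
    intro f hf
    have h1 := S.aeval_mul_eq_zero hf t X
    have h2 : (fun j => dual (eval x (θ j)) (w j)) = fun j => t * aeval X (θ j) := by
      funext j
      ext
      · rw [fst_dual, TrivSqZeroExt.fst_mul, ht, one_mul, fst_aeval_dualNumber, funext hX]
      · rw [snd_dual, hw]
    rw [h2, h1, TrivSqZeroExt.snd_zero]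

/-- A linear relation with coefficients `c` says that `(1 + c₀ ε) θ(x + ε c)` and `θ(x)` are the
same dual-number point. The inverse recovers the argument, so `c = 0`, and then `c₀ = 0` because `θ
l` does not vanish at `x`. -/
theorem linearIndependent_jetVec (S : AffineInverse θ I)
    {x : σ → ℂ} (hx : eval (fun j => eval x (θ j)) S.goodForm ≠ 0) :
    LinearIndependent ℂ (jetVec θ x) := by
  rw [Fintype.linearIndependent_iff]
  intro c hc
  have hq := S.q_ne_zero hx
  have hsum : ∀ j, c none * eval x (θ j) + ∑ s, c (some s) * eval x (pderiv s (θ j)) = 0 := by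
    intro j
    have := congrFun hc j
    simpa [Fintype.sum_option, jetVec] using this
  have heq := S.eq_of_eq_mul (A := DualNumber ℂ) (t := dual 1 (c none)) (t' := 1)
    (x := fun s => dual (x s) (c (some s))) (x' := fun s => dual (x s) 0) (fun j => by
      ext
      · simp [TrivSqZeroExt.fst_mul, fst_aeval_dualNumber]
      · rw [DualNumber.snd_mul, snd_aeval_dualNumber, fst_aeval_dualNumber, one_mul,
          snd_aeval_dualNumber]
        simp only [fst_dual, snd_dual, zero_mul, Finset.sum_const_zero]
        linear_combination hsum j)
    (isUnit_dualNumber (by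
      rw [fst_aeval_dualNumber]
      simpa [TrivSqZeroExt.fst_mul, fst_aeval_dualNumber] using hq))
  have hs : ∀ s, c (some s) = 0 := by
    intro s
    have := congrArg TrivSqZeroExt.snd (congrFun heq s)
    simpa using this
  have h0 : c none = 0 := by
    have := hsum S.l
    simp only [hs, zero_mul, Finset.sum_const_zero, add_zero] at this
    exact (mul_eq_zero.mp this).resolve_right (S.θ_ne_zero (t := 1) (by simpa using hx))
  rintro (_ | s)
  · exact h0
  · exact hs s

theorem finrank_jetSpan (S : AffineInverse θ I)
    {x : σ → ℂ} (hx : eval (fun j => eval x (θ j)) S.goodForm ≠ 0) :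
    Module.finrank ℂ (jetSpan θ x) = Fintype.card σ + 1 := by
  rw [jetSpan_eq_span_range, finrank_span_eq_card (S.linearIndependent_jetVec hx),
    Fintype.card_option]

/-- The map from the coordinate ring of projective space to that of the cone. -/
def coneMap (θ : Fin n → MvPolynomial σ ℂ) :
    MvPolynomial (Fin n) ℂ →ₐ[ℂ] MvPolynomial (Option σ) ℂ :=
  aeval fun j => X none * rename some (θ j)

omit [Fintype σ] in
theorem ker_coneMap (S : AffineInverse θ I) : RingHom.ker (coneMap θ) = I := by
  ext f
  exact S.mem_iff_aeval_option.symm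

omit [Fintype σ] in
theorem isPrime (S : AffineInverse θ I) : I.IsPrime := by
  rw [← S.ker_coneMap]
  exact RingHom.ker_isPrime _

/-- The coordinate ring of the cone is identified with the image `T` of `coneMap`. The inverse
exhibits each `X (some s)` as a quotient of elements of `T`, and then `θ l` does the same for `X
none` up to algebraic elements. So the full polynomial ring is algebraic over `T`. -/
theorem trdeg_eq (S : AffineInverse θ I) :
    Algebra.trdeg ℂ (MvPolynomial (Fin n) ℂ ⧸ I) = (Fintype.card σ + 1 : ℕ) := by
  have hI := S.ker_coneMap
  subst hI
  rw [(Ideal.quotientKerEquivRange (coneMap θ)).trdeg_eq]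
  set T := (coneMap θ).range
  have hT : ∀ f, IsAlgebraic T (coneMap θ f) := fun f =>
    isAlgebraic_algebraMap (⟨coneMap θ f, f, rfl⟩ : T)
  have hC : ∀ r : ℂ, IsAlgebraic T (C r : MvPolynomial (Option σ) ℂ) := by
    intro r
    have := hT (C r)
    rwa [coneMap, aeval_C] at this
  have hhom : ∀ {f : MvPolynomial (Fin n) ℂ} {d : ℕ}, f.IsHomogeneous d →
      coneMap θ f = X none ^ d * rename some (aeval θ f) := by
    intro f d hf
    rw [coneMap, IsHomogeneous.aeval_mul hf]
    congr 1
    exact (MvPolynomial.comp_aeval_apply θ (rename some) f).symm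
  have hrinj : Function.Injective (rename (R := ℂ) (some : σ → Option σ)) :=
    rename_injective _ (Option.some_injective _)
  have hX : ∀ s, IsAlgebraic T (X (some s) : MvPolynomial (Option σ) ℂ) := by
    intro s
    have h1 := hT (S.qs s)
    rw [hhom (S.hom_qs s), S.inv s, map_mul, rename_X, mul_left_comm, mul_comm,
      ← hhom S.hom_q] at h1
    refine IsAlgebraic.of_mul (mem_nonZeroDivisors_of_ne_zero ?_) (hT S.q) h1
    rw [hhom S.hom_q]
    refine mul_ne_zero (pow_ne_zero _ (X_ne_zero _)) ?_
    rw [Ne, map_eq_zero_iff _ hrinj]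
    exact S.ne_zero
  have hren : ∀ p : MvPolynomial σ ℂ, IsAlgebraic T (rename some p : MvPolynomial (Option σ) ℂ) := by
    intro p
    induction p using MvPolynomial.induction_on with
    | C a => rw [rename_C]; exact hC a
    | add p q hp hq => rw [map_add]; exact hp.add hq
    | mul_X p s hp => rw [map_mul, rename_X]; exact hp.mul (hX s)
  have ht : IsAlgebraic T (X none : MvPolynomial (Option σ) ℂ) := by
    have h1 := hT (X S.l)
    have e : coneMap θ (X S.l) = X none * rename some (θ S.l) := aeval_X _ _
    rw [e, mul_comm] at h1
    refine IsAlgebraic.of_mul (mem_nonZeroDivisors_of_ne_zero ?_) (hren (θ S.l)) h1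
    rw [Ne, map_eq_zero_iff _ hrinj]
    exact S.l_ne_zero
  have halg : Algebra.IsAlgebraic T (MvPolynomial (Option σ) ℂ) := by
    constructor
    intro p
    induction p using MvPolynomial.induction_on with
    | C a => exact hC a
    | add p q hp hq => exact hp.add hq
    | mul_X p o hp =>
      rcases o with _ | s
      · exact hp.mul ht
      · exact hp.mul (hX s)
  have : FaithfulSMul ℂ T :=
    (faithfulSMul_iff_algebraMap_injective _ _).mpr (algebraMap ℂ T).injective
  have h1 := trdeg_add_eq ℂ T (A := MvPolynomial (Option σ) ℂ)
  rw [trdeg_eq_zero (R := T), add_zero, MvPolynomial.trdeg_of_isDomain] at h1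
  rw [h1]
  simp

end AffineInverse

/-! ### Elimination over closed subsets of small dimension -/

/-- Every zero of `J` is a zero of one of its finitely many minimal primes, and for each of these
the image is contained in a hypersurface by `exists_eval_eq_zero_of_prime`. -/
theorem exists_eval_eq_zero_of_ideal {ι τ κ : Type} [Finite ι] [Finite τ] [Finite κ]
    (J : Ideal (MvPolynomial ι ℂ)) {r : ℕ}
    (hr : ∀ P : Ideal (MvPolynomial ι ℂ), P.IsPrime → J ≤ P →
      Algebra.trdeg ℂ (MvPolynomial ι ℂ ⧸ P) < r) (hc : r + Nat.card τ ≤ Nat.card κ)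
    (Φ : κ → MvPolynomial τ (MvPolynomial ι ℂ)) :
    Generically fun y : κ → ℂ => ∀ z : ι → ℂ, (∀ f ∈ J, eval z f = 0) → ∀ s : τ → ℂ,
      ¬ ∀ j, eval₂ (eval z) s (Φ j) = y j := by
  have hfin : Finite J.minimalPrimes := (Ideal.finite_minimalPrimes_of_isNoetherianRing _ J).to_subtype
  have h1 : ∀ P : J.minimalPrimes, Generically fun y : κ → ℂ => ∀ z : ι → ℂ,
      (∀ f ∈ P.1, eval z f = 0) → ∀ s : τ → ℂ, ¬ ∀ j, eval₂ (eval z) s (Φ j) = y j := by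
    rintro ⟨P, hP⟩
    have hPp : P.IsPrime := hP.1.1
    have hlt := hr P hPp hP.1.2
    obtain ⟨k, hk⟩ := Cardinal.lt_aleph0.mp (hlt.trans (Cardinal.natCast_lt_aleph0 (n := r)))
    rw [hk] at hlt
    have hkr : k < r := by exact_mod_cast hlt
    obtain ⟨F, hF, h⟩ := exists_eval_eq_zero_of_prime (τ := τ) (κ := κ) P hk.le (by omega) Φ
    refine ⟨F, hF, fun y hy z hz s hs => hy ?_⟩
    rw [← h z hz s]
    congr 2
    exact funext fun j => (hs j).symm
  refine (Generically.forall h1).mono fun y hy z hz s hs => ?_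
  have hker : (RingHom.ker (eval z)).IsPrime := RingHom.ker_isPrime _
  obtain ⟨P, hP, hPz⟩ := Ideal.exists_minimalPrimes_le (I := J) (J := RingHom.ker (eval z)) hz
  exact hy ⟨P, hP⟩ z hPz s hs

/-! ### A polynomial frame of the orthogonal complement of the rows of a matrix -/

section Perp

variable {n : ℕ} {ρ : Type} [Fintype ρ] [DecidableEq ρ] {A B : Type} [CommRing A] [CommRing B]

/-- The vectors orthogonal to the rows of `T` given by Cramer's rule for the columns `c`. -/
def perpVec (T : Matrix ρ (Fin n) A) (c : ρ → Fin n) (j k : Fin n) : A :=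
  (T.submatrix id c).det * (if k = j then 1 else 0) -
    ∑ r, (if c r = k then 1 else 0) * ((T.submatrix id c).adjugate * T) r j

theorem sum_mul_perpVec (T : Matrix ρ (Fin n) A) (c : ρ → Fin n) (j : Fin n) (r : ρ) :
    ∑ k, T r k * perpVec T c j k = 0 := by
  simp only [perpVec, mul_sub, Finset.sum_sub_distrib]
  have h1 : ∑ k, T r k * ((T.submatrix id c).det * (if k = j then 1 else 0)) =
      (T.submatrix id c).det * T r j := by simp [mul_comm]
  have h2 : ∑ k, T r k * ∑ r', (if c r' = k then 1 else 0) *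
      ((T.submatrix id c).adjugate * T) r' j =
      (T.submatrix id c * ((T.submatrix id c).adjugate * T)) r j := by
    rw [Matrix.mul_apply]
    simp only [Finset.mul_sum]
    rw [Finset.sum_comm]
    refine Finset.sum_congr rfl fun r' _ => ?_
    simp
  rw [h1, h2, ← Matrix.mul_assoc, Matrix.mul_adjugate, Matrix.smul_mul, Matrix.one_mul,
    Matrix.smul_apply, smul_eq_mul, sub_self]

theorem perpVec_col (T : Matrix ρ (Fin n) A) (c : ρ → Fin n) (r : ρ) (k : Fin n) :
    perpVec T c (c r) k = 0 := by
  have h1 : ∀ r', ((T.submatrix id c).adjugate * T) r' (c r) =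
      if r' = r then (T.submatrix id c).det else 0 := by
    intro r'
    have h2 : ((T.submatrix id c).adjugate * T) r' (c r) =
        ((T.submatrix id c).adjugate * T.submatrix id c) r' r := rfl
    rw [h2, Matrix.adjugate_mul, Matrix.smul_apply, Matrix.one_apply, smul_eq_mul]
    simp
  simp only [perpVec, h1]
  simp [eq_comm]

/-- The vectors attached to the selected columns vanish, so the sum may run over all `j`.
Orthogonality of `u` to the rows kills the adjugate term and leaves the determinant times `u`. When
the minor is nonzero, the remaining vectors thus span the orthogonal complement. -/
theorem sum_smul_perpVec (T : Matrix ρ (Fin n) A) (c : ρ → Fin n) {u : Fin n → A}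
    (hu : ∀ r, ∑ k, T r k * u k = 0) (k : Fin n) :
    ∑ j : {j : Fin n // ∀ r, c r ≠ j}, u j * perpVec T c j k = (T.submatrix id c).det * u k := by
  classical
  have h0 : ∑ j : {j : Fin n // ∀ r, c r ≠ j}, u j * perpVec T c j k =
      ∑ j, u j * perpVec T c j k := by
    rw [← Finset.sum_subtype (Finset.univ.filter fun j : Fin n => ∀ r, c r ≠ j) (by simp)
      (fun j => u j * perpVec T c j k), Finset.sum_filter_of_ne]
    rintro j - hj r rfl
    exact hj (by rw [perpVec_col, mul_zero])
  rw [h0]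
  simp only [perpVec, mul_sub, Finset.sum_sub_distrib]
  have h2 : ∑ j, u j * ∑ r, (if c r = k then 1 else 0) *
      ((T.submatrix id c).adjugate * T) r j = 0 := by
    simp only [Finset.mul_sum]
    rw [Finset.sum_comm]
    refine Finset.sum_eq_zero fun r _ => ?_
    have h3 : ∑ j, ((T.submatrix id c).adjugate * T) r j * u j = 0 := by
      have h4 : T.mulVec u = 0 := funext hu
      have h5 := congrFun (congrArg (fun z => (T.submatrix id c).adjugate.mulVec z) h4) r
      simp only [Matrix.mulVec_mulVec, Matrix.mulVec_zero] at h5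
      exact h5
    have h6 : ∀ j, u j * ((if c r = k then (1 : A) else 0) *
        ((T.submatrix id c).adjugate * T) r j) =
        (if c r = k then 1 else 0) * (((T.submatrix id c).adjugate * T) r j * u j) := by
      intro j; ring
    simp only [h6, ← Finset.mul_sum, h3, mul_zero]
  rw [h2]
  simp [mul_comm]

theorem perpVec_of_notMem (T : Matrix ρ (Fin n) A) (c : ρ → Fin n)
    (j : Fin n) {k : Fin n} (hk : ∀ r, c r ≠ k) :
    perpVec T c j k = if k = j then (T.submatrix id c).det else 0 := by
  simp [perpVec, hk]

theorem map_perpVec (f : A →+* B) (T : Matrix ρ (Fin n) A) (c : ρ → Fin n) (j k : Fin n) :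
    f (perpVec T c j k) = perpVec (T.map f) c j k := by
  have h1 : (T.map f).submatrix id c = f.mapMatrix (T.submatrix id c) := rfl
  simp only [perpVec, h1, ← RingHom.map_adjugate, ← RingHom.map_det]
  rw [map_sub, map_mul, map_sum]
  congr 1
  · congr 1
    split_ifs <;> simp
  · refine Finset.sum_congr rfl fun r _ => ?_
    rw [map_mul]
    congr 1
    · split_ifs <;> simp
    · rw [Matrix.mul_apply, map_sum, Matrix.mul_apply]
      simp

omit [DecidableEq ρ] in
theorem card_notMem_range {c : ρ → Fin n} (hc : Function.Injective c) :
    Fintype.card {j : Fin n // ∀ r, c r ≠ j} + Fintype.card ρ = n := by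
  classical
  have h1 : Fintype.card {j : Fin n // ∀ r, c r ≠ j} =
      Fintype.card {j : Fin n // ¬ ∃ r, c r = j} :=
    Fintype.card_congr (Equiv.subtypeEquivRight fun j => by push Not; rfl)
  have h2 : Fintype.card {j : Fin n // ∃ r, c r = j} = Fintype.card ρ :=
    Fintype.card_congr (Equiv.ofInjective c hc).symm
  have h3 := Fintype.card_subtype_compl (fun j : Fin n => ∃ r, c r = j)
  have h4 := Fintype.card_subtype_le (fun j : Fin n => ∃ r, c r = j)
  rw [Fintype.card_fin] at h3 h4
  omega

end Perp

section PerpField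

variable {n : ℕ} {ρ : Type} [Fintype ρ] [DecidableEq ρ]

theorem spansPerp_perpVec {T : Matrix ρ (Fin n) ℂ} {c : ρ → Fin n}
    (hc : (T.submatrix id c).det ≠ 0) :
    SpansPerp (fun j : {j : Fin n // ∀ r, c r ≠ j} => perpVec T c j)
      (Submodule.span ℂ (Set.range T)) := by
  intro u
  constructor
  · intro h
    have hu : ∀ r, ∑ k, T r k * u k = 0 := fun r => h (T r) (Submodule.subset_span ⟨r, rfl⟩)
    refine ⟨fun j => (T.submatrix id c).det⁻¹ * u j, ?_⟩
    funext k
    have := sum_smul_perpVec T c hu k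
    simp only [Finset.sum_apply, Pi.smul_apply, smul_eq_mul, mul_assoc, ← Finset.mul_sum, this]
    rw [inv_mul_cancel_left₀ hc]
  · rintro ⟨a, rfl⟩ w hw
    induction hw using Submodule.span_induction with
    | mem w hw =>
      obtain ⟨r, rfl⟩ := hw
      rw [dotProduct_sum]
      refine Finset.sum_eq_zero fun j _ => ?_
      rw [dotProduct_smul]
      have := sum_mul_perpVec T c j r
      rw [dotProduct, this, smul_zero]
    | zero => simp
    | add w w' _ _ h h' => rw [add_dotProduct, h, h', add_zero]
    | smul a w _ h => rw [smul_dotProduct, h, smul_zero]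

theorem linearIndependent_perpVec {T : Matrix ρ (Fin n) ℂ} {c : ρ → Fin n}
    (hc : (T.submatrix id c).det ≠ 0) :
    LinearIndependent ℂ (fun j : {j : Fin n // ∀ r, c r ≠ j} => perpVec T c j) := by
  rw [Fintype.linearIndependent_iff]
  intro a ha k
  have := congrFun ha k
  simp only [Finset.sum_apply, Pi.smul_apply, smul_eq_mul, perpVec_of_notMem T c _ k.2,
    Pi.zero_apply] at this
  rw [Finset.sum_eq_single k] at this
  · simpa [hc] using this
  · intro b _ hb
    rw [if_neg (fun h => hb (Subtype.ext h.symm)), mul_zero]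
  · simp

theorem injective_of_det_ne_zero {A : Type} [CommRing A] {T : Matrix ρ (Fin n) A} {c : ρ → Fin n}
    (hc : (T.submatrix id c).det ≠ 0) : Function.Injective c := by
  intro r r' h
  by_contra hne
  exact hc (Matrix.det_zero_of_column_eq hne fun k => by simp [h])

theorem exists_det_ne_zero {T : Matrix ρ (Fin n) ℂ}
    (hT : Module.finrank ℂ (Submodule.span ℂ (Set.range T)) = Fintype.card ρ) :
    ∃ c : ρ → Fin n, (T.submatrix id c).det ≠ 0 := by
  have h1 : Module.finrank ℂ (Submodule.span ℂ (Set.range T.col)) = Fintype.card ρ := by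
    rw [← Matrix.rank_eq_finrank_span_cols, Matrix.rank_eq_finrank_span_row]
    exact hT
  obtain ⟨f, hf, -, hli⟩ := Submodule.exists_fun_fin_finrank_span_eq ℂ (Set.range T.col)
  choose g hg using hf
  let e : ρ ≃ Fin (Module.finrank ℂ (Submodule.span ℂ (Set.range T.col))) :=
    (Fintype.equivFin ρ).trans (finCongr h1.symm)
  refine ⟨fun r => g (e r), ?_⟩
  have h2 : LinearIndependent ℂ (T.submatrix id fun r => g (e r)).col := by
    have h3 : (T.submatrix id fun r => g (e r)).col = f ∘ e := by
      funext r
      rw [Function.comp, ← hg]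
      rfl
    rw [h3]
    exact hli.comp e e.injective
  exact ((Matrix.isUnit_iff_isUnit_det _).mp
    (Matrix.linearIndependent_cols_iff_isUnit.mp h2)).ne_zero

end PerpField

/-! ### Incidence of points and symmetric matrices over affine space -/

section Incidence

variable {n : ℕ} {σ : Type} [Fintype σ] [DecidableEq σ]

/-- The matrix with rows the entries of `θ` and their partial derivatives. -/
def jetMatrix (θ : Fin n → MvPolynomial σ ℂ) : Matrix (Option σ) (Fin n) (MvPolynomial σ ℂ)
  | none => θ
  | some s => fun j => pderiv s (θ j)

omit [Fintype σ] [DecidableEq σ] in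
theorem map_jetMatrix (θ : Fin n → MvPolynomial σ ℂ) (x : σ → ℂ) :
    (jetMatrix θ).map (eval x) = jetVec θ x := by
  ext o j
  cases o <;> rfl

/-- A maximal minor of the matrix of `θ` and its partial derivatives. -/
def jetMinor (θ : Fin n → MvPolynomial σ ℂ) (c : Option σ → Fin n) : MvPolynomial σ ℂ :=
  ((jetMatrix θ).submatrix id c).det

theorem eval_jetMinor (θ : Fin n → MvPolynomial σ ℂ) (c : Option σ → Fin n) (x : σ → ℂ) :
    eval x (jetMinor θ c) = (Matrix.submatrix (jetVec θ x) id c).det := by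
  rw [jetMinor, RingHom.map_det, ← map_jetMatrix]
  rfl

theorem spansPerp_jet {θ : Fin n → MvPolynomial σ ℂ} {c : Option σ → Fin n} {x : σ → ℂ}
    (hc : eval x (jetMinor θ c) ≠ 0) :
    SpansPerp (fun j : {j : Fin n // ∀ r, c r ≠ j} => perpVec (jetVec θ x) c j) (jetSpan θ x) := by
  rw [jetSpan_eq_span_range]
  rw [eval_jetMinor] at hc
  exact spansPerp_perpVec hc

/-- The parameters of the symmetric matrices for which a given point is critical. -/
abbrev IncidenceIdx (c : Option σ → Fin n) (i : Fin n) : Type :=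
  Option {j : Fin n // ∀ r, c r ≠ j} ⊕ Sym2 {j : Fin n // j ≠ i}

/-- The parametrization of the incidence, with coefficients in an algebra. -/
def incidenceMat {R : Type} [CommRing R] (θ : Fin n → MvPolynomial σ ℂ) (c : Option σ → Fin n)
    (i : Fin n) (φ : MvPolynomial σ ℂ →+* R) (s : IncidenceIdx c i → R) (e : Sym2 (Fin n)) : R :=
  paramMat i (fun j => φ (θ j))
    (fun (j : {j : Fin n // ∀ r, c r ≠ j}) k => φ (perpVec (jetMatrix θ) c j k)) s e.out.1 e.out.2

theorem map_incidenceMat {R : Type} [CommRing R] (θ : Fin n → MvPolynomial σ ℂ)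
    (c : Option σ → Fin n) (i : Fin n) (φ : MvPolynomial σ ℂ →+* R) (s : IncidenceIdx c i → R)
    (χ : R →+* ℂ) {x : σ → ℂ} (hx : χ.comp φ = eval x) (j l : Fin n) :
    χ (incidenceMat θ c i φ s s(j, l)) = paramMat i (fun j => eval x (θ j))
      (fun (j : {j : Fin n // ∀ r, c r ≠ j}) => perpVec (jetVec θ x) c j) (fun t => χ (s t)) j l := by
  rw [incidenceMat, paramMat_out, map_paramMat]
  have h : ∀ p, χ (φ p) = eval x p := fun p => by rw [← hx]; rfl
  have h' : ∀ j k, eval x (perpVec (jetMatrix θ) c j k) = perpVec (jetVec θ x) c j k := fun j k => by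
    rw [map_perpVec, map_jetMatrix]
  simp only [h, h']

-- This is the dimension count behind the argument: base plus fibre of the incidence has the
-- dimension of `Sym²`. An injective `c` selects `|σ| + 1` columns, which leaves `n - |σ| - 1`
-- conormal vectors.
omit [DecidableEq σ] in
theorem card_incidenceIdx {c : Option σ → Fin n} (hc : Function.Injective c) (i : Fin n) :
    Fintype.card σ + Nat.card (IncidenceIdx c i) = Nat.card (Sym2 (Fin n)) := by
  have h1 := card_paramIdx (ν := {j : Fin n // ∀ r, c r ≠ j}) i
  change Nat.card (IncidenceIdx c i) + n = _ at h1
  have h2 := card_notMem_range hc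
  rw [Fintype.card_option] at h2
  omega

omit [Fintype σ] [DecidableEq σ] in
theorem mem_jetSpan_self (θ : Fin n → MvPolynomial σ ℂ) (x : σ → ℂ) :
    (fun j => eval x (θ j)) ∈ jetSpan θ x :=
  Submodule.subset_span (Or.inl rfl)

omit [DecidableEq σ] in
theorem exists_ne_zero_of_dotProduct_self {v : Fin n → ℂ} (hv : v ⬝ᵥ v ≠ 0) : ∃ i, v i ≠ 0 := by
  by_contra h
  push Not at h
  exact hv (by simp [dotProduct, h])

/-- For a general symmetric matrix, no immersive critical point lies on a given hypersurface. -/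
theorem generically_eval_ne_zero (θ : Fin n → MvPolynomial σ ℂ) {h : MvPolynomial σ ℂ}
    (hh : h ≠ 0) :
    Generically fun y : Sym2 (Fin n) → ℂ => ∀ x : σ → ℂ,
      (fun j => eval x (θ j)) ⬝ᵥ (fun j => eval x (θ j)) ≠ 0 →
      Module.finrank ℂ (jetSpan θ x) = Fintype.card σ + 1 →
      CritAt (symMat y) (fun j => eval x (θ j)) (jetSpan θ x) → eval x h ≠ 0 := by
  -- Where a fixed maximal minor and a fixed coordinate are nonzero, the incidence is one polynomial
  -- family. Finitely many such loci cover the immersive nonisotropic points.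
  have key : ∀ ci : (Option σ → Fin n) × Fin n, Generically fun y : Sym2 (Fin n) → ℂ =>
      ∀ x : σ → ℂ, (fun j => eval x (θ j)) ⬝ᵥ (fun j => eval x (θ j)) ≠ 0 →
      eval x (jetMinor θ ci.1) ≠ 0 → eval x (θ ci.2) ≠ 0 →
      CritAt (symMat y) (fun j => eval x (θ j)) (jetSpan θ x) → eval x h ≠ 0 := by
    rintro ⟨c, i⟩
    by_cases hc : Function.Injective c
    swap
    · refine ⟨1, one_ne_zero, fun y _ x _ hx => absurd ?_ hx⟩
      by_contra h0
      rw [eval_jetMinor] at h0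
      exact hc (injective_of_det_ne_zero h0)
    -- A prime that contains the nonzero `h` has a quotient of transcendence degree below `|σ|`, so
    -- the family over `h = 0` has too few parameters to dominate `Sym²`.
    have h1 := exists_eval_eq_zero_of_ideal (τ := IncidenceIdx c i) (κ := Sym2 (Fin n))
      (Ideal.span {h}) (r := Fintype.card σ) (fun P hP hle => by
        have hne : (⊥ : Ideal (MvPolynomial σ ℂ)) < P := by
          rw [bot_lt_iff_ne_bot]
          rintro rfl
          exact hh (by simpa using hle)
        have h2 := trdeg_quotient_lt_of_lt hne
        rw [(AlgEquiv.quotientBot ℂ (MvPolynomial σ ℂ)).trdeg_eq,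
          MvPolynomial.trdeg_of_isDomain] at h2
        simpa using h2) (card_incidenceIdx hc i).le
      (incidenceMat θ c i C X)
    refine h1.mono fun y hy x hv hx hi hcrit h0 => ?_
    obtain ⟨s, hs⟩ := exists_paramMat_of_critAt (mem_jetSpan_self θ x) hv (spansPerp_jet hx) hi hcrit
    refine hy x (fun f hf => ?_) s fun e => ?_
    · obtain ⟨g, rfl⟩ := Ideal.mem_span_singleton'.mp hf
      rw [map_mul, h0, mul_zero]
    · induction e with
      | _ j l =>
        have h3 := map_incidenceMat θ c i C X (eval₂Hom (eval x) s) (x := x)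
          (RingHom.ext fun p => by simp) j l
        rw [← coe_eval₂Hom, h3]
        simpa using hs j l
  refine (Generically.forall key).mono fun y hy x hv hx hcrit => ?_
  rw [jetSpan_eq_span_range, ← Fintype.card_option] at hx
  obtain ⟨c, hc⟩ := exists_det_ne_zero hx
  obtain ⟨i, hi⟩ := exists_ne_zero_of_dotProduct_self hv
  exact hy (c, i) x hv (by rwa [eval_jetMinor]) hi hcrit

/-- For a general symmetric matrix, the number of immersive critical points off a suitable
hypersurface is finite and constant. -/
theorem exists_generically_ncard_eq (θ : Fin n → MvPolynomial σ ℂ) (h : MvPolynomial σ ℂ)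
    (hh : ∀ x, eval x h ≠ 0 → Module.finrank ℂ (jetSpan θ x) = Fintype.card σ + 1) :
    ∃ d : ℕ, Generically fun y : Sym2 (Fin n) → ℂ =>
      {x : σ → ℂ | eval x h ≠ 0 ∧ (fun j => eval x (θ j)) ⬝ᵥ (fun j => eval x (θ j)) ≠ 0 ∧
        CritAt (symMat y) (fun j => eval x (θ j)) (jetSpan θ x)}.Finite ∧
      {x : σ → ℂ | eval x h ≠ 0 ∧ (fun j => eval x (θ j)) ⬝ᵥ (fun j => eval x (θ j)) ≠ 0 ∧
        CritAt (symMat y) (fun j => eval x (θ j)) (jetSpan θ x)}.ncard = d := by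
  by_cases hz : ∀ x, eval x h ≠ 0 → (fun j => eval x (θ j)) ⬝ᵥ (fun j => eval x (θ j)) = 0
  · refine ⟨0, 1, one_ne_zero, fun y _ => ?_⟩
    have : {x : σ → ℂ | eval x h ≠ 0 ∧ (fun j => eval x (θ j)) ⬝ᵥ (fun j => eval x (θ j)) ≠ 0 ∧
        CritAt (symMat y) (fun j => eval x (θ j)) (jetSpan θ x)} = ∅ := by
      rw [Set.eq_empty_iff_forall_notMem]
      rintro x ⟨h1, h2, -⟩
      exact h2 (hz x h1)
    simp [this]
  push Not at hz
  obtain ⟨x₀, hx₀, hv₀⟩ := hz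
  obtain ⟨i, hi⟩ := exists_ne_zero_of_dotProduct_self hv₀
  obtain ⟨c, hc⟩ : ∃ c, eval x₀ (jetMinor θ c) ≠ 0 := by
    have := hh x₀ hx₀
    rw [jetSpan_eq_span_range, ← Fintype.card_option] at this
    obtain ⟨c, hc⟩ := exists_det_ne_zero this
    exact ⟨c, by rwa [eval_jetMinor]⟩
  have hcinj : Function.Injective c := by
    rw [eval_jetMinor] at hc
    exact injective_of_det_ne_zero hc
  set D : MvPolynomial σ ℂ := ∑ j, θ j * θ j with hD
  have hDx : ∀ x, eval x D = (fun j => eval x (θ j)) ⬝ᵥ (fun j => eval x (θ j)) := by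
    intro x; simp [hD, dotProduct]
  -- One choice of `c` and `i`, made at the sample point `x₀`, suffices: for general matrices no
  -- critical point with `h ≠ 0` lies on the hypersurface `g = 0`.
  set g : MvPolynomial σ ℂ := jetMinor θ c * θ i with hg
  have hg0 : g ≠ 0 := by
    intro h0
    have := congrArg (eval x₀) h0
    rw [hg, map_mul, map_zero] at this
    exact mul_ne_zero hc hi this
  let φ : MvPolynomial σ ℂ →+* MvPolynomial (σ ⊕ IncidenceIdx c i) ℂ := (rename Sum.inl).toRingHom
  obtain ⟨d, F, hF, hd⟩ := exists_ncard_fiber_eq (ι := σ ⊕ IncidenceIdx c i) (κ := Sym2 (Fin n))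
    (by rw [Nat.card_sum, Nat.card_eq_fintype_card (α := σ), card_incidenceIdx hcinj i])
    (incidenceMat θ c i φ fun t => X (Sum.inr t)) (φ (h * D * g))
  have hφ : ∀ z : σ ⊕ IncidenceIdx c i → ℂ,
      (eval z).comp φ = eval fun s => z (Sum.inl s) := by
    intro z
    refine RingHom.ext fun p => ?_
    change eval z (rename Sum.inl p) = _
    rw [eval_rename]
    rfl
  refine ⟨d, (Generically.and ⟨F, hF, hd⟩ (generically_eval_ne_zero θ hg0)).mono ?_⟩
  rintro y ⟨⟨hfin, hcard⟩, hgen⟩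
  set Z := {z : σ ⊕ IncidenceIdx c i → ℂ | eval z (φ (h * D * g)) ≠ 0 ∧
    ∀ e, eval z (incidenceMat θ c i φ (fun t => X (Sum.inr t)) e) = y e} with hZ
  have hmemZ : ∀ z, z ∈ Z ↔ eval (fun s => z (Sum.inl s)) (h * D * g) ≠ 0 ∧ ∀ j l,
      paramMat i (fun j => eval (fun s => z (Sum.inl s)) (θ j))
        (fun (j : {j : Fin n // ∀ r, c r ≠ j}) => perpVec (jetVec θ fun s => z (Sum.inl s)) c j)
        (fun t => z (Sum.inr t)) j l = y s(j, l) := by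
    intro z
    have h1 : eval z (φ (h * D * g)) = eval (fun s => z (Sum.inl s)) (h * D * g) := by
      rw [← hφ]; rfl
    rw [hZ]
    change (_ ∧ _) ↔ _
    rw [h1]
    refine and_congr_right fun _ => ?_
    have h2 : ∀ j l, eval z (incidenceMat θ c i φ (fun t => X (Sum.inr t)) s(j, l)) = _ :=
      fun j l => map_incidenceMat θ c i φ (fun t => X (Sum.inr t)) (eval z) (hφ z) j l
    constructor
    · intro H j l
      have := H s(j, l)
      rw [h2] at this
      simpa using this
    · intro H e
      induction e with
      | _ j l =>
        rw [h2]
        simpa using H j l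
  -- The critical points are the projection of a fibre of the map from the parameters to `Sym²`. The
  -- projection is injective on the fibre by `paramMat_injective`, so the cardinalities agree.
  have himg : {x : σ → ℂ | eval x h ≠ 0 ∧ (fun j => eval x (θ j)) ⬝ᵥ (fun j => eval x (θ j)) ≠ 0 ∧
      CritAt (symMat y) (fun j => eval x (θ j)) (jetSpan θ x)} =
      (fun z : σ ⊕ IncidenceIdx c i → ℂ => fun s => z (Sum.inl s)) '' Z := by
    ext x
    constructor
    · rintro ⟨h1, h2, h3⟩
      have h4 := hgen x h2 (hh x h1) h3
      have h5 := h4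
      rw [hg, map_mul] at h5
      obtain ⟨s, hs⟩ := exists_paramMat_of_critAt (mem_jetSpan_self θ x) h2
        (spansPerp_jet (left_ne_zero_of_mul h5)) (right_ne_zero_of_mul h5) h3
      refine ⟨Sum.elim x s, (hmemZ _).mpr ⟨?_, hs⟩, rfl⟩
      simp only [Sum.elim_inl, map_mul, hDx]
      exact mul_ne_zero (mul_ne_zero h1 h2) h4
    · rintro ⟨z, hz, rfl⟩
      obtain ⟨h1, h2⟩ := (hmemZ z).mp hz
      simp only [map_mul, hDx, hg] at h1
      have h3 := left_ne_zero_of_mul h1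
      have h4 := left_ne_zero_of_mul (right_ne_zero_of_mul h1)
      exact ⟨left_ne_zero_of_mul h3, right_ne_zero_of_mul h3,
        critAt_of_paramMat (mem_jetSpan_self θ _) (right_ne_zero_of_mul h3) (spansPerp_jet h4) h2⟩
  have hinj : Set.InjOn (fun z : σ ⊕ IncidenceIdx c i → ℂ => fun s => z (Sum.inl s)) Z := by
    intro z hz z' hz' hzz
    simp only at hzz
    obtain ⟨h1, h2⟩ := (hmemZ z).mp hz
    obtain ⟨-, h2'⟩ := (hmemZ z').mp hz'
    rw [← hzz] at h2'
    simp only [map_mul, hDx, hg] at h1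
    have h3 := right_ne_zero_of_mul (left_ne_zero_of_mul h1)
    have h4 := left_ne_zero_of_mul (right_ne_zero_of_mul h1)
    have h5 := right_ne_zero_of_mul (right_ne_zero_of_mul h1)
    have h6 := paramMat_injective (mem_jetSpan_self θ _) h3 (spansPerp_jet h4)
      (by rw [eval_jetMinor] at h4; exact linearIndependent_perpVec h4) h5
      (fun j l => (h2 j l).trans (h2' j l).symm)
    funext t
    rcases t with s | t
    · exact congrFun hzz s
    · exact congrFun h6 t
  rw [himg]
  exact ⟨hfin.image _, by rw [hinj.ncard_image, hcard]⟩

end Incidence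

/-! ### Orthogonal complements for the dot product -/

/-- The dot product as a bilinear form. -/
def dotForm (n : ℕ) : LinearMap.BilinForm ℂ (Fin n → ℂ) := dotProductBilin ℂ ℂ

theorem dotForm_apply {n : ℕ} (v w : Fin n → ℂ) : dotForm n v w = v ⬝ᵥ w := rfl

theorem dotForm_isRefl (n : ℕ) : (dotForm n).IsRefl := by
  intro v w h
  rw [dotForm_apply] at h ⊢
  rwa [dotProduct_comm]

theorem dotForm_nondegenerate (n : ℕ) : (dotForm n).Nondegenerate := by
  refine ((dotForm_isRefl n).nondegenerate_iff_separatingLeft).mpr fun v hv => ?_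
  exact dotProduct_eq_zero v fun w => hv w

theorem mem_orthogonal_dotForm {n : ℕ} {W : Submodule ℂ (Fin n → ℂ)} {u : Fin n → ℂ} :
    u ∈ (dotForm n).orthogonal W ↔ ∀ w ∈ W, w ⬝ᵥ u = 0 := Iff.rfl

/-! ### The dimension of a hyperplane section of the affine cone -/

section Cone

variable {n : ℕ} {V : Set (PSpace n)}

theorem smul_mem_cone {v : Fin n → ℂ} {c : ℂ} (hc : c ≠ 0) (hv : v ∈ cone V) : c • v ∈ cone V := by
  obtain ⟨h0, h⟩ := hv
  refine ⟨smul_ne_zero hc h0, ?_⟩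
  rwa [(Projectivization.mk_eq_mk_iff' ℂ _ _ _ h0).mpr ⟨c, rfl⟩]

theorem mem_definingIdeal {f : MvPolynomial (Fin n) ℂ} :
    f ∈ definingIdeal V ↔ ∀ v ∈ cone V, eval v f = 0 := by
  simp only [definingIdeal, mem_vanishingIdeal_iff, aeval_eq_eval]

theorem ringHom_aeval {ι S T : Type} [CommRing S] [Algebra ℂ S] [CommRing T] [Algebra ℂ T]
    (χ : S →+* T) (hχ : ∀ r, χ (algebraMap ℂ S r) = algebraMap ℂ T r) (x : ι → S)
    (f : MvPolynomial ι ℂ) : χ (aeval x f) = aeval (fun i => χ (x i)) f :=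
  MvPolynomial.comp_aeval_apply x ({ χ with commutes' := hχ } : S →ₐ[ℂ] T) f

/-- The coefficients in the scaling variable are the homogeneous components of `f`. At a vector `v`
of the cone, `t ↦ f(t v)` vanishes for all `t ≠ 0`, so all its coefficients are zero. -/
theorem coeff_scale_mem {f : MvPolynomial (Fin n) ℂ} (hf : f ∈ definingIdeal V) (k : ℕ) :
    (aeval (fun j => (Polynomial.X * Polynomial.C (X j) :
      Polynomial (MvPolynomial (Fin n) ℂ))) f).coeff k ∈ definingIdeal V := by
  rw [mem_definingIdeal]
  intro v hv
  set p := aeval (fun j => (Polynomial.X * Polynomial.C (X j) :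
      Polynomial (MvPolynomial (Fin n) ℂ))) f
  have h1 : ∀ t : ℂ, Polynomial.eval t (p.map (eval v)) = eval (t • v) f := by
    intro t
    let χ : Polynomial (MvPolynomial (Fin n) ℂ) →+* ℂ := Polynomial.eval₂RingHom (eval v) t
    have h2 : Polynomial.eval t (p.map (eval v)) = χ p := Polynomial.eval_map _ _
    rw [h2]
    have h3 : χ.comp (aeval (fun j => (Polynomial.X * Polynomial.C (X j) :
      Polynomial (MvPolynomial (Fin n) ℂ)))).toRingHom = eval (t • v) := by
      refine MvPolynomial.ringHom_ext (fun r => ?_) fun j => ?_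
      · simp [χ, IsScalarTower.algebraMap_apply ℂ (MvPolynomial (Fin n) ℂ)
          (Polynomial (MvPolynomial (Fin n) ℂ)), MvPolynomial.algebraMap_eq]
      · simp only [χ, RingHom.comp_apply, AlgHom.toRingHom_eq_coe, RingHom.coe_coe, aeval_X,
          Polynomial.coe_eval₂RingHom, Polynomial.eval₂_mul, Polynomial.eval₂_X,
          Polynomial.eval₂_C, eval_X, Pi.smul_apply, smul_eq_mul]
    exact congrArg (fun g => g f) h3
  have h2 : p.map (eval v) = 0 := by
    refine Polynomial.eq_zero_of_infinite_isRoot _ (Set.Infinite.mono (s := {t : ℂ | t ≠ 0}) ?_ ?_)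
    · intro t ht
      exact (h1 t).trans (mem_definingIdeal.mp hf _ (smul_mem_cone ht hv))
    · exact (Set.finite_singleton (0 : ℂ)).infinite_compl
  have := congrArg (fun r => Polynomial.coeff r k) h2
  simpa using this

/-- Between `I_V` and `P` lies the ideal of the cone over the zeros of `P`, namely the kernel of `f
↦ f(t x)` with `x` taken modulo `P`. It contains the form `g ∉ I_V`, but not `X i - 1 ∈ P`. Both
inclusions are strict, so the transcendence degree drops twice from `N + 1`. -/
theorem trdeg_lt_of_hyperplane_section [(definingIdeal V).IsPrime] {N : ℕ}
    (hN : Algebra.trdeg ℂ (MvPolynomial (Fin n) ℂ ⧸ definingIdeal V) = (N + 1 : ℕ))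
    {g : MvPolynomial (Fin n) ℂ} {d : ℕ} (hg : g.IsHomogeneous d) (hgI : g ∉ definingIdeal V)
    {i : Fin n} {P : Ideal (MvPolynomial (Fin n) ℂ)} [P.IsPrime] (hIP : definingIdeal V ≤ P)
    (hgP : g ∈ P) (hiP : X i - 1 ∈ P) :
    Algebra.trdeg ℂ (MvPolynomial (Fin n) ℂ ⧸ P) < N := by
  set q : MvPolynomial (Fin n) ℂ →ₐ[ℂ] MvPolynomial (Fin n) ℂ ⧸ P := Ideal.Quotient.mkₐ ℂ P with hq
  let φ : MvPolynomial (Fin n) ℂ →ₐ[ℂ] Polynomial (MvPolynomial (Fin n) ℂ ⧸ P) :=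
    aeval fun j => Polynomial.X * Polynomial.C (q (X j))
  have hqP : ∀ f, q f = 0 ↔ f ∈ P := fun f => Ideal.Quotient.eq_zero_iff_mem
  have hφI : ∀ f ∈ definingIdeal V, φ f = 0 := by
    intro f hf
    have h1 : φ f = (aeval (fun j => (Polynomial.X * Polynomial.C (X j) :
        Polynomial (MvPolynomial (Fin n) ℂ))) f).map q.toRingHom := by
      have := ringHom_aeval (Polynomial.mapRingHom q.toRingHom)
        (T := Polynomial (MvPolynomial (Fin n) ℂ ⧸ P)) (fun r => by
          rw [Polynomial.algebraMap_apply, Polynomial.algebraMap_apply, Polynomial.coe_mapRingHom,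
            Polynomial.map_C]
          exact congrArg Polynomial.C (q.commutes r))
        (fun j => (Polynomial.X * Polynomial.C (X j) : Polynomial (MvPolynomial (Fin n) ℂ))) f
      refine Eq.trans ?_ this.symm
      simp only [φ]
      congr 2
      funext j
      simp
    rw [h1]
    ext k
    rw [Polynomial.coeff_map, Polynomial.coeff_zero]
    exact (hqP _).mpr (hIP (coeff_scale_mem hf k))
  have hφg : φ g = 0 := by
    have h1 := IsHomogeneous.aeval_mul hg (Polynomial.X : Polynomial (MvPolynomial (Fin n) ℂ ⧸ P))
      (fun j => Polynomial.C (q (X j)))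
    have h2 : aeval (fun j => Polynomial.C (q (X j))) g = Polynomial.C (q g) := by
      have h3 := ringHom_aeval (S := MvPolynomial (Fin n) ℂ ⧸ P)
        (T := Polynomial (MvPolynomial (Fin n) ℂ ⧸ P)) Polynomial.C (fun r => rfl) (fun j => q (X j)) g
      have h4 := MvPolynomial.comp_aeval_apply (R := ℂ) (X : Fin n → MvPolynomial (Fin n) ℂ) q g
      rw [aeval_X_left] at h4
      rw [← h4] at h3
      exact h3.symm
    rw [h2, (hqP g).mpr hgP, map_zero, mul_zero] at h1
    exact h1
  have hφi : φ (X i - 1) ≠ 0 := by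
    have h1 : q (X i) = 1 := by
      have := (hqP _).mpr hiP
      rwa [map_sub, map_one, sub_eq_zero] at this
    rw [map_sub, map_one, aeval_X, h1, map_one, mul_one]
    exact Polynomial.X_sub_C_ne_zero (1 : MvPolynomial (Fin n) ℂ ⧸ P)
  have hkP : RingHom.ker φ ≤ P := by
    intro f hf
    have hf0 : φ f = 0 := hf
    have h1 : Polynomial.aeval (1 : MvPolynomial (Fin n) ℂ ⧸ P) (φ f) = q f := by
      have h5 := MvPolynomial.comp_aeval_apply (R := ℂ)
        (fun j => Polynomial.X * Polynomial.C (q (X j)))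
        ((Polynomial.aeval (1 : MvPolynomial (Fin n) ℂ ⧸ P)).restrictScalars ℂ) f
      have h4 := MvPolynomial.comp_aeval_apply (R := ℂ) (X : Fin n → MvPolynomial (Fin n) ℂ) q f
      rw [aeval_X_left] at h4
      refine h5.trans (Eq.trans ?_ h4.symm)
      congr 2
      funext j
      simp
    rw [hf0, map_zero] at h1
    exact (hqP f).mp h1.symm
  have hkp : (RingHom.ker φ).IsPrime := RingHom.ker_isPrime _
  have h1 : definingIdeal V < RingHom.ker φ :=
    lt_of_le_of_ne hφI fun h => hgI (h ▸ hφg)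
  have h2 : RingHom.ker φ < P := lt_of_le_of_ne hkP fun h => hφi (by
    have h5 : X i - 1 ∈ RingHom.ker φ := by rw [h]; exact hiP
    exact h5)
  have h3 := trdeg_quotient_lt_of_lt h1
  have h4 := trdeg_quotient_lt_of_lt h2
  rw [hN] at h3
  obtain ⟨k, hk⟩ := Cardinal.lt_aleph0.mp (h3.trans Cardinal.natCast_lt_aleph0)
  rw [hk] at h3 h4
  have hkN : k ≤ N := by
    have : k < N + 1 := by exact_mod_cast h3
    omega
  exact h4.trans_le (by exact_mod_cast hkN)

theorem coneTangent_smul {c : ℂ} (hc : c ≠ 0) (v : Fin n → ℂ) :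
    coneTangent V (c • v) = coneTangent V v := by
  have key : ∀ (c : ℂ) (v : Fin n → ℂ), c ≠ 0 → coneTangent V v ≤ coneTangent V (c • v) := by
    intro c v hc w hw f hf
    set f' : MvPolynomial (Fin n) ℂ := aeval (fun j => C c * X j) f with hf'
    have hev : ∀ u, eval u f' = eval (c • u) f := by
      intro u
      have h := MvPolynomial.comp_aeval_apply (R := ℂ)
        (fun j => (C c * X j : MvPolynomial (Fin n) ℂ)) (aeval u) f
      refine h.trans ?_
      rw [aeval_eq_eval]
      congr 2
      funext j
      simp
    have hmem : f' ∈ definingIdeal V := by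
      rw [mem_definingIdeal]
      intro u hu
      rw [hev]
      exact mem_definingIdeal.mp hf _ (smul_mem_cone hc hu)
    have h1 := mem_coneTangent_iff.mp hw f' hmem
    have h2 := MvPolynomial.comp_aeval_apply (R := ℂ)
        (fun j => (C c * X j : MvPolynomial (Fin n) ℂ)) (aeval fun j => dual (v j) (w j)) f
    rw [← hf'] at h2
    rw [h2, snd_aeval_dualNumber] at h1
    have h3 : ∀ j, aeval (fun j => dual (v j) (w j)) (C c * X j : MvPolynomial (Fin n) ℂ) =
        dual (c * v j) (c * w j) := by
      intro j
      rw [map_mul, aeval_X, aeval_C, TrivSqZeroExt.algebraMap_eq_inl]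
      ext <;> simp [dual]
    simp only [h3, fst_dual, snd_dual] at h1
    have h4 : c * ∑ j, eval (c • v) (pderiv j f) * w j = 0 := by
      rw [← h1, Finset.mul_sum]
      refine Finset.sum_congr rfl fun j _ => ?_
      rw [show (fun s => c * v s) = c • v from rfl]
      ring
    exact (mul_eq_zero.mp h4).resolve_left hc
  refine le_antisymm ?_ (key c v hc)
  have := key c⁻¹ (c • v) (inv_ne_zero hc)
  rwa [smul_smul, inv_mul_cancel₀ hc, one_smul] at this

/-- This is Euler's relation: `v + ε v = (1 + ε) v`, and in the expansion of `f((1 + ε) v)` by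
powers of the scale all coefficients vanish on the cone. -/
theorem self_mem_coneTangent {v : Fin n → ℂ} (hv : v ∈ cone V) : v ∈ coneTangent V v := by
  rw [mem_coneTangent_iff]
  intro f hf
  set p := aeval (fun j => (Polynomial.X * Polynomial.C (X j) :
      Polynomial (MvPolynomial (Fin n) ℂ))) f with hp
  let ev : MvPolynomial (Fin n) ℂ →+* DualNumber ℂ := (algebraMap ℂ (DualNumber ℂ)).comp (eval v)
  let χ : Polynomial (MvPolynomial (Fin n) ℂ) →+* DualNumber ℂ :=
    Polynomial.eval₂RingHom ev (dual 1 1)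
  have h3 : χ.comp (aeval (fun j => (Polynomial.X * Polynomial.C (X j) :
      Polynomial (MvPolynomial (Fin n) ℂ)))).toRingHom =
      (aeval (R := ℂ) fun j => dual (v j) (v j)).toRingHom := by
    refine MvPolynomial.ringHom_ext (fun r => ?_) fun j => ?_
    · simp [χ, ev, IsScalarTower.algebraMap_apply ℂ (MvPolynomial (Fin n) ℂ)
          (Polynomial (MvPolynomial (Fin n) ℂ)), MvPolynomial.algebraMap_eq]
    · have : algebraMap ℂ (DualNumber ℂ) (v j) * dual 1 1 = dual (v j) (v j) := by
        rw [TrivSqZeroExt.algebraMap_eq_inl]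
        ext <;> simp [dual]
      simpa [χ, ev] using this
  have h4 : aeval (fun j => dual (v j) (v j)) f = χ p := (congrArg (fun g => g f) h3).symm
  rw [h4]
  have h5 : χ p = Polynomial.eval₂ ev (dual 1 1) p := rfl
  rw [h5, Polynomial.eval₂_eq_sum_range, Finset.sum_eq_zero, TrivSqZeroExt.snd_zero]
  intro k _
  simp only [ev]
  rw [RingHom.comp_apply, mem_definingIdeal.mp (coeff_scale_mem hf k) v hv, map_zero, zero_mul]

end Cone

/-! ### The differential of the Rayleigh quotient -/

theorem hasFDerivAt_quadratic {n : ℕ} {H : Matrix (Fin n) (Fin n) ℂ} (hH : H.IsSymm)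
    (v : Fin n → ℂ) : ∃ L : (Fin n → ℂ) →L[ℂ] ℂ,
      HasFDerivAt (fun v : Fin n → ℂ => v ⬝ᵥ H.mulVec v) L v ∧
      ∀ w, L w = 2 * (w ⬝ᵥ H.mulVec v) := by
  have hc : ∀ j, HasFDerivAt (fun v : Fin n → ℂ => v j) (ContinuousLinearMap.proj (R := ℂ) j) v :=
    fun j => hasFDerivAt_apply j v
  refine ⟨_, HasFDerivAt.fun_sum (u := Finset.univ) fun j _ => (hc j).mul
    (HasFDerivAt.fun_sum (u := Finset.univ) fun l _ => (hc l).const_mul (H j l)), fun w => ?_⟩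
  have h1 : w ⬝ᵥ H.mulVec v = v ⬝ᵥ H.mulVec w := by
    rw [Matrix.dotProduct_mulVec, ← Matrix.mulVec_transpose, hH.eq, dotProduct_comm]
  have h2 : ∑ j, v j * ∑ l, H j l * w l = v ⬝ᵥ H.mulVec w := rfl
  have h4 : ∑ j, (∑ l, H j l * v l) * w j = w ⬝ᵥ H.mulVec v := dotProduct_comm _ _
  have h5 : 2 * (w ⬝ᵥ H.mulVec v) = ∑ j, v j * ∑ l, H j l * w l +
      ∑ j, (∑ l, H j l * v l) * w j := by
    rw [h2, h4, ← h1, two_mul]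
  rw [h5, ← Finset.sum_add_distrib]
  simp
  rfl

theorem hasFDerivAt_rayleigh {n : ℕ} {H : Matrix (Fin n) (Fin n) ℂ} (hH : H.IsSymm)
    {v : Fin n → ℂ} (hv : v ⬝ᵥ v ≠ 0) : ∃ L : (Fin n → ℂ) →L[ℂ] ℂ,
      HasFDerivAt (rayleigh H) L v ∧ ∀ w, L w = 2 * ((w ⬝ᵥ H.mulVec v) * (v ⬝ᵥ v) -
        (v ⬝ᵥ H.mulVec v) * (w ⬝ᵥ v)) / (v ⬝ᵥ v) ^ 2 := by
  obtain ⟨L, hL, hLw⟩ := hasFDerivAt_quadratic hH v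
  obtain ⟨L', hL', hLw'⟩ := hasFDerivAt_quadratic Matrix.isSymm_one v
  simp only [Matrix.one_mulVec] at hL' hLw'
  have h1 : rayleigh H = fun v => (v ⬝ᵥ H.mulVec v) * (v ⬝ᵥ v)⁻¹ := by
    funext v
    rw [rayleigh, div_eq_mul_inv]
  rw [h1]
  refine ⟨_, hL.mul (HasDerivAt.comp_hasFDerivAt (f := fun v : Fin n → ℂ => v ⬝ᵥ v) v
    (hasDerivAt_inv hv) hL'), fun w => ?_⟩
  simp only [_root_.add_apply, _root_.smul_apply, hLw, hLw', smul_eq_mul]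
  field_simp
  ring

theorem fderiv_rayleigh_eq_zero_iff {n : ℕ} {H : Matrix (Fin n) (Fin n) ℂ} (hH : H.IsSymm)
    {v : Fin n → ℂ} (hv : v ⬝ᵥ v ≠ 0) (w : Fin n → ℂ) : fderiv ℂ (rayleigh H) v w = 0 ↔
      (w ⬝ᵥ H.mulVec v) * (v ⬝ᵥ v) = (v ⬝ᵥ H.mulVec v) * (w ⬝ᵥ v) := by
  obtain ⟨L, hL, hLw⟩ := hasFDerivAt_rayleigh hH hv
  rw [hL.fderiv, hLw, div_eq_zero_iff, or_iff_left (pow_ne_zero 2 hv), mul_eq_zero,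
    or_iff_right two_ne_zero, sub_eq_zero]

/-! ### Critical points on a proper closed subset of the variety -/

section Variety

variable {n : ℕ} {V : Set (PSpace n)}

/-- The tangent space is the orthogonal complement of the span of the gradients of the generators.
Nondegeneracy of the dot product gives back this span as its complement, and a basis can be chosen
among the gradients; its size is the codimension `e`. -/
theorem exists_spansPerp_coneTangent {k e : ℕ} {f : Fin k → MvPolynomial (Fin n) ℂ}
    (hf : Ideal.span (Set.range f) = definingIdeal V) {v : Fin n → ℂ} (hv : v ∈ cone V)
    (he : e + Module.finrank ℂ (coneTangent V v) = n) :
    ∃ L : Fin e → Fin k, SpansPerp (fun l j => eval v (pderiv j (f (L l)))) (coneTangent V v) := by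
  set G : Submodule ℂ (Fin n → ℂ) :=
    Submodule.span ℂ (Set.range fun l j => eval v (pderiv j (f l))) with hG
  have hT : coneTangent V v = (dotForm n).orthogonal G := by
    ext w
    rw [mem_orthogonal_dotForm]
    constructor
    · intro hw g hg
      induction hg using Submodule.span_induction with
      | mem g hg =>
        obtain ⟨l, rfl⟩ := hg
        exact hw (f l) (hf ▸ Ideal.subset_span ⟨l, rfl⟩)
      | zero => simp
      | add g g' _ _ h h' => rw [add_dotProduct, h, h', add_zero]
      | smul a g _ h => rw [smul_dotProduct, h, smul_zero]
    · intro hw p hp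
      rw [← hf] at hp
      induction hp using Submodule.span_induction with
      | mem g hg =>
        obtain ⟨l, rfl⟩ := hg
        exact hw _ (Submodule.subset_span ⟨l, rfl⟩)
      | zero => simp
      | add g g' _ _ h h' => simp only [map_add, add_mul, Finset.sum_add_distrib, h, h', add_zero]
      | smul a g hg h =>
        -- In the product rule for `a * g`, the term that differentiates `a` disappears because `g`
        -- vanishes at `v`.
        have hg0 : eval v g = 0 := by
          refine mem_definingIdeal.mp ?_ v hv
          rw [← hf]
          exact hg
        simp only [smul_eq_mul, pderiv_mul, map_add, map_mul, hg0, mul_zero, zero_add, mul_assoc,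
          ← Finset.mul_sum, h]
  have hdim : Module.finrank ℂ G = e := by
    have h1 := LinearMap.BilinForm.finrank_orthogonal (dotForm_nondegenerate n) G
    have h2 := G.finrank_le
    rw [← hT, Module.finrank_fin_fun] at h1
    rw [Module.finrank_fin_fun] at h2
    omega
  obtain ⟨u, hu, hspan, -⟩ := Submodule.exists_fun_fin_finrank_span_eq ℂ
    (Set.range fun l j => eval v (pderiv j (f l)))
  choose L hL using hu
  refine ⟨fun l => L (finCongr hdim.symm l), fun z => ?_⟩
  have h3 : (∀ w ∈ coneTangent V v, w ⬝ᵥ z = 0) ↔ z ∈ G := by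
    rw [← mem_orthogonal_dotForm, hT,
      LinearMap.BilinForm.orthogonal_orthogonal (dotForm_nondegenerate n) (dotForm_isRefl n)]
  have h4 : z ∈ G ↔ z ∈ Submodule.span ℂ (Set.range u) := by rw [hspan]
  rw [h3, h4, Submodule.mem_span_range_iff_exists_fun]
  constructor
  · rintro ⟨a, rfl⟩
    refine ⟨fun l => a (finCongr hdim.symm l), ?_⟩
    rw [← Equiv.sum_comp (finCongr hdim.symm)]
    exact Finset.sum_congr rfl fun l _ => by rw [← hL]
  · rintro ⟨a, rfl⟩
    refine ⟨fun l => a (finCongr hdim l), ?_⟩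
    rw [← Equiv.sum_comp (finCongr hdim.symm)]
    exact Finset.sum_congr rfl fun l _ => by rw [← hL]; rfl

/-- For a general symmetric matrix, no critical point on the variety lies on a given proper closed
subset. -/
theorem generically_eval_rep_ne_zero [(definingIdeal V).IsPrime] {N : ℕ}
    (hN : Algebra.trdeg ℂ (MvPolynomial (Fin n) ℂ ⧸ definingIdeal V) = (N + 1 : ℕ))
    {g : MvPolynomial (Fin n) ℂ} {d : ℕ} (hg : g.IsHomogeneous d) (hgI : g ∉ definingIdeal V) :
    Generically fun y : Sym2 (Fin n) → ℂ => ∀ v ∈ regCone V, v ⬝ᵥ v ≠ 0 →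
      CritAt (symMat y) v (coneTangent V v) → eval v g ≠ 0 := by
  by_cases hNn : N + 1 ≤ n
  swap
  · refine ⟨1, one_ne_zero, fun y _ v hv => ?_⟩
    exfalso
    have h1 := hv.2
    rw [hN] at h1
    have h2 : Module.finrank ℂ (coneTangent V v) = N + 1 := by exact_mod_cast h1
    have h3 := (coneTangent V v).finrank_le
    rw [h2, Module.finrank_fin_fun] at h3
    exact hNn h3
  obtain ⟨e, rfl⟩ : ∃ e, n = e + (N + 1) := ⟨n - (N + 1), by omega⟩
  obtain ⟨k, f, hf⟩ : ∃ (k : ℕ) (f : Fin k → MvPolynomial (Fin (e + (N + 1))) ℂ),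
      Ideal.span (Set.range f) = definingIdeal V := by
    obtain ⟨S, hS⟩ := (IsNoetherian.noetherian (definingIdeal V) : (definingIdeal V).FG)
    refine ⟨S.card, fun l => (S.equivFin.symm l : MvPolynomial (Fin (e + (N + 1))) ℂ), ?_⟩
    rw [← hS]
    congr 1
    ext p
    constructor
    · rintro ⟨l, rfl⟩; exact (S.equivFin.symm l).2
    · intro hp; exact ⟨S.equivFin ⟨p, hp⟩, by simp⟩
  have key : ∀ iL : Fin (e + (N + 1)) × (Fin e → Fin k),
      Generically fun y : Sym2 (Fin (e + (N + 1))) → ℂ => ∀ v ∈ cone V, v ⬝ᵥ v ≠ 0 →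
        v iL.1 = 1 → SpansPerp (fun l j => eval v (pderiv j (f (iL.2 l)))) (coneTangent V v) →
        CritAt (symMat y) v (coneTangent V v) → eval v g ≠ 0 := by
    rintro ⟨i, L⟩
    have hcard : N + Nat.card (Option (Fin e) ⊕ Sym2 {j : Fin (e + (N + 1)) // j ≠ i}) =
        Nat.card (Sym2 (Fin (e + (N + 1)))) := by
      have := card_paramIdx (ν := Fin e) i
      rw [Fintype.card_fin] at this
      omega
    -- The normalization `v_i = 1` removes the scale from the cone, so the base `V ∩ {g = 0}`
    -- contributes dimension less than `N`. With `e = n - (N + 1)` conormal vectors the family does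
    -- not dominate `Sym²`.
    have h1 := exists_eval_eq_zero_of_ideal
      (τ := Option (Fin e) ⊕ Sym2 {j : Fin (e + (N + 1)) // j ≠ i})
      (κ := Sym2 (Fin (e + (N + 1))))
      (definingIdeal V ⊔ Ideal.span {g, X i - 1}) (r := N) (fun P hP hle => by
        have h2 := (le_sup_right (a := definingIdeal V)).trans hle
        exact trdeg_lt_of_hyperplane_section hN hg hgI (le_sup_left.trans hle)
          (h2 (Ideal.subset_span (Or.inl rfl))) (h2 (Ideal.subset_span (Or.inr rfl)))) hcard.le
      (fun s => paramMat i (fun j => C (X j)) (fun l j => C (pderiv j (f (L l)))) X s.out.1 s.out.2)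
    refine h1.mono fun y hy v hv hvv hvi hperp hcrit h0 => ?_
    have hvi' : v i ≠ 0 := by rw [hvi]; exact one_ne_zero
    obtain ⟨s, hs⟩ := exists_paramMat_of_critAt (self_mem_coneTangent hv) hvv hperp hvi' hcrit
    refine hy v (fun p hp => ?_) s fun t => ?_
    · have hle : definingIdeal V ⊔ Ideal.span {g, X i - 1} ≤ RingHom.ker (eval v) := by
        refine sup_le (fun q hq => mem_definingIdeal.mp hq v hv) (Ideal.span_le.mpr ?_)
        rintro q (rfl | rfl)
        · exact h0
        · change eval v (X i - 1) = 0
          rw [map_sub, eval_X, hvi, map_one, sub_self]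
      exact hle hp
    · induction t with
      | _ j l =>
        rw [paramMat_out, ← coe_eval₂Hom, map_paramMat]
        simp only [coe_eval₂Hom, eval₂_C, eval₂_X, eval_X]
        exact hs j l
  refine (Generically.forall key).mono fun y hy v hv hvv hcrit h0 => ?_
  -- Tangent space, criticality and vanishing of the form `g` are invariant under scaling, so `v`
  -- may be replaced by the representative with `v_i = 1`.
  obtain ⟨i, hi⟩ := exists_ne_zero_of_dotProduct_self hvv
  have hc : (v i)⁻¹ ≠ 0 := inv_ne_zero hi
  have hT : coneTangent V ((v i)⁻¹ • v) = coneTangent V v := coneTangent_smul hc v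
  have hcone := smul_mem_cone hc hv.1
  have hrank : Module.finrank ℂ (coneTangent V v) = N + 1 := by
    have h1 := hv.2
    rw [hN] at h1
    exact_mod_cast h1
  obtain ⟨L, hL⟩ := exists_spansPerp_coneTangent (e := e) hf hcone (by rw [hT, hrank])
  refine hy (i, L) _ hcone ?_ ?_ hL ?_ ?_
  · simp only [smul_dotProduct, dotProduct_smul, smul_eq_mul]
    exact mul_ne_zero hc (mul_ne_zero hc hvv)
  · simp [hi]
  · rw [hT]
    exact (critAt_smul hc).mpr hcrit
  · rw [IsHomogeneous.eval_smul hg, h0, mul_zero]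

end Variety

/-! ### Coordinates and charts of the parameter space -/

section Charts

variable {n m k : ℕ} {a : Fin k → ℕ}

/-- Rescaling of the coordinates of the projective factors. -/
def scaleBlocks {A : Type} [CommRing A] (r : Fin k → A) (x : CoordIdx m a → A) :
    CoordIdx m a → A :=
  Sum.elim (fun j => x (Sum.inl j)) fun s => r s.1 * x (Sum.inr s)

theorem aeval_scaleBlocks {A : Type} [CommRing A] [Algebra ℂ A]
    {f : MvPolynomial (CoordIdx m a) ℂ} {d : Fin k → ℕ}
    (hf : ∀ i, IsWeightedHomogeneous (blockWeight i) f (d i)) (r : Fin k → A)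
    (x : CoordIdx m a → A) :
    aeval (scaleBlocks r x) f = (∏ i, r i ^ d i) * aeval x f := by
  have hs : scaleBlocks r x = fun s => (∏ i, r i ^ (blockWeight i s : ℕ)) * x s := by
    funext s
    rcases s with j | s
    · simp [scaleBlocks, blockWeight]
    · simp [scaleBlocks, blockWeight, pow_ite, Finset.prod_ite_eq]
  rw [hs, aeval_def, aeval_def, eval₂_eq, eval₂_eq, Finset.mul_sum]
  refine Finset.sum_congr rfl fun p hp => ?_
  have h1 : ∀ i, ∑ s ∈ p.support, p s * blockWeight i s = d i := fun i => by
    have := hf i (mem_support_iff.mp hp)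
    rwa [Finsupp.weight_apply, Finsupp.sum] at this
  have h2 : ∏ s ∈ p.support, (∏ i, r i ^ (blockWeight i s : ℕ)) ^ p s = ∏ i, r i ^ d i := by
    simp only [← Finset.prod_pow, ← pow_mul]
    rw [Finset.prod_comm]
    refine Finset.prod_congr rfl fun i _ => ?_
    rw [Finset.prod_pow_eq_pow_sum, ← h1 i]
    simp only [mul_comm]
  simp only [mul_pow, Finset.prod_mul_distrib, h2]
  ring

theorem scaleBlocks_scaleBlocks {A : Type} [CommRing A] (r r' : Fin k → A)
    (x : CoordIdx m a → A) :
    scaleBlocks r (scaleBlocks r' x) = scaleBlocks (fun i => r i * r' i) x := by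
  funext s
  rcases s with j | s <;> simp [scaleBlocks, mul_assoc]

theorem scaleBlocks_one {A : Type} [CommRing A] (x : CoordIdx m a → A) :
    scaleBlocks (fun _ => 1) x = x := by
  funext s
  rcases s with j | s <;> simp [scaleBlocks]

theorem evalMap_scaleBlocks {ψ : Fin n → MvPolynomial (CoordIdx m a) ℂ} {d : Fin k → ℕ}
    (hψ : ∀ i j, IsWeightedHomogeneous (blockWeight i) (ψ j) (d i)) (r : Fin k → ℂ)
    (x : CoordIdx m a → ℂ) : evalMap ψ (scaleBlocks r x) = (∏ i, r i ^ d i) • evalMap ψ x :=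
  funext fun j => aeval_scaleBlocks (A := ℂ) (fun i => hψ i j) r x

/-- Rescaling a dual-number point by constants multiplies `ψ` by a nonzero constant, by
multihomogeneity, and this is absorbed in the factor `t`. So the jet does not depend on the chosen
homogeneous coordinates. -/
theorem jetSpan_scaleBlocks {ψ : Fin n → MvPolynomial (CoordIdx m a) ℂ} {d : Fin k → ℕ}
    (hψ : ∀ i j, IsWeightedHomogeneous (blockWeight i) (ψ j) (d i)) {r : Fin k → ℂ}
    (hr : ∀ i, r i ≠ 0) (x : CoordIdx m a → ℂ) : jetSpan ψ (scaleBlocks r x) = jetSpan ψ x := by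
  have key : ∀ (r : Fin k → ℂ) (x : CoordIdx m a → ℂ), (∀ i, r i ≠ 0) →
      jetSpan ψ (scaleBlocks r x) ≤ jetSpan ψ x := by
    intro r x hr w hw
    obtain ⟨t, Y, ht, hY, hw⟩ := mem_jetSpan_iff_dualNumber.mp hw
    have h1 : ∀ i, dual (r i) 0 * dual (r i)⁻¹ 0 = 1 := fun i => by
      ext <;> simp [hr i]
    have h2 : scaleBlocks (fun i => dual (r i) 0) (scaleBlocks (fun i => dual (r i)⁻¹ 0) Y) = Y := by
      rw [scaleBlocks_scaleBlocks]
      simp only [h1, scaleBlocks_one]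
    refine mem_jetSpan_of_dualNumber (t := t * ∏ i, dual (r i) 0 ^ d i)
      (X := scaleBlocks (fun i => dual (r i)⁻¹ 0) Y) ?_ ?_ fun j => ?_
    · rw [TrivSqZeroExt.fst_mul, ht, one_mul]
      have := map_prod (TrivSqZeroExt.fstHom ℂ ℂ ℂ) (fun i => dual (r i) 0 ^ d i) Finset.univ
      simp only [map_pow, TrivSqZeroExt.fstHom_apply, fst_dual] at this
      rw [this]
      exact Finset.prod_ne_zero_iff.mpr fun i _ => pow_ne_zero _ (hr i)
    · rintro (j | s)
      · exact hY (Sum.inl j)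
      · have := hY (Sum.inr s)
        simp only [scaleBlocks, Sum.elim_inr, TrivSqZeroExt.fst_mul, fst_dual] at this ⊢
        rw [this, ← mul_assoc, inv_mul_cancel₀ (hr s.1), one_mul]
    · rw [hw, mul_assoc, ← aeval_scaleBlocks (fun i => hψ i j), h2]
  refine le_antisymm (key r x hr) ?_
  have := key (fun i => (r i)⁻¹) (scaleBlocks r x) fun i => inv_ne_zero (hr i)
  rw [scaleBlocks_scaleBlocks] at this
  simpa only [inv_mul_cancel₀ (hr _), scaleBlocks_one] using this

theorem isCoord_iff {u : ParamSpace m a} {x : CoordIdx m a → ℂ} :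
    IsCoord u x ↔ ∃ r : Fin k → ℂ, (∀ i, r i ≠ 0) ∧ x = scaleBlocks r (coords u) := by
  constructor
  · rintro ⟨h1, h2⟩
    have h3 : ∀ i, ∃ r : ℂ, r ≠ 0 ∧ ∀ s, x (Sum.inr ⟨i, s⟩) = r * (u.2 i).rep s := by
      intro i
      obtain ⟨h0, h⟩ := h2 i
      have h' : Projectivization.mk ℂ _ h0 = Projectivization.mk ℂ _ (u.2 i).rep_nonzero := by
        rw [h, Projectivization.mk_rep]
      obtain ⟨c, hc⟩ := (Projectivization.mk_eq_mk_iff ℂ _ _ _ _).mp h'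
      exact ⟨c, c.ne_zero, fun s => (congrFun hc s).symm⟩
    choose r hr h using h3
    refine ⟨r, hr, ?_⟩
    funext s
    rcases s with j | ⟨i, s⟩
    · exact h1 j
    · exact h i s
  · rintro ⟨r, hr, rfl⟩
    refine ⟨fun j => rfl, fun i => ?_⟩
    have h0 : (fun s => scaleBlocks r (coords u) (Sum.inr ⟨i, s⟩)) = r i • (u.2 i).rep := rfl
    simp only [h0]
    refine ⟨smul_ne_zero (hr i) (u.2 i).rep_nonzero, ?_⟩
    conv_rhs => rw [← Projectivization.mk_rep (u.2 i)]
    rw [Projectivization.mk_eq_mk_iff']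
    exact ⟨r i, rfl⟩

theorem IsCoord.unique {u u' : ParamSpace m a} {x : CoordIdx m a → ℂ} (h : IsCoord u x)
    (h' : IsCoord u' x) : u = u' := by
  refine Prod.ext (funext fun j => (h.1 j).symm.trans (h'.1 j)) (funext fun i => ?_)
  obtain ⟨_, h1⟩ := h.2 i
  obtain ⟨_, h2⟩ := h'.2 i
  rw [← h1, ← h2]

/-- Indices of the coordinates of the affine charts. -/
abbrev AffIdx (m : ℕ) {k : ℕ} (a : Fin k → ℕ) : Type := Fin m ⊕ (Σ i : Fin k, Fin (a i))

theorem card_affIdx : Fintype.card (AffIdx m a) = m + ∑ i, a i := by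
  simp

/-- The homogeneous coordinates of a point of a chart. -/
def chartCoord {A : Type} [CommRing A] (c : ∀ i, Fin (a i + 1)) (y : AffIdx m a → A) :
    CoordIdx m a → A :=
  Sum.elim (fun j => y (Sum.inl j)) fun s =>
    Fin.insertNth (α := fun _ => A) (c s.1) 1 (fun t => y (Sum.inr ⟨s.1, t⟩)) s.2

theorem chartCoord_inr_self {A : Type} [CommRing A] (c : ∀ i, Fin (a i + 1))
    (y : AffIdx m a → A) (i : Fin k) : chartCoord c y (Sum.inr ⟨i, c i⟩) = 1 := by
  simp [chartCoord]

theorem chartCoord_inr_succAbove {A : Type} [CommRing A] (c : ∀ i, Fin (a i + 1))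
    (y : AffIdx m a → A) (i : Fin k) (t : Fin (a i)) :
    chartCoord c y (Sum.inr ⟨i, (c i).succAbove t⟩) = y (Sum.inr ⟨i, t⟩) := by
  simp [chartCoord]

theorem map_chartCoord {A B : Type} [CommRing A] [CommRing B] (χ : A →+* B)
    (c : ∀ i, Fin (a i + 1)) (y : AffIdx m a → A) (s : CoordIdx m a) :
    χ (chartCoord c y s) = chartCoord c (fun t => χ (y t)) s := by
  rcases s with j | ⟨i, s⟩
  · rfl
  · rcases Fin.eq_self_or_eq_succAbove (c i) s with rfl | ⟨t, rfl⟩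
    · rw [chartCoord_inr_self, chartCoord_inr_self, map_one]
    · rw [chartCoord_inr_succAbove, chartCoord_inr_succAbove]

/-- The chart coordinates of a point with homogeneous coordinates `x`, where `r` is the inverse of
the coordinates that are normalized. -/
def affCoord {A : Type} [CommRing A] (c : ∀ i, Fin (a i + 1)) (r : Fin k → A)
    (x : CoordIdx m a → A) : AffIdx m a → A :=
  Sum.elim (fun j => x (Sum.inl j)) fun t => r t.1 * x (Sum.inr ⟨t.1, (c t.1).succAbove t.2⟩)

theorem chartCoord_affCoord {A : Type} [CommRing A] {c : ∀ i, Fin (a i + 1)} {r : Fin k → A}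
    {x : CoordIdx m a → A} (hr : ∀ i, r i * x (Sum.inr ⟨i, c i⟩) = 1) :
    chartCoord c (affCoord c r x) = scaleBlocks r x := by
  funext s
  rcases s with j | ⟨i, s⟩
  · rfl
  · rcases Fin.eq_self_or_eq_succAbove (c i) s with rfl | ⟨t, rfl⟩
    · rw [chartCoord_inr_self]
      exact (hr i).symm
    · rw [chartCoord_inr_succAbove]
      rfl

theorem chartCoord_injective {A : Type} [CommRing A] (c : ∀ i, Fin (a i + 1)) :
    Function.Injective (chartCoord (m := m) (A := A) c) := by
  intro y y' h
  funext s
  rcases s with j | ⟨i, t⟩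
  · exact congrFun h (Sum.inl j)
  · have := congrFun h (Sum.inr ⟨i, (c i).succAbove t⟩)
    rwa [chartCoord_inr_succAbove, chartCoord_inr_succAbove] at this

/-- The polynomial in the coordinates of a chart given by a polynomial in the homogeneous
coordinates. -/
def dehomogenize (c : ∀ i, Fin (a i + 1)) :
    MvPolynomial (CoordIdx m a) ℂ →ₐ[ℂ] MvPolynomial (AffIdx m a) ℂ :=
  aeval (chartCoord c X)

theorem aeval_dehomogenize {A : Type} [CommRing A] [Algebra ℂ A] (c : ∀ i, Fin (a i + 1))
    (y : AffIdx m a → A) (f : MvPolynomial (CoordIdx m a) ℂ) :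
    aeval y (dehomogenize c f) = aeval (chartCoord c y) f := by
  rw [dehomogenize, MvPolynomial.comp_aeval_apply]
  congr 2
  funext s
  have := map_chartCoord (aeval (R := ℂ) y).toRingHom c X s
  simp only [AlgHom.toRingHom_eq_coe, RingHom.coe_coe, aeval_X] at this
  exact this

theorem eval_dehomogenize (c : ∀ i, Fin (a i + 1)) (y : AffIdx m a → ℂ)
    (f : MvPolynomial (CoordIdx m a) ℂ) :
    eval y (dehomogenize c f) = eval (chartCoord c y) f :=
  aeval_dehomogenize c y f

/-- A first-order deformation of homogeneous coordinates returns to the chart after division by the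
coordinates `c i`, which are units of the dual numbers. The resulting power factor is absorbed in
`t`: the scaling directions add only multiples of `ψ(x)`. -/
theorem jetSpan_dehomogenize {ψ : Fin n → MvPolynomial (CoordIdx m a) ℂ} {d : Fin k → ℕ}
    (hψ : ∀ i j, IsWeightedHomogeneous (blockWeight i) (ψ j) (d i)) (c : ∀ i, Fin (a i + 1))
    (y : AffIdx m a → ℂ) :
    jetSpan (fun j => dehomogenize c (ψ j)) y = jetSpan ψ (chartCoord c y) := by
  ext w
  constructor
  · intro hw
    obtain ⟨t, Y, ht, hY, hw⟩ := mem_jetSpan_iff_dualNumber.mp hw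
    refine mem_jetSpan_iff_dualNumber.mpr ⟨t, chartCoord c Y, ht, fun s => ?_, fun j => ?_⟩
    · have := map_chartCoord (TrivSqZeroExt.fstHom ℂ ℂ ℂ).toRingHom c Y s
      have hY' : (fun t => (Y t).fst) = y := funext hY
      rw [← hY']
      exact this
    · rw [hw, aeval_dehomogenize]
  · intro hw
    obtain ⟨t, Z, ht, hZ, hw⟩ := mem_jetSpan_iff_dualNumber.mp hw
    have h1 : ∀ i, (Z (Sum.inr ⟨i, c i⟩)).fst = 1 := fun i => by
      rw [hZ, chartCoord_inr_self]
    have h2 : ∀ i, ∃ r : DualNumber ℂ, r * Z (Sum.inr ⟨i, c i⟩) = 1 ∧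
        Z (Sum.inr ⟨i, c i⟩) * r = 1 ∧ r.fst = 1 := by
      intro i
      obtain ⟨w, hw⟩ := isUnit_dualNumber (z := Z (Sum.inr ⟨i, c i⟩)) (by rw [h1]; exact one_ne_zero)
      have h3 : ((w⁻¹ : (DualNumber ℂ)ˣ) : DualNumber ℂ) * Z (Sum.inr ⟨i, c i⟩) = 1 := by
        rw [← hw, Units.inv_mul]
      refine ⟨_, h3, by rw [mul_comm]; exact h3, ?_⟩
      have h4 := congrArg TrivSqZeroExt.fst h3
      rw [TrivSqZeroExt.fst_mul, h1, mul_one] at h4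
      exact h4
    choose r hr hr' hr1 using h2
    refine mem_jetSpan_of_dualNumber (t := t * ∏ i, Z (Sum.inr ⟨i, c i⟩) ^ d i)
      (X := affCoord c r Z) ?_ ?_ fun j => ?_
    · rw [TrivSqZeroExt.fst_mul, ht, one_mul]
      have := map_prod (TrivSqZeroExt.fstHom ℂ ℂ ℂ) (fun i => Z (Sum.inr ⟨i, c i⟩) ^ d i) Finset.univ
      simp only [map_pow, TrivSqZeroExt.fstHom_apply, h1, one_pow, Finset.prod_const_one] at this
      rw [this]
      exact one_ne_zero
    · rintro (j | ⟨i, s⟩)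
      · exact hZ (Sum.inl j)
      · have := hZ (Sum.inr ⟨i, (c i).succAbove s⟩)
        rw [chartCoord_inr_succAbove] at this
        simp only [affCoord, Sum.elim_inr, TrivSqZeroExt.fst_mul, hr1, one_mul]
        exact this
    · rw [hw, mul_assoc, aeval_dehomogenize, chartCoord_affCoord hr,
        ← aeval_scaleBlocks (fun i => hψ i j), scaleBlocks_scaleBlocks]
      simp only [hr', scaleBlocks_one]

/-- The point with given coordinates in a chart. -/
def chartPoint (c : ∀ i, Fin (a i + 1)) (y : AffIdx m a → ℂ) : ParamSpace m a :=
  (fun j => y (Sum.inl j), fun i => Projectivization.mk ℂ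
    (fun s => chartCoord c y (Sum.inr ⟨i, s⟩)) fun h => by
      have := congrFun h (c i)
      rw [chartCoord_inr_self] at this
      exact one_ne_zero this)

theorem isCoord_chartPoint (c : ∀ i, Fin (a i + 1)) (y : AffIdx m a → ℂ) :
    IsCoord (chartPoint c y) (chartCoord c y) :=
  ⟨fun _ => rfl, fun _ => ⟨_, rfl⟩⟩

theorem exists_chartPoint_eq {c : ∀ i, Fin (a i + 1)} {u : ParamSpace m a}
    (hc : ∀ i, coords u (Sum.inr ⟨i, c i⟩) ≠ 0) : ∃ y, chartPoint c y = u := by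
  set r : Fin k → ℂ := fun i => (coords u (Sum.inr ⟨i, c i⟩))⁻¹
  refine ⟨affCoord c r (coords u), (isCoord_chartPoint c _).unique ?_⟩
  rw [chartCoord_affCoord fun i => inv_mul_cancel₀ (hc i)]
  exact isCoord_iff.mpr ⟨r, fun i => inv_ne_zero (hc i), rfl⟩

theorem chartPoint_injective (c : ∀ i, Fin (a i + 1)) :
    Function.Injective (chartPoint (m := m) c) := by
  intro y y' h
  have h1 := isCoord_chartPoint c y
  rw [h] at h1
  obtain ⟨r, hr, h2⟩ := isCoord_iff.mp h1
  obtain ⟨r', hr', h3⟩ := isCoord_iff.mp (isCoord_chartPoint c y')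
  have h4 : ∀ i, r i = r' i := by
    intro i
    have h5 := congrFun h2 (Sum.inr ⟨i, c i⟩)
    have h6 := congrFun h3 (Sum.inr ⟨i, c i⟩)
    rw [chartCoord_inr_self] at h5 h6
    simp only [scaleBlocks, Sum.elim_inr] at h5 h6
    have h7 : coords (chartPoint c y') (Sum.inr ⟨i, c i⟩) ≠ 0 := fun h0 => by
      rw [h0, mul_zero] at h5
      exact one_ne_zero h5
    exact mul_right_cancel₀ h7 (h5.symm.trans h6)
  have h8 : r = r' := funext h4
  rw [h8, ← h3] at h2
  exact chartCoord_injective c h2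

theorem coords_chartPoint_ne_zero (c : ∀ i, Fin (a i + 1)) (y : AffIdx m a → ℂ)
    (s : CoordIdx m a) : coords (chartPoint c y) s ≠ 0 ↔ chartCoord c y s ≠ 0 := by
  obtain ⟨r, hr, h⟩ := isCoord_iff.mp (isCoord_chartPoint c y)
  rw [h]
  rcases s with j | s
  · rfl
  · simp only [scaleBlocks, Sum.elim_inr]
    rw [mul_ne_zero_iff, and_iff_right (hr _)]

theorem exists_chart (u : ParamSpace m a) :
    ∃ c : ∀ i, Fin (a i + 1), ∀ i, coords u (Sum.inr ⟨i, c i⟩) ≠ 0 := by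
  have : ∀ i, ∃ s, coords u (Sum.inr ⟨i, s⟩) ≠ 0 := fun i =>
    Function.ne_iff.mp (u.2 i).rep_nonzero
  choose c hc using this
  exact ⟨c, hc⟩

/-- The value and the jet of `ψ` at a point can be computed in a chart. -/
theorem evalMap_chartPoint {ψ : Fin n → MvPolynomial (CoordIdx m a) ℂ} {d : Fin k → ℕ}
    (hψ : ∀ i j, IsWeightedHomogeneous (blockWeight i) (ψ j) (d i)) (c : ∀ i, Fin (a i + 1))
    (y : AffIdx m a → ℂ) : ∃ r : ℂ, r ≠ 0 ∧
      evalMap ψ (coords (chartPoint c y)) = r • (fun j => eval y (dehomogenize c (ψ j))) ∧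
      jetSpan ψ (coords (chartPoint c y)) = jetSpan (fun j => dehomogenize c (ψ j)) y := by
  obtain ⟨r, hr, h⟩ := isCoord_iff.mp (isCoord_chartPoint c y)
  have h0 : ∏ i, r i ^ d i ≠ 0 := Finset.prod_ne_zero_iff.mpr fun i _ => pow_ne_zero _ (hr i)
  generalize coords (chartPoint c y) = x at h
  refine ⟨(∏ i, r i ^ d i)⁻¹, inv_ne_zero h0, ?_, ?_⟩
  · have h1 : (fun j => eval y (dehomogenize c (ψ j))) = (∏ i, r i ^ d i) • evalMap ψ x := by
      rw [← evalMap_scaleBlocks hψ, ← h]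
      funext j
      rw [eval_dehomogenize, evalMap]
    rw [h1, smul_smul, inv_mul_cancel₀ h0, one_smul]
  · rw [jetSpan_dehomogenize hψ, h, jetSpan_scaleBlocks hψ hr]

end Charts

/-! ### Zariski closures in projective space -/

section Closure

variable {n : ℕ}

theorem forall_eval_smul_eq_zero {S : Set (PSpace n)} {v : Fin n → ℂ}
    (hv : ∀ f ∈ definingIdeal S, eval v f = 0) {c : ℂ} (hc : c ≠ 0) :
    ∀ f ∈ definingIdeal S, eval (c • v) f = 0 := by
  intro f hf
  have hev : ∀ u, eval u (aeval (fun j => (C c * X j : MvPolynomial (Fin n) ℂ)) f) =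
      eval (c • u) f := by
    intro u
    have h := MvPolynomial.comp_aeval_apply (R := ℂ)
      (fun j => (C c * X j : MvPolynomial (Fin n) ℂ)) (aeval u) f
    simp only [aeval_eq_eval, map_mul, eval_C, eval_X] at h
    exact h
  rw [← hev]
  refine hv _ (mem_definingIdeal.mpr fun u hu => ?_)
  rw [hev]
  exact mem_definingIdeal.mp hf _ (smul_mem_cone hc hu)

theorem exists_rep_eq_smul {v : Fin n → ℂ} (hv : v ≠ 0) :
    ∃ c : ℂ, c ≠ 0 ∧ (Projectivization.mk ℂ v hv).rep = c • v := by
  obtain ⟨c, hc⟩ := Projectivization.exists_smul_eq_mk_rep ℂ v hv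
  exact ⟨c, c.ne_zero, hc.symm⟩

theorem mem_cone_projClosure {S : Set (PSpace n)} {v : Fin n → ℂ} :
    v ∈ cone (projClosure S) ↔ v ≠ 0 ∧ ∀ f ∈ definingIdeal S, eval v f = 0 := by
  constructor
  · rintro ⟨hv, h⟩
    refine ⟨hv, ?_⟩
    obtain ⟨c, hc, hrep⟩ := exists_rep_eq_smul hv
    have h1 : ∀ f ∈ definingIdeal S, eval (c • v) f = 0 := by
      rw [← hrep]
      exact h
    have h2 := forall_eval_smul_eq_zero h1 (inv_ne_zero hc)
    rwa [inv_smul_smul₀ hc] at h2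
  · rintro ⟨hv, h⟩
    refine ⟨hv, ?_⟩
    obtain ⟨c, hc, hrep⟩ := exists_rep_eq_smul hv
    intro f hf
    rw [hrep]
    exact forall_eval_smul_eq_zero h hc f hf

theorem definingIdeal_projClosure (S : Set (PSpace n)) :
    definingIdeal (projClosure S) = definingIdeal S := by
  ext f
  constructor
  · intro hf
    rw [mem_definingIdeal] at hf ⊢
    intro v hv
    exact hf v (mem_cone_projClosure.mpr ⟨hv.1, fun g hg => mem_definingIdeal.mp hg v hv⟩)
  · intro hf
    rw [mem_definingIdeal]
    intro v hv
    exact (mem_cone_projClosure.mp hv).2 f hf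

/-- The degree-zero component of `f` lies in the ideal and `V` is nonempty. The cone omits the
origin, whereas `t • ψ(x)` may be zero, so this case is needed in the parametric description of the
ideal. -/
theorem eval_zero_of_mem_definingIdeal {V : Set (PSpace n)} {v : Fin n → ℂ} (hv : v ∈ cone V)
    {f : MvPolynomial (Fin n) ℂ} (hf : f ∈ definingIdeal V) : eval 0 f = 0 := by
  have h := mem_definingIdeal.mp (coeff_scale_mem hf 0) v hv
  rw [Polynomial.coeff_zero_eq_eval_zero] at h
  have h2 := ringHom_aeval ((eval v).comp (Polynomial.evalRingHom 0)) (T := ℂ) (fun r => by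
      rw [Polynomial.algebraMap_apply, RingHom.comp_apply, Polynomial.coe_evalRingHom,
        Polynomial.eval_C]
      exact eval_C r)
    (fun j => (Polynomial.X * Polynomial.C (X j) : Polynomial (MvPolynomial (Fin n) ℂ))) f
  rw [RingHom.comp_apply, Polynomial.coe_evalRingHom, h] at h2
  rw [h2]
  congr 2
  funext j
  simp

end Closure

/-! ### The charts of a birational parametrization -/

section Birational

variable {n m k : ℕ} {a : Fin k → ℕ} {ψ : Fin n → MvPolynomial (CoordIdx m a) ℂ}
  {V : Set (PSpace n)}

namespace IsBirationalParam

theorem mem_cone_iff (hψ : IsBirationalParam ψ V) {v : Fin n → ℂ} :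
    v ∈ cone V ↔ v ≠ 0 ∧ ∀ f ∈ definingIdeal V, eval v f = 0 := by
  rw [hψ.eq_closure, definingIdeal_projClosure, mem_cone_projClosure]

theorem exists_mem_cone (hψ : IsBirationalParam ψ V) : ∃ v, v ∈ cone V := by
  obtain ⟨g₀, -, -, -, -, -, -, h, -⟩ := hψ.exists_inverse
  by_contra hc
  push Not at hc
  exact h (mem_definingIdeal.mpr fun v hv => (hc v hv).elim)

theorem mem_definingIdeal_iff (hψ : IsBirationalParam ψ V) {f : MvPolynomial (Fin n) ℂ} :
    f ∈ definingIdeal V ↔ ∀ (t : ℂ) (u : ParamSpace m a),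
      eval (t • evalMap ψ (coords u)) f = 0 := by
  constructor
  · intro hf t u
    by_cases h0 : t • evalMap ψ (coords u) = 0
    · rw [h0]
      obtain ⟨v, hv⟩ := hψ.exists_mem_cone
      exact eval_zero_of_mem_definingIdeal hv hf
    · rw [hψ.eq_closure, definingIdeal_projClosure, mem_definingIdeal] at hf
      have h1 := right_ne_zero_of_smul h0
      refine hf _ ⟨h0, u, h1, ?_⟩
      rw [Projectivization.mk_eq_mk_iff']
      exact ⟨t, rfl⟩
  · intro h
    rw [hψ.eq_closure, definingIdeal_projClosure, mem_definingIdeal]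
    rintro v ⟨hv, u, hu, hvu⟩
    obtain ⟨t, rfl⟩ := (Projectivization.mk_eq_mk_iff' ℂ _ _ _ _).mp hvu
    exact h t u

/-- The chart is dense: the product of `f(t ψ(x))` with the normalizing coordinates vanishes for
every `x`, and the nonzero product of coordinates can be cancelled. -/
theorem mem_definingIdeal_iff_chart (hψ : IsBirationalParam ψ V) (c : ∀ i, Fin (a i + 1))
    {f : MvPolynomial (Fin n) ℂ} : f ∈ definingIdeal V ↔ ∀ (t : ℂ) (y : AffIdx m a → ℂ),
      eval (fun j => t * eval y (dehomogenize c (ψ j))) f = 0 := by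
  obtain ⟨d, hd⟩ := hψ.multihomogeneous
  rw [hψ.mem_definingIdeal_iff]
  constructor
  · intro h t y
    obtain ⟨r, hr, h1, -⟩ := evalMap_chartPoint hd c y
    have h2 := h (t * r⁻¹) (chartPoint c y)
    rw [h1, smul_smul, mul_assoc, inv_mul_cancel₀ hr, mul_one] at h2
    exact h2
  · intro h t u
    have h1 : ∀ x, eval x (aeval (fun j => C t * ψ j) f) = eval (t • evalMap ψ x) f := by
      intro x
      have h := MvPolynomial.comp_aeval_apply (R := ℂ) (fun j => C t * ψ j) (aeval x) f
      simp only [aeval_eq_eval, map_mul, eval_C] at h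
      exact h
    have h2 : aeval (fun j => C t * ψ j) f * ∏ i, X (Sum.inr ⟨i, c i⟩) = 0 := by
      refine MvPolynomial.funext fun x => ?_
      rw [map_mul, map_prod, map_zero, h1]
      by_cases hx : ∀ i, x (Sum.inr ⟨i, c i⟩) ≠ 0
      · obtain ⟨r, hrx⟩ : ∃ r : Fin k → ℂ, ∀ i, r i * x (Sum.inr ⟨i, c i⟩) = 1 :=
          ⟨fun i => (x (Sum.inr ⟨i, c i⟩))⁻¹, fun i => inv_mul_cancel₀ (hx i)⟩
        have hr : ∏ i, r i ^ d i ≠ 0 := Finset.prod_ne_zero_iff.mpr fun i _ =>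
          pow_ne_zero _ (left_ne_zero_of_mul_eq_one (hrx i))
        have h3 := h (t * (∏ i, r i ^ d i)⁻¹) (affCoord c r x)
        simp only [eval_dehomogenize] at h3
        rw [chartCoord_affCoord hrx] at h3
        have h4 : ∀ j, eval (scaleBlocks r x) (ψ j) = (∏ i, r i ^ d i) * eval x (ψ j) := fun j =>
          congrFun (evalMap_scaleBlocks hd r x) j
        simp only [h4, mul_assoc, inv_mul_cancel_left₀ hr] at h3
        have h5 : eval (t • evalMap ψ x) f = 0 := h3
        rw [h5, zero_mul]
      · push Not at hx
        obtain ⟨i, hi⟩ := hx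
        have h3 : ∏ i, eval x (X (Sum.inr ⟨i, c i⟩) : MvPolynomial (CoordIdx m a) ℂ) = 0 :=
          Finset.prod_eq_zero (Finset.mem_univ i) (by rw [eval_X, hi])
        rw [h3, mul_zero]
    have h3 : (∏ i, X (Sum.inr ⟨i, c i⟩) : MvPolynomial (CoordIdx m a) ℂ) ≠ 0 :=
      Finset.prod_ne_zero_iff.mpr fun i _ => X_ne_zero _
    rw [← h1, (mul_eq_zero.mp h2).resolve_right h3, map_zero]

theorem mem_iff_aeval_dehomogenize (hψ : IsBirationalParam ψ V) (c : ∀ i, Fin (a i + 1))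
    {f : MvPolynomial (Fin n) ℂ} {e : ℕ} (hf : f.IsHomogeneous e) :
    f ∈ definingIdeal V ↔ aeval (fun j => dehomogenize c (ψ j)) f = 0 := by
  have hev : ∀ y, eval y (aeval (fun j => dehomogenize c (ψ j)) f) =
      eval (fun j => eval y (dehomogenize c (ψ j))) f := fun y =>
    MvPolynomial.comp_aeval_apply (fun j => dehomogenize c (ψ j)) (aeval y) f
  rw [hψ.mem_definingIdeal_iff_chart c]
  constructor
  · intro h
    refine MvPolynomial.funext fun y => ?_
    have := h 1 y
    rw [hev, map_zero]
    simpa using this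
  · intro h t y
    have := IsHomogeneous.eval_smul hf t (fun j => eval y (dehomogenize c (ψ j)))
    rw [← hev, h, map_zero, mul_zero] at this
    exact this

/-- Every chart of a birational parametrization is birational. -/
theorem nonempty_affineInverse (hψ : IsBirationalParam ψ V) (c : ∀ i, Fin (a i + 1)) :
    Nonempty (AffineInverse (fun j => dehomogenize c (ψ j)) (definingIdeal V)) := by
  obtain ⟨g₀, g, e₀, e, hg₀, hgl, hgr, hg₀V, hgV, hinl, hinr⟩ := hψ.exists_inverse
  set θ : Fin n → MvPolynomial (AffIdx m a) ℂ := fun j => dehomogenize c (ψ j) with hθ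
  have hcomp : ∀ f : MvPolynomial (Fin n) ℂ, aeval θ f = dehomogenize c (aeval ψ f) := fun f =>
    (MvPolynomial.comp_aeval_apply ψ (dehomogenize c) f).symm
  have hX : ∀ s : CoordIdx m a, dehomogenize c (X s) = chartCoord c X s := fun s => by
    rw [dehomogenize, aeval_X]
  have hinl' : ∀ j, aeval θ (g (Sum.inl j)) = X (Sum.inl j) * aeval θ g₀ := by
    intro j
    rw [hcomp, hcomp, hinl, map_mul, hX]
    rfl
  have hinr' : ∀ i s, aeval θ (g (Sum.inr ⟨i, s⟩)) =
      aeval θ (g (Sum.inr ⟨i, c i⟩)) * chartCoord c X (Sum.inr ⟨i, s⟩) := by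
    intro i s
    have h := congrArg (dehomogenize c) (hinr i s (c i))
    rw [map_mul, map_mul, hX, hX, chartCoord_inr_self, mul_one, ← hcomp, ← hcomp] at h
    exact h
  have h0 : aeval θ g₀ ≠ 0 := fun h => hg₀V ((hψ.mem_iff_aeval_dehomogenize c hg₀).mpr h)
  have h1 : ∀ i, aeval θ (g (Sum.inr ⟨i, c i⟩)) ≠ 0 := by
    intro i h
    obtain ⟨s, hs⟩ := hgV i
    refine hs ((hψ.mem_iff_aeval_dehomogenize c (hgr i s)).mpr ?_)
    change aeval θ _ = 0
    rw [hinr', h, zero_mul]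
  obtain ⟨v, hv⟩ := hψ.exists_mem_cone
  obtain ⟨l, hl⟩ := Function.ne_iff.mp hv.1
  have hprod : ∀ T : Finset (Fin k), (∏ i ∈ T, g (Sum.inr ⟨i, c i⟩)).IsHomogeneous (∑ i ∈ T, e i) :=
    fun T => IsHomogeneous.prod _ _ _ fun i _ => hgr i (c i)
  -- In the chart the inverse has the coordinates `g (inl j) / g₀` and, in block `i`, the quotients
  -- of `g` by its entry at index `c i`. All are brought to the common denominator `q`, so that they
  -- are forms of one degree.
  refine ⟨{
    mem_iff := fun f => hψ.mem_definingIdeal_iff_chart c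
    q := g₀ * ∏ i, g (Sum.inr ⟨i, c i⟩)
    qs := Sum.elim (fun j => g (Sum.inl j) * ∏ i, g (Sum.inr ⟨i, c i⟩)) fun s =>
      g₀ * (g (Sum.inr ⟨s.1, (c s.1).succAbove s.2⟩) *
        ∏ i ∈ Finset.univ.erase s.1, g (Sum.inr ⟨i, c i⟩))
    deg := e₀ + ∑ i, e i
    hom_q := hg₀.mul (hprod _)
    hom_qs := ?_
    ne_zero := ?_
    inv := ?_
    l := l
    l_ne_zero := ?_ }⟩
  · rintro (j | ⟨i, t⟩)
    · exact (hgl j).mul (hprod _)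
    · have := hg₀.mul ((hgr i ((c i).succAbove t)).mul (hprod (Finset.univ.erase i)))
      rwa [Finset.add_sum_erase _ _ (Finset.mem_univ i)] at this
  · rw [map_mul, map_prod]
    exact mul_ne_zero h0 (Finset.prod_ne_zero_iff.mpr fun i _ => h1 i)
  · rintro (j | ⟨i, t⟩)
    · simp only [Sum.elim_inl, map_mul, hinl']
      ring
    · simp only [Sum.elim_inr, map_mul, hinr' i ((c i).succAbove t), chartCoord_inr_succAbove]
      rw [← Finset.mul_prod_erase Finset.univ (fun i => g (Sum.inr ⟨i, c i⟩)) (Finset.mem_univ i),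
        map_mul]
      ring
  -- If `ψ l` vanished on the chart, `X l` would vanish on `V`, contrary to `v l ≠ 0`.
  · intro h
    have h2 : X l ∈ definingIdeal V := by
      rw [hψ.mem_iff_aeval_dehomogenize c (isHomogeneous_X ℂ l), aeval_X]
      exact h
    have h3 := mem_definingIdeal.mp h2 v hv
    rw [eval_X] at h3
    exact hl h3

end IsBirationalParam

end Birational

/-! ### The gradient of the parametric Rayleigh quotient -/

theorem hasFDerivAt_eval {ι : Type} [Fintype ι] (f : MvPolynomial ι ℂ) (x : ι → ℂ) :
    ∃ L : (ι → ℂ) →L[ℂ] ℂ, HasFDerivAt (fun x : ι → ℂ => eval x f) L x ∧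
      ∀ w, L w = ∑ s, w s * eval x (pderiv s f) := by
  classical
  induction f using MvPolynomial.induction_on with
  | C r =>
    refine ⟨0, ?_, fun w => by simp⟩
    simp only [eval_C]
    exact hasFDerivAt_const r x
  | add p q hp hq =>
    obtain ⟨L, hL, hLw⟩ := hp
    obtain ⟨L', hL', hLw'⟩ := hq
    refine ⟨L + L', ?_, fun w => ?_⟩
    · simp only [map_add]
      exact hL.add hL'
    · simp [hLw, hLw', mul_add, Finset.sum_add_distrib]
  | mul_X p i hp =>
    obtain ⟨L, hL, hLw⟩ := hp
    have h1 : HasFDerivAt (fun x : ι → ℂ => x i) (ContinuousLinearMap.proj (R := ℂ) i) x :=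
      hasFDerivAt_apply i x
    have h2 := hL.mul h1
    simp only [map_mul, eval_X]
    refine ⟨_, h2, fun w => ?_⟩
    simp only [_root_.add_apply, _root_.smul_apply, hLw, ContinuousLinearMap.proj_apply,
      smul_eq_mul, pderiv_mul, map_add, map_mul, eval_X, mul_add, Finset.sum_add_distrib]
    rw [add_comm]
    congr 1
    · rw [Finset.mul_sum]
      exact Finset.sum_congr rfl fun s _ => by ring
    · rw [Finset.sum_eq_single i]
      · rw [pderiv_X_self, map_one]
        ring
      · intro b _ hb
        rw [pderiv_X_of_ne hb.symm]
        simp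
      · simp

section Param

variable {n m k : ℕ} {a : Fin k → ℕ}

theorem hasFDerivAt_evalMap (ψ : Fin n → MvPolynomial (CoordIdx m a) ℂ) (x : CoordIdx m a → ℂ) :
    ∃ L : (CoordIdx m a → ℂ) →L[ℂ] (Fin n → ℂ), HasFDerivAt (evalMap ψ) L x ∧
      ∀ w j, L w j = ∑ s, w s * eval x (pderiv s (ψ j)) := by
  choose L hL hLw using fun j => hasFDerivAt_eval (ψ j) x
  exact ⟨ContinuousLinearMap.pi L, hasFDerivAt_pi.mpr hL, fun w j => hLw j w⟩

/-- By the chain rule only the columns of the Jacobian matter. Including `ψ(x)` in the jet span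
imposes nothing new, because the derivative of the scale-invariant Rayleigh quotient kills the
radial direction. -/
theorem fderiv_rayleigh_evalMap_eq_zero_iff {ψ : Fin n → MvPolynomial (CoordIdx m a) ℂ}
    {H : Matrix (Fin n) (Fin n) ℂ} (hH : H.IsSymm) {x : CoordIdx m a → ℂ}
    (hx : evalMap ψ x ⬝ᵥ evalMap ψ x ≠ 0) :
    fderiv ℂ (fun x : CoordIdx m a → ℂ => rayleigh H (evalMap ψ x)) x = 0 ↔
      CritAt H (evalMap ψ x) (jetSpan ψ x) := by
  obtain ⟨L, hL, hLw⟩ := hasFDerivAt_evalMap ψ x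
  obtain ⟨R, hR, hRw⟩ := hasFDerivAt_rayleigh hH hx
  set v := evalMap ψ x with hv
  have h1 : HasFDerivAt (fun x : CoordIdx m a → ℂ => rayleigh H (evalMap ψ x)) (R.comp L) x :=
    HasFDerivAt.comp (g := rayleigh H) x hR hL
  have hR0 : ∀ w, R w = 0 ↔ (w ⬝ᵥ H.mulVec v) * (v ⬝ᵥ v) = (v ⬝ᵥ H.mulVec v) * (w ⬝ᵥ v) := by
    intro w
    rw [← hR.fderiv, fderiv_rayleigh_eq_zero_iff hH hx]
  rw [h1.fderiv]
  constructor
  · intro h w hw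
    obtain ⟨c₀, c, hc⟩ := mem_jetSpan_iff.mp hw
    have h2 : w = c₀ • v + L c := by
      funext j
      rw [hc j, Pi.add_apply, hLw]
      rfl
    rw [← hR0, h2, map_add, map_smul]
    have h3 : R (L c) = 0 := by
      have := DFunLike.congr_fun h c
      exact this
    rw [h3, (hR0 v).mpr rfl, smul_zero, add_zero]
  · intro h
    ext w
    refine (hR0 _).mpr (h _ (mem_jetSpan_iff.mpr ⟨0, w, fun j => ?_⟩))
    rw [zero_mul, zero_add]
    exact hLw w j

theorem gradVanishes_iff_critAt {ψ : Fin n → MvPolynomial (CoordIdx m a) ℂ}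
    {H : Matrix (Fin n) (Fin n) ℂ} (hH : H.IsSymm) {u : ParamSpace m a} (hu : u ∈ nonIsotropic ψ) :
    GradVanishes ψ H u ↔ CritAt H (evalMap ψ (coords u)) (jetSpan ψ (coords u)) :=
  fderiv_rayleigh_evalMap_eq_zero_iff hH hu

end Param

/-! ### Critical points on the variety and in one chart -/

namespace AffineInverse

variable {n : ℕ} {σ : Type} [Fintype σ] {θ : Fin n → MvPolynomial σ ℂ} {V : Set (PSpace n)}

omit [Fintype σ] in
theorem _root_.RayleighRitz.eval_aeval_eq (θ : Fin n → MvPolynomial σ ℂ) (x : σ → ℂ)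
    (f : MvPolynomial (Fin n) ℂ) : eval x (aeval θ f) = eval (fun j => eval x (θ j)) f :=
  MvPolynomial.comp_aeval_apply θ (aeval x) f

/-- The critical points of the Rayleigh quotient in the domain of a birational parametrization. -/
def affCrit (S : AffineInverse θ (definingIdeal V)) (H : Matrix (Fin n) (Fin n) ℂ) :
    Set (σ → ℂ) :=
  {x | eval x (aeval θ S.goodForm) ≠ 0 ∧
    (fun j => eval x (θ j)) ⬝ᵥ (fun j => eval x (θ j)) ≠ 0 ∧
    CritAt H (fun j => eval x (θ j)) (jetSpan θ x)}

/-- Regularity is automatic in the domain of the inverse: there the tangent space is the jet span,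
of dimension `|σ| + 1`, which is the transcendence degree of the coordinate ring. -/
theorem smul_mem_regCone (S : AffineInverse θ (definingIdeal V))
    (hV : ∀ v, v ∈ cone V ↔ v ≠ 0 ∧ ∀ f ∈ definingIdeal V, eval v f = 0) {x : σ → ℂ}
    (hx : eval x (aeval θ S.goodForm) ≠ 0) {t : ℂ} (ht : t ≠ 0) :
    t • (fun j => eval x (θ j)) ∈ regCone V := by
  rw [eval_aeval_eq] at hx
  refine ⟨(hV _).mpr ⟨smul_ne_zero ht fun h0 => ?_, fun f hf => (S.mem_iff f).mp hf t x⟩, ?_⟩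
  · have := S.θ_ne_zero (t := 1) (x := x) (by simpa using hx)
    exact this (congrFun h0 S.l)
  · rw [coneTangent_smul ht, S.coneTangent_eq_jetSpan hx, S.finrank_jetSpan hx, S.trdeg_eq]

omit [Fintype σ] in
theorem eval_smul_goodForm (S : AffineInverse θ (definingIdeal V)) {t : ℂ} (ht : t ≠ 0)
    (x : σ → ℂ) : eval (t • (fun j => eval x (θ j))) S.goodForm ≠ 0 ↔
      eval x (aeval θ S.goodForm) ≠ 0 := by
  rw [IsHomogeneous.eval_smul S.isHomogeneous_goodForm, eval_aeval_eq, mul_ne_zero_iff,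
    and_iff_right (pow_ne_zero _ ht)]

theorem smul_dotProduct_self_ne_zero {v : Fin n → ℂ} {t : ℂ} (ht : t ≠ 0) :
    (t • v) ⬝ᵥ (t • v) ≠ 0 ↔ v ⬝ᵥ v ≠ 0 := by
  simp [ht]

theorem _root_.RayleighRitz.mem_critPoints {H : Matrix (Fin n) (Fin n) ℂ} (hH : H.IsSymm)
    {p : PSpace n} : p ∈ critPoints V H ↔ p.rep ∈ regCone V ∧ p.rep ⬝ᵥ p.rep ≠ 0 ∧
      CritAt H p.rep (coneTangent V p.rep) := by
  refine and_congr_right fun _ => and_congr_right fun h => ?_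
  exact forall_congr' fun w => forall_congr' fun _ => fderiv_rayleigh_eq_zero_iff hH h w

/-- If all critical points on the variety lie in the domain of the inverse map, then they are in
bijection with the critical points in the chart. -/
theorem ncard_critPoints (S : AffineInverse θ (definingIdeal V))
    (hV : ∀ v, v ∈ cone V ↔ v ≠ 0 ∧ ∀ f ∈ definingIdeal V, eval v f = 0)
    {H : Matrix (Fin n) (Fin n) ℂ} (hH : H.IsSymm)
    (hgood : ∀ v ∈ regCone V, v ⬝ᵥ v ≠ 0 → CritAt H v (coneTangent V v) →
      eval v S.goodForm ≠ 0) (hfin : (S.affCrit H).Finite) :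
    (critPoints V H).Finite ∧ (critPoints V H).ncard = (S.affCrit H).ncard := by
  set F : PSpace n → σ → ℂ := fun p s => eval p.rep (S.qs s) / eval p.rep S.q with hF
  have key : ∀ p ∈ critPoints V H, ∃ t : ℂ, t ≠ 0 ∧
      p.rep = t • (fun j => eval (F p) (θ j)) := by
    intro p hp
    obtain ⟨h1, h2, h3⟩ := (mem_critPoints hH).mp hp
    have hg := hgood _ h1 h2 h3
    have hI := ((hV _).mp h1.1).2
    obtain ⟨t, x, hx, hv⟩ := S.exists_eq_mul (A := ℂ) hI (isUnit_iff_ne_zero.mpr hg)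
    have hq := S.q_ne_zero hg
    have hxF : F p = x := by
      funext s
      exact (div_eq_iff hq).mpr (hx s)
    have hv' : p.rep = t • (fun j => eval (F p) (θ j)) := by
      rw [hxF]
      exact funext hv
    refine ⟨t, ?_, hv'⟩
    rintro rfl
    rw [zero_smul] at hv'
    exact p.rep_nonzero hv'
  have himg : F '' critPoints V H = S.affCrit H := by
    ext x
    constructor
    · rintro ⟨p, hp, rfl⟩
      obtain ⟨t, ht, hv⟩ := key p hp
      obtain ⟨h1, h2, h3⟩ := (mem_critPoints hH).mp hp
      have hg := hgood _ h1 h2 h3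
      rw [hv, S.eval_smul_goodForm ht] at hg
      rw [hv, smul_dotProduct_self_ne_zero ht] at h2
      rw [hv, critAt_smul ht, coneTangent_smul ht,
        S.coneTangent_eq_jetSpan (by rwa [← eval_aeval_eq])] at h3
      exact ⟨hg, h2, h3⟩
    · rintro ⟨h1, h2, h3⟩
      have hreg := S.smul_mem_regCone hV h1 one_ne_zero
      rw [one_smul] at hreg
      obtain ⟨hv0, -⟩ := (hV _).mp hreg.1
      obtain ⟨c, hc, hrep⟩ := exists_rep_eq_smul hv0
      refine ⟨Projectivization.mk ℂ _ hv0, (mem_critPoints hH).mpr ?_, ?_⟩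
      · rw [hrep]
        refine ⟨S.smul_mem_regCone hV h1 hc, (smul_dotProduct_self_ne_zero hc).mpr h2, ?_⟩
        rw [critAt_smul hc, coneTangent_smul hc,
          S.coneTangent_eq_jetSpan (by rwa [← eval_aeval_eq])]
        exact h3
      · funext s
        have hq := S.q_ne_zero ((S.eval_smul_goodForm hc x).mpr h1)
        rw [hF]
        simp only [hrep]
        exact (div_eq_iff hq).mpr (S.aeval_qs_mul (A := ℂ) c x s)
  have hinj : Set.InjOn F (critPoints V H) := by
    intro p hp p' hp' h
    obtain ⟨t, ht, hv⟩ := key p hp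
    obtain ⟨t', ht', hv'⟩ := key p' hp'
    rw [← h] at hv'
    rw [← Projectivization.mk_rep p, ← Projectivization.mk_rep p', Projectivization.mk_eq_mk_iff']
    refine ⟨t * t'⁻¹, ?_⟩
    rw [hv, hv', smul_smul, mul_assoc, inv_mul_cancel₀ ht', mul_one]
  refine ⟨Set.Finite.of_finite_image (himg ▸ hfin) hinj, ?_⟩
  rw [← himg, hinj.ncard_image]

end AffineInverse

/-! ### Critical points on the parameter space -/

section Param

variable {n m k : ℕ} {a : Fin k → ℕ} {ψ : Fin n → MvPolynomial (CoordIdx m a) ℂ}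
  {V : Set (PSpace n)}

/-- The immersive points of `U` off the isotropic quadric where the gradient of the Rayleigh
quotient vanishes. -/
def immersiveCrit (ψ : Fin n → MvPolynomial (CoordIdx m a) ℂ) (H : Matrix (Fin n) (Fin n) ℂ) :
    Set (ParamSpace m a) :=
  {u | u ∈ nonIsotropic ψ ∧ IsImmersiveAt ψ u ∧ GradVanishes ψ H u}

theorem isImmersiveAt_iff {u : ParamSpace m a} : IsImmersiveAt ψ u ↔
    Module.finrank ℂ (jetSpan ψ (coords u)) = Fintype.card (AffIdx m a) + 1 := by
  rw [card_affIdx]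
  rfl

/-- The polynomial that cuts out the points of the chart `c` outside the chart `c₀` or outside the
domain of the inverse map. -/
def badPoly {c₀ : ∀ i, Fin (a i + 1)}
    (S : AffineInverse (fun j => dehomogenize c₀ (ψ j)) (definingIdeal V))
    (c : ∀ i, Fin (a i + 1)) : MvPolynomial (AffIdx m a) ℂ :=
  (∏ i, chartCoord c X (Sum.inr ⟨i, c₀ i⟩)) *
    aeval (fun j => dehomogenize c (ψ j)) S.goodForm

/-- Each chart coordinate is either `1` or a variable, and `goodForm`, which does not vanish on `V`,
is nonzero in every chart since charts are dense. -/
theorem badPoly_ne_zero (hψ : IsBirationalParam ψ V) {c₀ : ∀ i, Fin (a i + 1)}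
    (S : AffineInverse (fun j => dehomogenize c₀ (ψ j)) (definingIdeal V))
    (c : ∀ i, Fin (a i + 1)) : badPoly S c ≠ 0 := by
  refine mul_ne_zero (Finset.prod_ne_zero_iff.mpr fun i _ => ?_) fun h => ?_
  · rcases Fin.eq_self_or_eq_succAbove (c i) (c₀ i) with h | ⟨t, h⟩
    · rw [h, chartCoord_inr_self]
      exact one_ne_zero
    · rw [h, chartCoord_inr_succAbove]
      exact X_ne_zero _
  · exact S.goodForm_notMem ((hψ.mem_iff_aeval_dehomogenize c S.isHomogeneous_goodForm).mpr h)

/-- An immersive critical point lies in some chart `c`, and nonvanishing of `badPoly S c` moves it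
to the chart `c₀` and into the domain of the inverse. Conversely points of that domain are immersive
by `finrank_jetSpan`. -/
theorem immersiveCrit_eq_image (hψ : IsBirationalParam ψ V) {c₀ : ∀ i, Fin (a i + 1)}
    (S : AffineInverse (fun j => dehomogenize c₀ (ψ j)) (definingIdeal V))
    {H : Matrix (Fin n) (Fin n) ℂ} (hH : H.IsSymm)
    (hgood : ∀ (c : ∀ i, Fin (a i + 1)) (y : AffIdx m a → ℂ),
      (fun j => eval y (dehomogenize c (ψ j))) ⬝ᵥ (fun j => eval y (dehomogenize c (ψ j))) ≠ 0 →
      Module.finrank ℂ (jetSpan (fun j => dehomogenize c (ψ j)) y) =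
        Fintype.card (AffIdx m a) + 1 →
      CritAt H (fun j => eval y (dehomogenize c (ψ j)))
        (jetSpan (fun j => dehomogenize c (ψ j)) y) → eval y (badPoly S c) ≠ 0) :
    immersiveCrit ψ H = chartPoint c₀ '' S.affCrit H := by
  obtain ⟨d, hd⟩ := hψ.multihomogeneous
  ext u
  constructor
  · rintro ⟨h1, h2, h3⟩
    rw [gradVanishes_iff_critAt hH h1] at h3
    rw [isImmersiveAt_iff] at h2
    have h1' : evalMap ψ (coords u) ⬝ᵥ evalMap ψ (coords u) ≠ 0 := h1
    obtain ⟨c, hc⟩ := exists_chart u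
    obtain ⟨y, rfl⟩ := exists_chartPoint_eq hc
    have hbad : eval y (badPoly S c) ≠ 0 := by
      obtain ⟨r, hr, hv, hj⟩ := evalMap_chartPoint hd c y
      rw [hv, AffineInverse.smul_dotProduct_self_ne_zero hr] at h1'
      rw [hj] at h2
      rw [hv, hj, critAt_smul hr] at h3
      exact hgood c y h1' h2 h3
    rw [badPoly, map_mul, map_prod, mul_ne_zero_iff, Finset.prod_ne_zero_iff] at hbad
    have hc₀ : ∀ i, coords (chartPoint c y) (Sum.inr ⟨i, c₀ i⟩) ≠ 0 := by
      intro i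
      rw [coords_chartPoint_ne_zero]
      have := hbad.1 i (Finset.mem_univ i)
      rw [map_chartCoord] at this
      simpa only [eval_X] using this
    have hgf : eval (evalMap ψ (coords (chartPoint c y))) S.goodForm ≠ 0 := by
      obtain ⟨r, hr, hv, hj⟩ := evalMap_chartPoint hd c y
      rw [hv, IsHomogeneous.eval_smul S.isHomogeneous_goodForm, ← eval_aeval_eq]
      exact mul_ne_zero (pow_ne_zero _ hr) hbad.2
    obtain ⟨y', hy'⟩ := exists_chartPoint_eq hc₀
    rw [← hy'] at h1' h3 hgf ⊢
    obtain ⟨r, hr, hv, hj⟩ := evalMap_chartPoint hd c₀ y'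
    rw [hv, AffineInverse.smul_dotProduct_self_ne_zero hr] at h1'
    rw [hv, hj, critAt_smul hr] at h3
    rw [hv, S.eval_smul_goodForm hr] at hgf
    exact ⟨y', ⟨hgf, h1', h3⟩, rfl⟩
  · rintro ⟨y, ⟨h1, h2, h3⟩, rfl⟩
    obtain ⟨r, hr, hv, hj⟩ := evalMap_chartPoint hd c₀ y
    have h4 : chartPoint c₀ y ∈ nonIsotropic ψ := by
      change evalMap ψ _ ⬝ᵥ evalMap ψ _ ≠ 0
      rw [hv, AffineInverse.smul_dotProduct_self_ne_zero hr]
      exact h2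
    refine ⟨h4, ?_, ?_⟩
    · rw [isImmersiveAt_iff, hj, S.finrank_jetSpan (by rwa [← eval_aeval_eq])]
    · rw [gradVanishes_iff_critAt hH h4, hv, hj, critAt_smul hr]
      exact h3

/-- The generic number of critical points. -/
theorem exists_generically_ncard (hψ : IsBirationalParam ψ V) :
    ∃ d : ℕ, Generically fun y : Sym2 (Fin n) → ℂ =>
      (immersiveCrit ψ (symMat y) ⊆ regNonIsotropic ψ V) ∧
      ((immersiveCrit ψ (symMat y)).Finite ∧ (immersiveCrit ψ (symMat y)).ncard = d) ∧
      ((critPoints V (symMat y)).Finite ∧ (critPoints V (symMat y)).ncard = d) := by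
  classical
  obtain ⟨S⟩ := hψ.nonempty_affineInverse (fun _ => 0)
  have := S.isPrime
  obtain ⟨b, hb⟩ := hψ.multihomogeneous
  obtain ⟨d, hd⟩ := exists_generically_ncard_eq (fun j => dehomogenize (fun _ => 0) (ψ j))
    (aeval (fun j => dehomogenize (fun _ => 0) (ψ j)) S.goodForm) fun x hx =>
      S.finrank_jetSpan (by rwa [← eval_aeval_eq])
  -- Every chart is needed, since a critical point might lie outside the chart in which points are
  -- counted. The statement `h2` does the same on `V`, where regular points need not lie in the
  -- image of `ψ`.
  have h1 := Generically.forall fun c : ∀ i, Fin (a i + 1) =>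
    generically_eval_ne_zero (fun j => dehomogenize c (ψ j)) (badPoly_ne_zero hψ S c)
  have h2 := generically_eval_rep_ne_zero S.trdeg_eq S.isHomogeneous_goodForm S.goodForm_notMem
  have hV := fun v => hψ.mem_cone_iff (v := v)
  refine ⟨d, ((hd.and h1).and h2).mono ?_⟩
  rintro y ⟨⟨⟨hfin, hcard⟩, h1⟩, h2⟩
  have himg := immersiveCrit_eq_image hψ S (symMat_isSymm y) h1
  have hfin' : (S.affCrit (symMat y)).Finite := hfin
  have hcard' : (S.affCrit (symMat y)).ncard = d := hcard
  refine ⟨?_, ?_, ?_⟩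
  -- Regularity is not part of `immersiveCrit`; it holds for general matrices because the points lie
  -- in the domain of the inverse.
  · intro u hu
    refine ⟨?_, hu.1⟩
    rw [himg] at hu
    obtain ⟨x, hx, rfl⟩ := hu
    obtain ⟨r, hr, hv, -⟩ := evalMap_chartPoint hb (fun _ => 0) x
    rw [hv]
    exact S.smul_mem_regCone hV hx.1 hr
  · rw [himg, Set.ncard_image_of_injective _ (chartPoint_injective _)]
    exact ⟨hfin'.image _, hcard'⟩
  · have := S.ncard_critPoints hV (symMat_isSymm y) h2 hfin'
    rwa [hcard'] at this

end Param

/-! ### The critical ideal -/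

section Param

variable {n m k : ℕ} {a : Fin k → ℕ} {ψ : Fin n → MvPolynomial (CoordIdx m a) ℂ}

/-- The generators of the critical ideal before saturation. -/
def critGen (ψ : Fin n → MvPolynomial (CoordIdx m a) ℂ) (H : Matrix (Fin n) (Fin n) ℂ)
    (s : CoordIdx m a) : MvPolynomial (CoordIdx m a) ℂ :=
  denomPoly ψ * pderiv s (numerPoly ψ H) - numerPoly ψ H * pderiv s (denomPoly ψ)

theorem eval_denomPoly (ψ : Fin n → MvPolynomial (CoordIdx m a) ℂ) (x : CoordIdx m a → ℂ) :
    eval x (denomPoly ψ) = evalMap ψ x ⬝ᵥ evalMap ψ x := by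
  simp [denomPoly, dotProduct, evalMap]

theorem eval_numerPoly (ψ : Fin n → MvPolynomial (CoordIdx m a) ℂ)
    (H : Matrix (Fin n) (Fin n) ℂ) (x : CoordIdx m a → ℂ) :
    eval x (numerPoly ψ H) = evalMap ψ x ⬝ᵥ H.mulVec (evalMap ψ x) := by
  simp [numerPoly, dotProduct, Matrix.mulVec, evalMap, Finset.mul_sum, mul_assoc]

theorem fderiv_eq_zero_iff_critGen {H : Matrix (Fin n) (Fin n) ℂ} {x : CoordIdx m a → ℂ}
    (hx : evalMap ψ x ⬝ᵥ evalMap ψ x ≠ 0) :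
    fderiv ℂ (fun x : CoordIdx m a → ℂ => rayleigh H (evalMap ψ x)) x = 0 ↔
      ∀ s, eval x (critGen ψ H s) = 0 := by
  obtain ⟨L, hL, hLw⟩ := hasFDerivAt_eval (numerPoly ψ H) x
  obtain ⟨R, hR, hRw⟩ := hasFDerivAt_eval (denomPoly ψ) x
  rw [← eval_denomPoly] at hx
  have h1 : (fun x : CoordIdx m a → ℂ => rayleigh H (evalMap ψ x)) =
      fun x => eval x (numerPoly ψ H) * (eval x (denomPoly ψ))⁻¹ := by
    funext x
    rw [rayleigh, div_eq_mul_inv, eval_numerPoly, eval_denomPoly]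
  have h2 := hL.mul (HasDerivAt.comp_hasFDerivAt
    (f := fun x : CoordIdx m a → ℂ => eval x (denomPoly ψ)) x (hasDerivAt_inv hx) hR)
  have h3 : ∀ w, fderiv ℂ (fun x : CoordIdx m a → ℂ => rayleigh H (evalMap ψ x)) x w =
      (∑ s, w s * eval x (critGen ψ H s)) / eval x (denomPoly ψ) ^ 2 := by
    intro w
    rw [h1]
    refine (DFunLike.congr_fun h2.fderiv w).trans ?_
    have h4 : ∑ s, w s * eval x (critGen ψ H s) = eval x (denomPoly ψ) * L w -
        eval x (numerPoly ψ H) * R w := by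
      rw [hLw, hRw, Finset.mul_sum, Finset.mul_sum, ← Finset.sum_sub_distrib]
      refine Finset.sum_congr rfl fun s _ => ?_
      rw [critGen, map_sub, map_mul, map_mul]
      ring
    rw [h4]
    simp only [_root_.add_apply, _root_.smul_apply, smul_eq_mul, Function.comp_apply]
    field_simp
    ring
  constructor
  · intro h s
    have h5 := h3 (Pi.single s 1)
    rw [h, eq_comm] at h5
    have h6 := (div_eq_zero_iff.mp h5).resolve_right (pow_ne_zero 2 hx)
    simpa [Pi.single_apply] using h6
  · intro h
    ext w
    rw [h3]
    simp [h]

theorem critGen_mem_critIdeal (H : Matrix (Fin n) (Fin n) ℂ) (s : CoordIdx m a) :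
    critGen ψ H s ∈ critIdeal ψ H :=
  ⟨0, by rw [pow_zero, mul_one]; exact Ideal.subset_span ⟨s, rfl⟩⟩

theorem eval_eq_zero_of_mem_critIdeal {H : Matrix (Fin n) (Fin n) ℂ} {x : CoordIdx m a → ℂ}
    (hx : eval x (denomPoly ψ) ≠ 0) (h : ∀ s, eval x (critGen ψ H s) = 0)
    {f : MvPolynomial (CoordIdx m a) ℂ} (hf : f ∈ critIdeal ψ H) : eval x f = 0 := by
  obtain ⟨N, hN⟩ := hf
  have h1 : Ideal.span (Set.range (critGen ψ H)) ≤ RingHom.ker (eval x) := by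
    rw [Ideal.span_le]
    rintro _ ⟨s, rfl⟩
    exact h s
  have h2 : eval x (f * denomPoly ψ ^ N) = 0 := h1 hN
  rw [map_mul, map_pow] at h2
  exact (mul_eq_zero.mp h2).resolve_right (pow_ne_zero _ hx)

/-- Nullstellensatz for the critical ideal. -/
theorem exists_pow_mem_critIdeal {H : Matrix (Fin n) (Fin n) ℂ}
    {f : MvPolynomial (CoordIdx m a) ℂ}
    (hf : ∀ x, eval x (denomPoly ψ) ≠ 0 → (∀ s, eval x (critGen ψ H s) = 0) → eval x f = 0) :
    ∃ N, f ^ N ∈ critIdeal ψ H := by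
  have h1 : f * denomPoly ψ ∈ (Ideal.span (Set.range (critGen ψ H))).radical := by
    rw [← vanishingIdeal_zeroLocus_eq_radical (K := ℂ), mem_vanishingIdeal_iff]
    intro x hx
    rw [aeval_eq_eval]
    change eval x _ = 0
    rw [map_mul]
    by_cases h0 : eval x (denomPoly ψ) = 0
    · rw [h0, mul_zero]
    · rw [hf x h0 fun s => hx _ (Ideal.subset_span ⟨s, rfl⟩), zero_mul]
  obtain ⟨N, hN⟩ := h1
  rw [mul_pow] at hN
  exact ⟨N, N, hN⟩

/-- The condition that the gradient vanishes does not depend on the homogeneous coordinates. -/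
theorem fderiv_eq_zero_iff_of_isCoord {d : Fin k → ℕ}
    (hψ : ∀ i j, IsWeightedHomogeneous (blockWeight i) (ψ j) (d i))
    {H : Matrix (Fin n) (Fin n) ℂ} (hH : H.IsSymm) {u : ParamSpace m a} {x : CoordIdx m a → ℂ}
    (hx : IsCoord u x) :
    (eval x (denomPoly ψ) ≠ 0 ∧ ∀ s, eval x (critGen ψ H s) = 0) ↔
      u ∈ nonIsotropic ψ ∧ GradVanishes ψ H u := by
  obtain ⟨r, hr, rfl⟩ := isCoord_iff.mp hx
  have h0 : ∏ i, r i ^ d i ≠ 0 := Finset.prod_ne_zero_iff.mpr fun i _ => pow_ne_zero _ (hr i)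
  have h1 : eval (scaleBlocks r (coords u)) (denomPoly ψ) ≠ 0 ↔ u ∈ nonIsotropic ψ := by
    rw [eval_denomPoly, evalMap_scaleBlocks hψ, AffineInverse.smul_dotProduct_self_ne_zero h0]
    rfl
  rw [h1]
  refine and_congr_right fun hu => ?_
  have h2 : evalMap ψ (scaleBlocks r (coords u)) ⬝ᵥ evalMap ψ (scaleBlocks r (coords u)) ≠ 0 := by
    rw [← eval_denomPoly]
    exact h1.mpr hu
  rw [gradVanishes_iff_critAt hH hu, ← fderiv_eq_zero_iff_critGen h2,
    fderiv_rayleigh_evalMap_eq_zero_iff hH h2, evalMap_scaleBlocks hψ, jetSpan_scaleBlocks hψ hr,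
    critAt_smul h0]

theorem mem_zeroSet_critIdeal_iff {d : Fin k → ℕ}
    (hψ : ∀ i j, IsWeightedHomogeneous (blockWeight i) (ψ j) (d i))
    {H : Matrix (Fin n) (Fin n) ℂ} (hH : H.IsSymm) {u : ParamSpace m a} (hu : u ∈ nonIsotropic ψ) :
    u ∈ zeroSet (critIdeal ψ H) ↔ GradVanishes ψ H u := by
  constructor
  · intro h
    refine ((fderiv_eq_zero_iff_of_isCoord hψ hH (isCoord_coords u)).mp ⟨?_, fun s => ?_⟩).2
    · rw [eval_denomPoly]
      exact hu
    · exact h _ (isCoord_coords u) _ (critGen_mem_critIdeal H s)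
  · intro h x hx f hf
    obtain ⟨h1, h2⟩ := (fderiv_eq_zero_iff_of_isCoord hψ hH hx).mpr ⟨hu, h⟩
    exact eval_eq_zero_of_mem_critIdeal h1 h2 hf

theorem exists_isCoord {x : CoordIdx m a → ℂ}
    (hx : ∀ i, ∃ s, x (Sum.inr ⟨i, s⟩) ≠ 0) : ∃ u : ParamSpace m a, IsCoord u x :=
  ⟨(fun j => x (Sum.inl j), fun i => Projectivization.mk ℂ (fun s => x (Sum.inr ⟨i, s⟩))
    (Function.ne_iff.mpr (hx i))), fun _ => rfl, fun _ => ⟨_, rfl⟩⟩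

theorem zeroSet_critIdeal {d : Fin k → ℕ}
    (hψ : ∀ i j, IsWeightedHomogeneous (blockWeight i) (ψ j) (d i))
    {H : Matrix (Fin n) (Fin n) ℂ} (hH : H.IsSymm) :
    zeroSet (critIdeal ψ H) = paramClosure {u | u ∈ nonIsotropic ψ ∧ GradVanishes ψ H u} := by
  ext u
  constructor
  · intro hu x hx f hf
    rw [mem_vanishingIdeal_iff] at hf
    have h1 : ∀ i, ∃ s, x (Sum.inr ⟨i, s⟩) ≠ 0 := fun i => by
      obtain ⟨h, -⟩ := hx.2 i
      exact Function.ne_iff.mp h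
    choose c hc using h1
    -- The Nullstellensatz also sees vectors with a zero block, which represent no point of `U`. The
    -- product of coordinates that are nonzero at `x` forces vanishing there and is cancelled
    -- afterwards.
    obtain ⟨N, hN⟩ := exists_pow_mem_critIdeal (ψ := ψ) (H := H)
      (f := f * ∏ i, X (Sum.inr ⟨i, c i⟩)) (fun z hz hz' => by
        rw [map_mul, map_prod]
        by_cases h : ∀ i, z (Sum.inr ⟨i, c i⟩) ≠ 0
        · obtain ⟨u', hu'⟩ := exists_isCoord fun i => ⟨c i, h i⟩
          have h2 : eval z f = 0 :=
            hf z ⟨u', (fderiv_eq_zero_iff_of_isCoord hψ hH hu').mp ⟨hz, hz'⟩, hu'⟩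
          rw [h2, zero_mul]
        · push Not at h
          obtain ⟨i, hi⟩ := h
          have h3 : ∏ i, eval z (X (Sum.inr ⟨i, c i⟩) : MvPolynomial (CoordIdx m a) ℂ) = 0 :=
            Finset.prod_eq_zero (Finset.mem_univ i) (by rw [eval_X, hi])
          rw [h3, mul_zero])
    have h4 := hu x hx _ hN
    rw [map_pow, map_mul, map_prod] at h4
    refine (mul_eq_zero.mp (eq_zero_of_pow_eq_zero h4)).resolve_right ?_
    exact Finset.prod_ne_zero_iff.mpr fun i _ => by rw [eval_X]; exact hc i
  · intro hu x hx f hf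
    refine hu x hx f ?_
    rw [mem_vanishingIdeal_iff]
    rintro z ⟨u', hu', hz⟩
    obtain ⟨h1, h2⟩ := (fderiv_eq_zero_iff_of_isCoord hψ hH hz).mpr hu'
    exact eval_eq_zero_of_mem_critIdeal h1 h2 hf

/-! ### Finite sets are Zariski closed -/

/-- Distinct points differ in an affine coordinate or in a projective factor; in the second case a
2×2 minor of their homogeneous coordinates is nonzero. -/
theorem exists_separating {u s : ParamSpace m a} (h : s ≠ u) :
    ∃ f : MvPolynomial (CoordIdx m a) ℂ, (∀ x, IsCoord s x → eval x f = 0) ∧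
      eval (coords u) f ≠ 0 := by
  by_cases h1 : s.1 = u.1
  · have h2 : s.2 ≠ u.2 := fun h2 => h (Prod.ext h1 h2)
    obtain ⟨i, hi⟩ := Function.ne_iff.mp h2
    obtain ⟨p, hp⟩ := Function.ne_iff.mp (s.2 i).rep_nonzero
    have h3 : ∃ q, (s.2 i).rep p * (u.2 i).rep q ≠ (s.2 i).rep q * (u.2 i).rep p := by
      by_contra hc
      push Not at hc
      refine hi (Eq.symm ?_)
      rw [← Projectivization.mk_rep (s.2 i), ← Projectivization.mk_rep (u.2 i),
        Projectivization.mk_eq_mk_iff']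
      refine ⟨(u.2 i).rep p / (s.2 i).rep p, funext fun q => ?_⟩
      rw [Pi.smul_apply, smul_eq_mul, div_mul_eq_mul_div, div_eq_iff hp, mul_comm, ← hc q, mul_comm]
    obtain ⟨q, hq⟩ := h3
    refine ⟨C ((s.2 i).rep p) * X (Sum.inr ⟨i, q⟩) - C ((s.2 i).rep q) * X (Sum.inr ⟨i, p⟩),
      fun x hx => ?_, ?_⟩
    · obtain ⟨r, hr, rfl⟩ := isCoord_iff.mp hx
      simp only [map_sub, map_mul, eval_C, eval_X, scaleBlocks, Sum.elim_inr, coords]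
      ring
    · simp only [map_sub, map_mul, eval_C, eval_X, coords, Sum.elim_inr]
      exact sub_ne_zero.mpr hq
  · obtain ⟨j, hj⟩ := Function.ne_iff.mp h1
    refine ⟨X (Sum.inl j) - C (s.1 j), fun x hx => ?_, ?_⟩
    · rw [map_sub, eval_X, eval_C, hx.1 j, sub_self]
    · rw [map_sub, eval_X, eval_C]
      exact sub_ne_zero.mpr hj.symm

theorem paramClosure_of_finite {S : Set (ParamSpace m a)} (hS : S.Finite) : paramClosure S = S := by
  ext u
  constructor
  · intro hu
    by_contra hc
    have h1 : ∀ s : S, s.1 ≠ u := fun s h => hc (h ▸ s.2)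
    choose f hf hfu using fun s : S => exists_separating (h1 s)
    have := hS.fintype
    have h2 : eval (coords u) (∏ s, f s) = 0 := by
      refine hu _ (isCoord_coords u) _ ?_
      rw [mem_vanishingIdeal_iff]
      rintro x ⟨s, hs, hx⟩
      rw [aeval_eq_eval]
      change eval x _ = 0
      rw [map_prod]
      exact Finset.prod_eq_zero (Finset.mem_univ ⟨s, hs⟩) (hf ⟨s, hs⟩ x hx)
    rw [map_prod] at h2
    exact Finset.prod_ne_zero_iff.mpr (fun s _ => hfu s) h2
  · intro hu x hx f hf
    exact mem_vanishingIdeal_iff.mp hf x ⟨u, hu, hx⟩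

end Param

end RayleighRitz

end

/-! ### Assembly of the three parts -/

open RayleighRitz

theorem proposition4p12 {n m k : ℕ} {a : Fin k → ℕ}
    (ψ : Fin n → MvPolynomial (CoordIdx m a) ℂ) (V : Set (PSpace n))
    (hψ : IsBirationalParam ψ V) :
    -- every symmetric `H`: critical points and zero set of the critical ideal
    (∀ H : Matrix (Fin n) (Fin n) ℂ, H.IsSymm →
      paramCritPoints ψ V H = zeroSet (critIdeal ψ H) ∩ regNonIsotropic ψ V ∧
      zeroSet (critIdeal ψ H) = paramClosure {u | u ∈ nonIsotropic ψ ∧ GradVanishes ψ H u}) ∧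
    -- general `H`: the two sets agree
    ((∀ u ∈ nonIsotropic ψ, IsImmersiveAt ψ u) →
      ForGeneralSymm n fun H => paramCritPoints ψ V H = zeroSet (critIdeal ψ H)) ∧
    -- general `H`: the number of critical points is the Rayleigh-Ritz degree
    ∃ d : ℕ, IsRRDegree V d ∧
      (ForGeneralSymm n fun H =>
        {u ∈ paramCritPoints ψ V H | IsImmersiveAt ψ u}.Finite ∧
        {u ∈ paramCritPoints ψ V H | IsImmersiveAt ψ u}.ncard = d) ∧
      ((∀ u ∈ regNonIsotropic ψ V, IsImmersiveAt ψ u) →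
        ForGeneralSymm n fun H =>
          (paramCritPoints ψ V H).Finite ∧ (paramCritPoints ψ V H).ncard = d) := by
  obtain ⟨b, hb⟩ := hψ.multihomogeneous
  obtain ⟨d, hd⟩ := exists_generically_ncard hψ
  have himm : ∀ H, immersiveCrit ψ H ⊆ regNonIsotropic ψ V →
      {u ∈ paramCritPoints ψ V H | IsImmersiveAt ψ u} = immersiveCrit ψ H := by
    intro H hH
    ext u
    constructor
    · rintro ⟨⟨h1, h2⟩, h3⟩
      exact ⟨h1.2, h3, h2⟩
    · intro hu
      exact ⟨⟨hH hu, hu.2.2⟩, hu.2.1⟩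
  refine ⟨fun H hH => ⟨?_, zeroSet_critIdeal hb hH⟩, fun hall => ?_, d, ?_, ?_, fun hall => ?_⟩
  · ext u
    constructor
    · rintro ⟨h1, h2⟩
      exact ⟨(mem_zeroSet_critIdeal_iff hb hH h1.2).mpr h2, h1⟩
    · rintro ⟨h1, h2⟩
      exact ⟨h2, (mem_zeroSet_critIdeal_iff hb hH h2.2).mp h1⟩
  · refine (hd.mono ?_).forGeneralSymm
    rintro y ⟨hreg, ⟨hfin, -⟩, -⟩
    -- Immersivity off the quadric identifies all zeros of the gradient with `immersiveCrit`. This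
    -- set is finite, so taking the closure adds nothing, and `hreg` places it over the regular
    -- locus.
    have h1 : {u | u ∈ nonIsotropic ψ ∧ GradVanishes ψ (symMat y) u} =
        immersiveCrit ψ (symMat y) := by
      ext u
      exact ⟨fun h => ⟨h.1, hall u h.1, h.2⟩, fun h => ⟨h.1, h.2.2⟩⟩
    rw [zeroSet_critIdeal hb (symMat_isSymm y), h1, paramClosure_of_finite hfin]
    ext u
    exact ⟨fun h => ⟨h.1.2, hall u h.1.2, h.2⟩, fun h => ⟨hreg h, h.2.2⟩⟩
  · exact (hd.mono fun y hy => hy.2.2).forGeneralSymm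
  · refine (hd.mono ?_).forGeneralSymm
    rintro y ⟨hreg, hfin, -⟩
    rw [himm _ hreg]
    exact hfin
  · refine (hd.mono ?_).forGeneralSymm
    rintro y ⟨hreg, hfin, -⟩
    have h1 : paramCritPoints ψ V (symMat y) = immersiveCrit ψ (symMat y) := by
      rw [← himm _ hreg]
      ext u
      exact ⟨fun h => ⟨h, hall u h.1⟩, fun h => h.1⟩
    rw [h1]
    exact hfin
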